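/- \textbf{Setting.} A $q$-state spin system $\mathcal I=(G,[q],\boldsymbol b,\boldsymbol A)$, $q\ge 2$, consists of a finite simple graph $G=(V,E)$, vectors $b_v\in\mathbb R_{\ge0}^q$ ($v\in V$) and symmetric matrices $A_e\in\mathbb R_{\ge0}^{q\times q}$ ($e\in E$). Its weight is $w_{\mathcal I}(\sigma)=\prod_{v\in V}b_v(\sigma_v)\prod_{e=\{u,v\}\in E}A_e(\sigma_u,\sigma_v)$ for $\sigma\in[q]^V$, and, if $Z_{\mathcal I}=\sum_\sigma w_{\mathcal I}(\sigma)>0$, its Gibbs distribution is $\mu_{\mathcal I}=w_{\mathcal I}/Z_{\mathcal I}$. For $\Lambda\subseteq V$, $\sigma\in[q]^\Lambda$ and $\tau\in[q]^{V\setminus\Lambda}$ let $$w^\sigma_{\mathcal I}(\tau)=\prod_{v\in V\setminus\Lambda}b_v(\tau_v)\prod_{\substack{e=\{u,v\}\in E\\u,v\in V\setminus\Lambda}}A_e(\tau_u,\tau_v)\prod_{\substack{e=\{u,v\}\in E\\u\in\Lambda,\,v\in V\setminus\Lambda}}A_e(\sigma_u,\tau_v),\qquad Z^\sigma_{\mathcal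 I}=\sum_{\tau}w^\sigma_{\mathcal I}(\tau).$$ $\mathcal I$ is \emph{permissive} if $Z^\sigma_{\mathcal I}>0$ for all $\Lambda$ and $\sigma$; then $\mu^\sigma_{v,\mathcal I}$ ($v\notin\Lambda$) denotes the marginal at $v$ of the distribution $w^\sigma_{\mathcal I}/Z^\sigma_{\mathcal I}$. Write $S_\ell(v)$ for the set of vertices at distance exactly $\ell$ from $v$. A class $\mathfrak I$ of permissive spin systems, with an integer $\ell=\ell(q)\ge2$ for each $q$, satisfies \emph{multiplicative strong spatial mixing} if for every $q$-state instance $\mathcal I\in\mathfrak I$, with $\ell=\ell(q)$, every $\Lambda\subseteq V$, $v\in V\setminus\Lambda$, and all $\sigma,\tau\in[q]^\Lambda$ with $\min\{\mathrm{dist}_G(v,u)\mid u\in\Lambda,\ \sigma_u\ne\tau_u\}=\ell$, $$\forall a\in[q]:\quad\left|\frac{\mu^\sigma_{v,\mathcal I}(a)}{\mu^\tau_{v,\mathcal I}(a)}-1\right|\le\frac1{5|S_\ell(v)|}\qquad(\text{with }0/0=1).$$ An \emph{update} of $\mathcal I$ consists of a set $D_V\subseteq V$ with a new vector for each $v\in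 D_V$, and a set $D_E$ of unordered pairs of distinct vertices with a new symmetric nonnegative matrix for each $e\in D_E$; pairs of $D_E$ that are not edges are added to the graph. The result is the updated instance $\mathcal I'$ on a graph $G'=(V,E')$. Algorithms are programs for a randomized real random access machine: unit-cost reading and writing of array cells (with at most four indices) that hold natural or real numbers, addition, truncated subtraction and comparison of natural numbers, arithmetic and comparison of real numbers, and tosses of coins with computed probabilities. The input, stored in memory, consists of $q$, the number $\ell(q)$, the instance $\mathcal I$ (adjacency lists in any order, vectors, matrices), the update (lists of $D_V$ and $D_E$ with the new vectors and matrices), and a configuration $X$; the output is the configuration that replaces $X$ in memory. \begin{theorem}\label{theorem-dynamic} There are an algorithm and an absolute constant $C$ such that the following holds for every class $\mathfrak I$ of permissive spin systems that satisfies multiplicative strong spatial mixing with $\ell=\ell(q)\ge2$. Let $\mathcal I$ be any spin system with $Z_{\mathcal I}>0$ and $q\ge2$ spins, let an update be given for which the updated instance $\mathcal I'$ belongs to $\mathfrak I$, and let the input sample be random, $X\sim\mu_{\mathcal I}$, independent of the coins of the algorithm. Then the algorithm halts with probability $1$, its output $X'$ has exactly the law $\mu_{\mathcal I'}$, and its expected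 running time (over $X$ and the coins) is at most $$\Delta\cdot\max(|D_V|+|D_E|,1)\cdot q^{\,C\Delta^{\ell}},$$ where $\Delta$ is the maximum of $1$ and the maximum degree of $G'$, and $\ell=\ell(q)$. \end{theorem} -/

import Mathlib

open scoped NNReal ENNReal

namespace DynamicSampling

/-! ### Spin systems and their Gibbs distributions -/

/-- A `q`-state spin system on the vertex set `{0, …, n-1}`. A symmetric nonnegative `q × q` matrix
is a function on unordered pairs of spins; the values of `A` at non-edges of the graph are
never used. -/
structure SpinSystem (n q : ℕ) where
  graph : SimpleGraph (Fin n)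
  b : Fin n → Fin q → ℝ≥0
  A : Sym2 (Fin n) → Sym2 (Fin q) → ℝ≥0

/-- A configuration: an assignment of spins to the vertices. -/
abbrev Conf (n q : ℕ) : Type := Fin n → Fin q

namespace SpinSystem

variable {n q : ℕ}

open Classical in
/-- The set of edges, as a finset. -/
noncomputable def edges (I : SpinSystem n q) : Finset (Sym2 (Fin n)) :=
  Finset.univ.filter fun e => e ∈ I.graph.edgeSet

open Classical in
/-- The maximum degree of the graph. -/
noncomputable def maxDegree (I : SpinSystem n q) : ℕ := I.graph.maxDegree

/-- The weight `∏ b_v(σ_v) ∏ A_e(σ_u, σ_v)` of a configuration. -/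
noncomputable def weight (I : SpinSystem n q) (σ : Conf n q) : ℝ≥0 :=
  (∏ v, I.b v (σ v)) * ∏ e ∈ I.edges, I.A e (e.map σ)

/-- The partition function `Z`. -/
noncomputable def Z (I : SpinSystem n q) : ℝ≥0 := ∑ σ : Conf n q, I.weight σ

/-- The Gibbs probability `w(σ) / Z` of a configuration. -/
noncomputable def gibbsProb (I : SpinSystem n q) (σ : Conf n q) : ℝ≥0 := I.weight σ / I.Z

/-- The Gibbs distribution, as a probability distribution; it exists as soon as `Z ≠ 0`. -/
noncomputable def gibbs (I : SpinSystem n q) (h : I.Z ≠ 0) : PMF (Conf n q) :=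
  PMF.ofFintype (fun σ => (I.gibbsProb σ : ℝ≥0∞)) (by
    have h1 : ∑ σ : Conf n q, I.gibbsProb σ = 1 := by
      unfold gibbsProb
      rw [← Finset.sum_div]
      exact div_self h
    exact_mod_cast h1)

open Classical in
/-- Conditional weight given a boundary condition on `Λ`. A pair consisting of a partial
configuration on `Λ` and a configuration `τ` on the complement of `Λ` is written as one full
configuration `ρ`. The factors are the vertices outside `Λ` and the edges not contained in `Λ`. -/
noncomputable def condWeight (I : SpinSystem n q) (Λ : Finset (Fin n)) (ρ : Conf n q) : ℝ≥0 :=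
  (∏ v ∈ Finset.univ.filter (fun v => v ∉ Λ), I.b v (ρ v)) *
    ∏ e ∈ I.edges.filter (fun e => ∃ v ∈ e, v ∉ Λ), I.A e (e.map ρ)

open Classical in
/-- The full configurations that extend the partial configuration `σ` on `Λ` (the values of `σ`
outside `Λ` play no role). -/
noncomputable def extensions (Λ : Finset (Fin n)) (σ : Conf n q) : Finset (Conf n q) :=
  Finset.univ.filter fun ρ => ∀ v ∈ Λ, ρ v = σ v

/-- The conditional partition function `Z^σ` of the partial configuration `σ` on `Λ`. -/
noncomputable def condZ (I : SpinSystem n q) (Λ : Finset (Fin n)) (σ : Conf n q) : ℝ≥0 :=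
  ∑ ρ ∈ extensions Λ σ, I.condWeight Λ ρ

open Classical in
/-- The marginal probability `μ_v^σ(a)`, where `σ` is a partial configuration on `Λ`. -/
noncomputable def condMarginal (I : SpinSystem n q) (Λ : Finset (Fin n)) (σ : Conf n q)
    (v : Fin n) (a : Fin q) : ℝ≥0 :=
  (∑ ρ ∈ (extensions Λ σ).filter (fun ρ => ρ v = a), I.condWeight Λ ρ) / I.condZ Λ σ

/-- A spin system is permissive if all conditional partition functions are positive. -/
def Permissive (I : SpinSystem n q) : Prop :=
  ∀ (Λ : Finset (Fin n)) (σ : Conf n q), 0 < I.condZ Λ σ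

/-- The sphere of radius `ℓ` around `v`. -/
def sphere (I : SpinSystem n q) (ℓ : ℕ) (v : Fin n) : Set (Fin n) :=
  {u | I.graph.edist v u = (ℓ : ℕ∞)}

/-- Multiplicative strong spatial mixing at distance `ℓ`: if the distance from `v` to the set where
the partial configurations `σ` and `τ` on `Λ` differ equals `ℓ`, then
`|μ_v^σ(a) / μ_v^τ(a) - 1| ≤ 1 / (5 |S_ℓ(v)|)` for every spin `a`, where `0 / 0 = 1` (and where the
ratio is infinite if only the denominator vanishes). -/
def RatioSSM (I : SpinSystem n q) (ℓ : ℕ) : Prop :=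
  ∀ (v : Fin n) (Λ : Finset (Fin n)) (σ τ : Conf n q), v ∉ Λ →
    (⨅ u ∈ {u : Fin n | u ∈ Λ ∧ σ u ≠ τ u}, I.graph.edist v u) = (ℓ : ℕ∞) →
    ∀ a : Fin q,
      (I.condMarginal Λ σ v a = 0 ∧ I.condMarginal Λ τ v a = 0) ∨
      (I.condMarginal Λ τ v a ≠ 0 ∧
        |(I.condMarginal Λ σ v a : ℝ) / (I.condMarginal Λ τ v a : ℝ) - 1|
          ≤ 1 / (5 * ((I.sphere ℓ v).ncard : ℝ)))

end SpinSystem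

/-- An update `(D_V, D_E, C)`: new vectors for the vertices in `D_V`, new matrices for the pairs of
distinct vertices in `D_E`. The values of `b` outside `D_V` and of `A` outside `D_E` are never
used. -/
structure Update (n q : ℕ) where
  DV : Finset (Fin n)
  DE : Finset (Sym2 (Fin n))
  not_diag : ∀ e ∈ DE, ¬ e.IsDiag
  b : Fin n → Fin q → ℝ≥0
  A : Sym2 (Fin n) → Sym2 (Fin q) → ℝ≥0

open Classical in
/-- The updated instance: the vectors of the vertices in `D_V` are replaced, the pairs in `D_E` that
are not edges are added as edges, and all pairs in `D_E` get their new matrices. -/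
noncomputable def SpinSystem.update {n q : ℕ} (I : SpinSystem n q) (U : Update n q) :
    SpinSystem n q where
  graph := I.graph ⊔ SimpleGraph.fromEdgeSet (U.DE : Set (Sym2 (Fin n)))
  b := fun v => if v ∈ U.DV then U.b v else I.b v
  A := fun e => if e ∈ U.DE then U.A e else I.A e

/-! ### Randomized real random access machines

Programs are texts of an imperative language over two kinds of cells, holding natural numbers or
real numbers. Cells are organized in arrays with at most four indices. Natural numbers can be added,
subtracted and compared, and used as indices; real numbers can be added, subtracted, multiplied,
divided and compared; a coin with a computed probability can be tossed. A program is a finite text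
with no real constants other than natural numbers, and the execution of one command is one step, so
that a step consists of a number of elementary operations that is bounded in terms of the program
alone. -/

/-- The address of a cell: the name of the array and four indices (unused indices are `0`). -/
abbrev Addr : Type := ℕ × ℕ × ℕ × ℕ × ℕ

/-- The contents of all cells. -/
structure Memory where
  nat : Addr → ℕ
  real : Addr → ℝ

/-- Expressions for natural numbers; in `get a i j k l` the name `a` of the array is fixed by the
program text, the indices are computed. Subtraction is truncated at `0`. -/
inductive NExp
  | lit (c : ℕ)
  | get (a : ℕ) (i j k l : NExp)
  | add (x y : NExp)
  | sub (x y : NExp)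

/-- The value of an expression for natural numbers. -/
def NExp.eval (m : Memory) : NExp → ℕ
  | .lit c => c
  | .get a i j k l => m.nat (a, i.eval m, j.eval m, k.eval m, l.eval m)
  | .add x y => x.eval m + y.eval m
  | .sub x y => x.eval m - y.eval m

/-- A computed address. -/
structure AExp where
  arr : ℕ
  i : NExp
  j : NExp
  k : NExp
  l : NExp

/-- The value of a computed address. -/
def AExp.eval (m : Memory) (x : AExp) : Addr :=
  (x.arr, x.i.eval m, x.j.eval m, x.k.eval m, x.l.eval m)

/-- Expressions for real numbers; division by zero returns zero. -/
inductive RExp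
  | ofNat (x : NExp)
  | get (x : AExp)
  | add (x y : RExp)
  | sub (x y : RExp)
  | mul (x y : RExp)
  | div (x y : RExp)

/-- The value of an expression for real numbers. -/
noncomputable def RExp.eval (m : Memory) : RExp → ℝ
  | .ofNat x => (x.eval m : ℝ)
  | .get x => m.real (x.eval m)
  | .add x y => x.eval m + y.eval m
  | .sub x y => x.eval m - y.eval m
  | .mul x y => x.eval m * y.eval m
  | .div x y => x.eval m / y.eval m

/-- Tests. -/
inductive Test
  | natEq (x y : NExp)
  | natLt (x y : NExp)
  | realEq (x y : RExp)
  | realLt (x y : RExp)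
  | neg (s : Test)
  | conj (s t : Test)

/-- The truth value of a test. -/
def Test.holds (m : Memory) : Test → Prop
  | .natEq x y => x.eval m = y.eval m
  | .natLt x y => x.eval m < y.eval m
  | .realEq x y => x.eval m = y.eval m
  | .realLt x y => x.eval m < y.eval m
  | .neg s => ¬ s.holds m
  | .conj s t => s.holds m ∧ t.holds m

/-- Programs. The command `toss x p` stores `1` in the cell `x` of natural numbers with probability
`p` and `0` otherwise; a number `p` outside the unit interval is replaced by the nearest number
in it. -/
inductive Cmd
  | skip
  | setNat (x : AExp) (e : NExp)
  | setReal (x : AExp) (e : RExp)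
  | toss (x : AExp) (p : RExp)
  | seq (c d : Cmd)
  | ite (t : Test) (c d : Cmd)
  | loop (t : Test) (c : Cmd)

/-- Storing a natural number in a cell. -/
def Memory.writeNat (m : Memory) (x : Addr) (c : ℕ) : Memory :=
  { m with nat := Function.update m.nat x c }

/-- Storing a real number in a cell. -/
noncomputable def Memory.writeReal (m : Memory) (x : Addr) (r : ℝ) : Memory :=
  { m with real := Function.update m.real x r }

/-- A machine configuration: the list of commands that remain to be executed, and the memory. The
machine has halted when the list is empty. -/
abbrev Config : Type := List Cmd × Memory

/-- The toss of a coin that shows `true` with probability `min p 1`. -/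
noncomputable def coin (p : ℝ≥0) : PMF Bool :=
  PMF.ofFintype (fun c => if c then ((min p 1 : ℝ≥0) : ℝ≥0∞) else ((1 - min p 1 : ℝ≥0) : ℝ≥0∞)) (by
    simp)

open Classical in
/-- One step of the machine. A loop whose test holds executes its body and then itself again. -/
noncomputable def step : Config → PMF Config
  | ([], m) => PMF.pure ([], m)
  | (.skip :: r, m) => PMF.pure (r, m)
  | (.setNat x e :: r, m) => PMF.pure (r, m.writeNat (x.eval m) (e.eval m))
  | (.setReal x e :: r, m) => PMF.pure (r, m.writeReal (x.eval m) (e.eval m))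
  | (.toss x p :: r, m) =>
      (coin (p.eval m).toNNReal).map fun c =>
        (r, m.writeNat (x.eval m) (if c then 1 else 0))
  | (.seq c d :: r, m) => PMF.pure (c :: d :: r, m)
  | (.ite t c d :: r, m) => PMF.pure (if t.holds m then (c :: r, m) else (d :: r, m))
  | (.loop t c :: r, m) => PMF.pure (if t.holds m then (c :: .loop t c :: r, m) else (r, m))

/-- The distribution of the machine configuration after `t` steps of the program `P`, started from
a random memory. -/
noncomputable def configAt (P : Cmd) (start : PMF Memory) : ℕ → PMF Config
  | 0 => start.map fun m => ([P], m)
  | t + 1 => (configAt P start t).bind step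

/-- The expected number of steps until the machine halts, `∑ t, Pr[not halted after t steps]`. -/
noncomputable def expectedTime (P : Cmd) (start : PMF Memory) : ℝ≥0∞ :=
  ∑' t : ℕ, (configAt P start t).toOuterMeasure {c | c.1 ≠ []}

/-- The probability that the machine halts with a memory in the set `S`. -/
noncomputable def haltProb (P : Cmd) (start : PMF Memory) (S : Set Memory) : ℝ≥0∞ :=
  ⨆ t : ℕ, (configAt P start t).toOuterMeasure {c | c.1 = [] ∧ c.2 ∈ S}

/-! ### Input and output -/

/-- The lists by which an instance and an update are given to a machine: the adjacency list of each
vertex, the list of the vertices in `D_V`, and the list of the pairs in `D_E`, each pair being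
written in one of its two orders. The order of the entries of the lists is arbitrary. -/
structure Listing {n q : ℕ} (I : SpinSystem n q) (U : Update n q) where
  adj : Fin n → List (Fin n)
  adj_nodup : ∀ v, (adj v).Nodup
  mem_adj : ∀ v w, w ∈ adj v ↔ I.graph.Adj v w
  dv : List (Fin n)
  dv_nodup : dv.Nodup
  mem_dv : ∀ v, v ∈ dv ↔ v ∈ U.DV
  de : List (Fin n × Fin n)
  de_nodup : (de.map fun p => s(p.1, p.2)).Nodup
  mem_de : ∀ e, (e ∈ de.map fun p => s(p.1, p.2)) ↔ e ∈ U.DE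

open Classical in
/-- The initial memory.

Arrays of natural numbers: array `0` holds `n`, `q`, `ℓ`, `|D_V|`, `|D_E|`; array `1` holds the
configuration `X`; array `2` holds the degrees; cell `(v, i)` of array `3` holds the `i`-th neighbour
of `v`; array `4` lists `D_V`; arrays `5` and `6` list the two ends of the pairs in `D_E`.

Arrays of real numbers: cell `(v, a)` of array `0` holds `b_v(a)`; cell `(v, i, a, c)` of array `1`
holds `A_e(a, c)`, where `e` joins `v` to its `i`-th neighbour; cell `(i, a)` of array `2` holds the
new `b_v(a)`, where `v` is the `i`-th vertex in the list of `D_V`; cell `(i, a, c)` of array `3` holds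
the new `A_e(a, c)`, where `e` is the `i`-th pair in the list of `D_E`.

All other cells are `0`. -/
noncomputable def Listing.load {n q : ℕ} {I : SpinSystem n q} {U : Update n q} (L : Listing I U)
    (ℓ : ℕ) (X : Conf n q) : Memory where
  nat := fun
    | (0, 0, 0, 0, 0) => n
    | (0, 1, 0, 0, 0) => q
    | (0, 2, 0, 0, 0) => ℓ
    | (0, 3, 0, 0, 0) => L.dv.length
    | (0, 4, 0, 0, 0) => L.de.length
    | (1, v, 0, 0, 0) => if h : v < n then X ⟨v, h⟩ else 0
    | (2, v, 0, 0, 0) => if h : v < n then (L.adj ⟨v, h⟩).length else 0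
    | (3, v, i, 0, 0) =>
        if h : ∃ hv : v < n, i < (L.adj ⟨v, hv⟩).length then
          ((L.adj ⟨v, h.1⟩)[i]'h.2 : ℕ) else 0
    | (4, i, 0, 0, 0) => if h : i < L.dv.length then (L.dv[i] : ℕ) else 0
    | (5, i, 0, 0, 0) => if h : i < L.de.length then (L.de[i].1 : ℕ) else 0
    | (6, i, 0, 0, 0) => if h : i < L.de.length then (L.de[i].2 : ℕ) else 0
    | _ => 0
  real := fun
    | (0, v, a, 0, 0) =>
        if h : v < n ∧ a < q then (I.b ⟨v, h.1⟩ ⟨a, h.2⟩ : ℝ) else 0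
    | (1, v, i, a, c) =>
        if h : (∃ hv : v < n, i < (L.adj ⟨v, hv⟩).length) ∧ a < q ∧ c < q then
          (I.A s(⟨v, h.1.1⟩, (L.adj ⟨v, h.1.1⟩)[i]'h.1.2) s(⟨a, h.2.1⟩, ⟨c, h.2.2⟩) : ℝ) else 0
    | (2, i, a, 0, 0) =>
        if h : i < L.dv.length ∧ a < q then (U.b (L.dv[i]'h.1) ⟨a, h.2⟩ : ℝ) else 0
    | (3, i, a, c, 0) =>
        if h : i < L.de.length ∧ a < q ∧ c < q then
          (U.A s((L.de[i]'h.1).1, (L.de[i]'h.1).2) s(⟨a, h.2.1⟩, ⟨c, h.2.2⟩) : ℝ) else 0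
    | _ => 0

/-- The memories that hold the configuration `Y` in array `1`. -/
def holding {n q : ℕ} (Y : Conf n q) : Set Memory :=
  {m | ∀ v : Fin n, m.nat (1, v, 0, 0, 0) = Y v}

end DynamicSampling

/-! The algorithm keeps a stack R of vertices and a configuration X such that, given X on R, the
part of X off R has the conditional Gibbs law of the updated instance J. Once R is empty, X has the
Gibbs law of J.

At the beginning R consists of the vertices touched by the update and their neighbours. Every factor
that changes lies inside R, so the conditional law off R given the spins in R is common to the old
and the new instance. The touched vertices receive new spins, as a deterministic function of the
spins in R, such that the configuration has positive weight in J (`weight_start_ne_zero`,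
`condWeight_start`, `sum_start_le`).

A round takes a vertex u of R and the block of u: u itself and the vertices off R at distance less
than ℓ. All neighbours of the block lie in R or on the sphere S of radius ℓ. Let p be the marginal
of X_u at u given X outside of the block, and p' the same marginal when the boundary is replaced by
a reference that agrees with X on R and is constant elsewhere. The round accepts with probability p'
/ (p (1 + 1/(5|S|))). On acceptance the block is resampled given its boundary and u leaves R. For a
fixed boundary, the configurations with spin X_u at u have total conditional probability p; the
acceptance probability cancels p, and what remains depends on the spins in R only, so the law
becomes the one in which u is free (`sum_accept`). On rejection S joins R; the acceptance
probability is a function of the spins in R ∪ S, so the spins elsewhere keep their conditional law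
(`accept_congr`). `sum_step_le` combines both outcomes.

Spatial mixing enters twice. The upper bound on p'/p makes the quotient a probability
(`accept_le_one`). The lower bound makes a rejection so unlikely that its probability times 1 + |S|
is at most 4/5 (`reject_le`); hence |R| decreases by at least 1/5 per round in expectation, and a
multiple of |R| is a potential for the running time (`mainLoop_time`). A round enumerates all
configurations on a block of at most 2Δ^ℓ vertices, and its cost is polynomial in q^(2Δ^ℓ).

Programs are analysed by weakest pre-expectations. For a loop, every function compatible with one
unfolding is an upper bound, so only upper bounds are proved. This suffices for the exact law: the
output probabilities are at most the Gibbs probabilities, and the finite expected time leaves no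
mass on runs that do not halt, so that upper bounds with sum 1 are attained (`haltProb_eq`). -/

namespace DynamicSampling

/-! ### Weakest pre-expectations

`wp κ c f m` bounds `κ` times the expected running time of `c` from the memory `m` plus the
expected value of `f` at the final memory. -/

/-- The expectation of a function with nonnegative values. -/
noncomputable def expect {α : Type*} (p : PMF α) (f : α → ℝ≥0∞) : ℝ≥0∞ := ∑' x, p x * f x

section expect

variable {α β : Type*}

lemma expect_pure (a : α) (f : α → ℝ≥0∞) : expect (PMF.pure a) f = f a := by
  unfold expect
  rw [tsum_eq_single a]
  · simp
  · intro b hb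
    simp [PMF.pure_apply, hb]

lemma expect_bind (p : PMF α) (k : α → PMF β) (f : β → ℝ≥0∞) :
    expect (p.bind k) f = expect p fun a => expect (k a) f := by
  unfold expect
  simp only [PMF.bind_apply, ← ENNReal.tsum_mul_right, ← ENNReal.tsum_mul_left]
  rw [ENNReal.tsum_comm]
  simp only [mul_assoc]

lemma expect_map (p : PMF α) (g : α → β) (f : β → ℝ≥0∞) :
    expect (p.map g) f = expect p fun a => f (g a) := by
  unfold PMF.map
  rw [expect_bind]
  simp only [Function.comp, expect_pure]

lemma expect_mono (p : PMF α) {f g : α → ℝ≥0∞} (h : ∀ a, f a ≤ g a) :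
    expect p f ≤ expect p g :=
  ENNReal.tsum_le_tsum fun a => mul_le_mul_right (h a) _

lemma expect_mono_support (p : PMF α) {f g : α → ℝ≥0∞} (h : ∀ a, p a ≠ 0 → f a ≤ g a) :
    expect p f ≤ expect p g :=
  ENNReal.tsum_le_tsum fun a => by
    by_cases ha : p a = 0
    · simp [ha]
    · exact mul_le_mul_right (h a ha) _

lemma expect_add (p : PMF α) (f g : α → ℝ≥0∞) :
    expect p (fun a => f a + g a) = expect p f + expect p g := by
  unfold expect
  simp only [mul_add]
  exact ENNReal.tsum_add

lemma expect_const (p : PMF α) (c : ℝ≥0∞) : expect p (fun _ => c) = c := by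
  unfold expect
  rw [ENNReal.tsum_mul_right, p.tsum_coe, one_mul]

open Classical in
lemma toOuterMeasure_eq_expect (p : PMF α) (s : Set α) :
    p.toOuterMeasure s = expect p fun a => if a ∈ s then 1 else 0 := by
  rw [PMF.toOuterMeasure_apply]
  unfold expect
  refine tsum_congr fun a => ?_
  by_cases h : a ∈ s <;> simp [h]

lemma coin_expect (p : ℝ≥0) (f : Bool → ℝ≥0∞) :
    expect (coin p) f = ((min p 1 : ℝ≥0) : ℝ≥0∞) * f true
      + ((1 - min p 1 : ℝ≥0) : ℝ≥0∞) * f false := by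
  unfold expect coin
  rw [tsum_bool]
  simp [PMF.ofFintype_apply, add_comm]

end expect

open Classical in
/-- The expected cost `κ` per step plus the expected final value of `f`; for a loop, the least
function that is compatible with the unfolding of the loop. -/
noncomputable def wp (κ : ℝ≥0∞) : Cmd → (Memory → ℝ≥0∞) → Memory → ℝ≥0∞
  | .skip, f, m => κ + f m
  | .setNat x e, f, m => κ + f (m.writeNat (x.eval m) (e.eval m))
  | .setReal x e, f, m => κ + f (m.writeReal (x.eval m) (e.eval m))
  | .toss x p, f, m => κ + expect (coin (p.eval m).toNNReal) fun c =>
      f (m.writeNat (x.eval m) (if c then 1 else 0))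
  | .seq c d, f, m => κ + wp κ c (wp κ d f) m
  | .ite t c d, f, m => κ + if t.holds m then wp κ c f m else wp κ d f m
  | .loop t c, f, m => ⨅ (X : Memory → ℝ≥0∞)
      (_ : ∀ m, κ + (if t.holds m then wp κ c X m else f m) ≤ X m), X m

lemma wp_mono (κ : ℝ≥0∞) (c : Cmd) : ∀ {f g : Memory → ℝ≥0∞}, (∀ m, f m ≤ g m) →
    ∀ m, wp κ c f m ≤ wp κ c g m := by
  induction c with
  | skip => intro f g h m; simpa [wp] using add_le_add_right (h m) κ
  | setNat x e => intro f g h m; exact add_le_add_right (h _) κ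
  | setReal x e => intro f g h m; exact add_le_add_right (h _) κ
  | toss x p => intro f g h m; exact add_le_add_right (expect_mono _ fun _ => h _) κ
  | seq c d ihc ihd => intro f g h m; exact add_le_add_right (ihc (ihd h) m) κ
  | ite t c d ihc ihd =>
    intro f g h m
    simp only [wp]
    split_ifs
    · exact add_le_add_right (ihc h m) κ
    · exact add_le_add_right (ihd h m) κ
  | loop t c ih =>
    intro f g h m
    simp only [wp]
    refine le_iInf₂ fun X hX => iInf₂_le X fun m => le_trans (add_le_add_right ?_ κ) (hX m)
    split_ifs
    · exact le_rfl
    · exact h m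

open Classical in
-- Loop rule: an invariant bounds the loop because the infimum in `wp` runs over exactly these
-- functions.
lemma wp_loop_le {κ : ℝ≥0∞} {t : Test} {c : Cmd} {f X : Memory → ℝ≥0∞}
    (h : ∀ m, κ + (if t.holds m then wp κ c X m else f m) ≤ X m) (m : Memory) :
    wp κ (.loop t c) f m ≤ X m :=
  iInf₂_le X h

open Classical in
-- Knaster–Tarski: by monotonicity of the body, the infimum of all compatible functions is itself
-- compatible.
lemma wp_loop_unfold (κ : ℝ≥0∞) (t : Test) (c : Cmd) (f : Memory → ℝ≥0∞) (m : Memory) :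
    κ + (if t.holds m then wp κ c (wp κ (.loop t c) f) m else f m) ≤ wp κ (.loop t c) f m := by
  conv_rhs => rw [wp]
  refine le_iInf₂ fun X hX => le_trans (add_le_add_right ?_ κ) (hX m)
  split_ifs
  · exact wp_mono κ c (wp_loop_le hX) m
  · exact le_rfl

open Classical in
-- The unfolding of a compatible function is again compatible, so the infimum lies below its own
-- unfolding. Together with `wp_loop_unfold` the loop is a fixed point, and it may be unfolded in
-- upper bounds.
lemma wp_loop_le_unfold (κ : ℝ≥0∞) (t : Test) (c : Cmd) (f : Memory → ℝ≥0∞) (m : Memory) :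
    wp κ (.loop t c) f m
      ≤ κ + if t.holds m then wp κ c (wp κ (.loop t c) f) m else f m := by
  refine wp_loop_le (X := fun m' => κ + if t.holds m' then wp κ c (wp κ (.loop t c) f) m'
    else f m') (fun m' => add_le_add_right ?_ κ) m
  split_ifs
  · exact wp_mono κ c (fun m' => wp_loop_unfold κ t c f m') m'
  · exact le_rfl

/-- The bound for a machine configuration: the remaining commands are executed in order. -/
noncomputable def configWp (κ : ℝ≥0∞) (g : Memory → ℝ≥0∞) (c : Config) : ℝ≥0∞ :=
  c.1.foldr (wp κ) g c.2

/-- Supermartingale property: each step of the machine pays κ out of the bound for the remaining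
execution. Only the loop needs an argument, namely `wp_loop_unfold`. -/
lemma step_configWp (κ : ℝ≥0∞) (g : Memory → ℝ≥0∞) (c : Config) (hc : c.1 ≠ []) :
    κ + expect (step c) (configWp κ g) ≤ configWp κ g c := by
  obtain ⟨l, m⟩ := c
  cases l with
  | nil => exact absurd rfl hc
  | cons a r =>
    cases a with
    | skip => simp [step, expect_pure, configWp, wp]
    | setNat x e => simp [step, expect_pure, configWp, wp]
    | setReal x e => simp [step, expect_pure, configWp, wp]
    | toss x p => simp [step, expect_map, configWp, wp]
    | seq c d => simp [step, expect_pure, configWp, wp]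
    | ite t c d =>
      by_cases h : t.holds m <;> simp [step, expect_pure, configWp, wp, h]
    | loop t c =>
      have := wp_loop_unfold κ t c (r.foldr (wp κ) g) m
      by_cases h : t.holds m <;> simpa [step, expect_pure, configWp, h] using this

/-! ### Running time and output law of the machine from pre-expectations. -/

lemma expect_configAt_zero (κ : ℝ≥0∞) (P : Cmd) (start : PMF Memory) (g : Memory → ℝ≥0∞) :
    expect (configAt P start 0) (configWp κ g) = expect start (wp κ P g) := by
  simp [configAt, expect_map, configWp]

/-- With unit cost the supermartingale inequality telescopes: the survival probabilities of the
first T steps plus the remaining bound never exceed the initial bound. -/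
lemma expectedTime_le (P : Cmd) (start : PMF Memory) :
    expectedTime P start ≤ expect start (wp 1 P fun _ => 0) := by
  classical
  have key : ∀ T : ℕ, ∑ t ∈ Finset.range T, (configAt P start t).toOuterMeasure {c | c.1 ≠ []}
      + expect (configAt P start T) (configWp 1 fun _ => 0) ≤ expect start (wp 1 P fun _ => 0) := by
    intro T
    induction T with
    | zero => simp [expect_configAt_zero]
    | succ T ih =>
      refine le_trans ?_ ih
      rw [Finset.sum_range_succ, add_assoc]
      refine add_le_add_right ?_ _
      rw [toOuterMeasure_eq_expect, configAt, expect_bind, ← expect_add]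
      refine expect_mono _ fun c => ?_
      by_cases hc : c.1 = []
      · obtain ⟨l, m⟩ := c
        simp only at hc
        subst hc
        simp [step, expect_pure]
      · simpa [hc] using step_configWp 1 (fun _ => 0) c hc
  unfold expectedTime
  rw [ENNReal.tsum_eq_iSup_nat]
  exact iSup_le fun T => le_trans le_self_add (key T)

open Classical in
-- With cost 0 the pre-expectation of an indicator does not increase in expectation along the
-- execution, and at a halted configuration it equals the indicator.
lemma halted_le (P : Cmd) (start : PMF Memory) (S : Set Memory) (t : ℕ) :
    (configAt P start t).toOuterMeasure {c | c.1 = [] ∧ c.2 ∈ S}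
      ≤ expect start (wp 0 P fun m => if m ∈ S then 1 else 0) := by
  have key : expect (configAt P start t) (configWp 0 fun m => if m ∈ S then 1 else 0)
      ≤ expect start (wp 0 P fun m => if m ∈ S then 1 else 0) := by
    induction t with
    | zero => simp [expect_configAt_zero]
    | succ t ih =>
      refine le_trans ?_ ih
      rw [configAt, expect_bind]
      refine expect_mono _ fun c => ?_
      by_cases hc : c.1 = []
      · obtain ⟨l, m⟩ := c
        simp only at hc
        subst hc
        simp [step, expect_pure]
      · simpa using step_configWp 0 (fun m => if m ∈ S then 1 else 0) c hc
  refine le_trans ?_ key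
  rw [toOuterMeasure_eq_expect]
  refine expect_mono _ fun c => ?_
  obtain ⟨l, m⟩ := c
  by_cases hl : l = []
  · subst hl
    simp [configWp]
  · simp [hl]

/-- A program whose expected running time is finite and whose output has at most the probabilities
of a given distribution has exactly that distribution as the law of its output. -/
lemma haltProb_eq {α : Type*} [Fintype α] (P : Cmd) (start : PMF Memory) (S : α → Set Memory)
    (hS : ∀ a b m, m ∈ S a → m ∈ S b → a = b) (μ : α → ℝ≥0) (hμ : ∑ a, μ a = 1)
    (hle : ∀ a t, (configAt P start t).toOuterMeasure {c | c.1 = [] ∧ c.2 ∈ S a} ≤ μ a)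
    (hout : ∀ t, (configAt P start t).toOuterMeasure {c | c.1 = [] ∧ ∀ a, c.2 ∉ S a} = 0)
    (htime : expectedTime P start ≠ ∞) (a : α) :
    haltProb P start (S a) = μ a := by
  classical
  -- At each time the unit mass splits into runs that have not halted, runs with one of the outputs,
  -- and runs halted without an output; the last part vanishes by `hout`.
  have hsum : ∀ t, 1 = (configAt P start t).toOuterMeasure {c | c.1 ≠ []}
      + ∑ a, (configAt P start t).toOuterMeasure {c | c.1 = [] ∧ c.2 ∈ S a} := by
    intro t
    rw [← add_zero (_ + _), ← hout t]
    simp only [toOuterMeasure_eq_expect]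
    have : ∀ (s : Finset α) (f : α → Config → ℝ≥0∞),
        ∑ a ∈ s, expect (configAt P start t) (f a)
          = expect (configAt P start t) fun c => ∑ a ∈ s, f a c := by
      intro s f
      induction s using Finset.induction_on with
      | empty => simp [expect]
      | insert a s ha ih =>
        simp only [Finset.sum_insert ha]
        rw [expect_add, ih]
    rw [this, ← expect_add, ← expect_add]
    refine (expect_const (configAt P start t) 1).symm.trans ?_
    congr 1
    ext c
    by_cases hc : c.1 = []
    · by_cases hm : ∃ a, c.2 ∈ S a
      · obtain ⟨b, hb⟩ := hm
        have h1 : ∀ a, c.2 ∈ S a ↔ a = b := fun a => ⟨fun h => hS a b _ h hb, fun h => h ▸ hb⟩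
        simp [hc, h1]
      · push Not at hm
        simp [hc, hm]
    · simp [hc]
  -- Finite expected time is a convergent sum of survival probabilities, so these tend to 0.
  have hlim := ENNReal.tendsto_atTop_zero_of_tsum_ne_top htime
  refine le_antisymm (iSup_le fun t => hle a t) ?_
  refine ENNReal.le_of_forall_pos_le_add fun ε hε _ => ?_
  obtain ⟨t, ht⟩ := (ENNReal.tendsto_atTop_zero.1 hlim) ε (by exact_mod_cast hε)
  have ht := ht t le_rfl
  have h1 := hsum t
  -- All outcomes other than `a` are charged their upper bounds; the mass that is left for `a` is
  -- then at least `μ a - ε`.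
  rw [← Finset.add_sum_erase _ _ (Finset.mem_univ a)] at h1
  have h2 : ∑ b ∈ Finset.univ.erase a,
      (configAt P start t).toOuterMeasure {c | c.1 = [] ∧ c.2 ∈ S b}
      ≤ ∑ b ∈ Finset.univ.erase a, (μ b : ℝ≥0∞) := Finset.sum_le_sum fun b _ => hle b t
  have h3 : (μ a : ℝ≥0∞) + ∑ b ∈ Finset.univ.erase a, (μ b : ℝ≥0∞) = 1 := by
    rw [Finset.add_sum_erase _ (fun b => (μ b : ℝ≥0∞)) (Finset.mem_univ a)]
    exact_mod_cast hμ
  have h4 : ∑ b ∈ Finset.univ.erase a, (μ b : ℝ≥0∞) ≠ ∞ :=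
    ne_top_of_le_ne_top ENNReal.one_ne_top (h3 ▸ le_add_self)
  refine le_trans ?_ (add_le_add_left (le_iSup (fun t => (configAt P start t).toOuterMeasure
    {c | c.1 = [] ∧ c.2 ∈ S a}) t) _)
  refine (ENNReal.add_le_add_iff_right h4).1 ?_
  rw [h3, h1]
  calc _ ≤ (ε : ℝ≥0∞) + ((configAt P start t).toOuterMeasure {c | c.1 = [] ∧ c.2 ∈ S a}
        + ∑ b ∈ Finset.univ.erase a, (μ b : ℝ≥0∞)) := add_le_add ht (add_le_add_right h2 _)
    _ = _ := by ring

/-! ### Deterministic commands -/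

/-- Whether a command may write to a given array of natural numbers. -/
def Cmd.writesNat : Cmd → ℕ → Bool
  | .skip, _ => false
  | .setNat x _, a => x.arr == a
  | .setReal _ _, _ => false
  | .toss x _, a => x.arr == a
  | .seq c d, a => c.writesNat a || d.writesNat a
  | .ite _ c d, a => c.writesNat a || d.writesNat a
  | .loop _ c, a => c.writesNat a

/-- Whether a command may write to a given array of real numbers. -/
def Cmd.writesReal : Cmd → ℕ → Bool
  | .skip, _ => false
  | .setNat _ _, _ => false
  | .setReal x _, a => x.arr == a
  | .toss _ _, _ => false
  | .seq c d, a => c.writesReal a || d.writesReal a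
  | .ite _ c d, a => c.writesReal a || d.writesReal a
  | .loop _ c, a => c.writesReal a

/-- Two memories agree on all arrays to which the command does not write. -/
def Frame (c : Cmd) (m m' : Memory) : Prop :=
  (∀ a i, c.writesNat a = false → m'.nat (a, i) = m.nat (a, i)) ∧
    ∀ a i, c.writesReal a = false → m'.real (a, i) = m.real (a, i)

/-- The default proof `rfl` evaluates the syntactic write test, so for a concrete program the
untouched arrays are found by computation. -/
lemma Frame.nat {c : Cmd} {m m' : Memory} (h : Frame c m m') (a : ℕ) (i : ℕ × ℕ × ℕ × ℕ)
    (ha : c.writesNat a = false := by rfl) : m'.nat (a, i) = m.nat (a, i) := h.1 a i ha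

lemma Frame.real {c : Cmd} {m m' : Memory} (h : Frame c m m') (a : ℕ) (i : ℕ × ℕ × ℕ × ℕ)
    (ha : c.writesReal a = false := by rfl) : m'.real (a, i) = m.real (a, i) := h.2 a i ha

lemma Frame.refl (c : Cmd) (m : Memory) : Frame c m m := ⟨fun _ _ _ => rfl, fun _ _ _ => rfl⟩

/-- The command leads from the memory `m` to the memory `m'` in at most `T` steps, without any
dependence on coins. -/
structure Runs (c : Cmd) (m m' : Memory) (T : ℕ) : Prop where
  wp_le : ∀ κ f, wp κ c f m ≤ κ * T + f m'
  frame : Frame c m m'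

namespace Runs

variable {c d : Cmd} {m m₁ m₂ : Memory} {T T₁ T₂ : ℕ}

lemma nat (h : Runs c m m₁ T) (a : ℕ) (i : ℕ × ℕ × ℕ × ℕ)
    (ha : c.writesNat a = false := by rfl) : m₁.nat (a, i) = m.nat (a, i) := h.frame.nat a i ha

lemma real (h : Runs c m m₁ T) (a : ℕ) (i : ℕ × ℕ × ℕ × ℕ)
    (ha : c.writesReal a = false := by rfl) : m₁.real (a, i) = m.real (a, i) :=
  h.frame.real a i ha

lemma mono (h : Runs c m m₁ T₁) (hT : T₁ ≤ T₂) : Runs c m m₁ T₂ :=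
  ⟨fun κ f => (h.wp_le κ f).trans (by gcongr), h.frame⟩

lemma skip : Runs .skip m m 1 := ⟨fun κ f => by simp [wp], Frame.refl _ _⟩

lemma setNat (x : AExp) (e : NExp) :
    Runs (.setNat x e) m (m.writeNat (x.eval m) (e.eval m)) 1 := by
  refine ⟨fun κ f => by simp [wp], fun a i h => ?_, fun a i _ => rfl⟩
  simp only [Cmd.writesNat, beq_eq_false_iff_ne] at h
  refine Function.update_of_ne ?_ _ _
  intro h1
  exact h (congrArg Prod.fst h1).symm

lemma setReal (x : AExp) (e : RExp) :
    Runs (.setReal x e) m (m.writeReal (x.eval m) (e.eval m)) 1 := by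
  refine ⟨fun κ f => by simp [wp], fun a i _ => rfl, fun a i h => ?_⟩
  simp only [Cmd.writesReal, beq_eq_false_iff_ne] at h
  refine Function.update_of_ne ?_ _ _
  intro h1
  exact h (congrArg Prod.fst h1).symm

lemma seq (h₁ : Runs c m m₁ T₁) (h₂ : Runs d m₁ m₂ T₂) :
    Runs (.seq c d) m m₂ (T₁ + T₂ + 1) := by
  refine ⟨fun κ f => ?_, fun a i h => ?_, fun a i h => ?_⟩
  · rw [wp]
    calc κ + wp κ c (wp κ d f) m ≤ κ + (κ * T₁ + (κ * T₂ + f m₂)) :=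
          add_le_add_right ((h₁.wp_le κ _).trans (add_le_add_right (h₂.wp_le κ f) _)) _
      _ = _ := by push_cast; ring
  · simp only [Cmd.writesNat, Bool.or_eq_false_iff] at h
    rw [h₂.frame.1 a i h.2, h₁.frame.1 a i h.1]
  · simp only [Cmd.writesReal, Bool.or_eq_false_iff] at h
    rw [h₂.frame.2 a i h.2, h₁.frame.2 a i h.1]

lemma ite_true {t : Test} (ht : t.holds m) (h : Runs c m m₁ T) :
    Runs (.ite t c d) m m₁ (T + 1) := by
  refine ⟨fun κ f => ?_, fun a i hw => ?_, fun a i hw => ?_⟩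
  · rw [wp, if_pos ht]
    calc κ + wp κ c f m ≤ κ + (κ * T + f m₁) := add_le_add_right (h.wp_le κ _) _
      _ = _ := by push_cast; ring
  · simp only [Cmd.writesNat, Bool.or_eq_false_iff] at hw
    exact h.frame.1 a i hw.1
  · simp only [Cmd.writesReal, Bool.or_eq_false_iff] at hw
    exact h.frame.2 a i hw.1

lemma ite_false {t : Test} (ht : ¬ t.holds m) (h : Runs d m m₁ T) :
    Runs (.ite t c d) m m₁ (T + 1) := by
  refine ⟨fun κ f => ?_, fun a i hw => ?_, fun a i hw => ?_⟩
  · rw [wp, if_neg ht]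
    calc κ + wp κ d f m ≤ κ + (κ * T + f m₁) := add_le_add_right (h.wp_le κ _) _
      _ = _ := by push_cast; ring
  · simp only [Cmd.writesNat, Bool.or_eq_false_iff] at hw
    exact h.frame.1 a i hw.2
  · simp only [Cmd.writesReal, Bool.or_eq_false_iff] at hw
    exact h.frame.2 a i hw.2

lemma loop_false {t : Test} (ht : ¬ t.holds m) : Runs (.loop t c) m m 1 := by
  classical
  refine ⟨fun κ f => ?_, Frame.refl _ _⟩
  exact (wp_loop_le_unfold κ t c f m).trans (by simp [ht])

lemma loop_true {t : Test} (ht : t.holds m) (h₁ : Runs c m m₁ T₁)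
    (h₂ : Runs (.loop t c) m₁ m₂ T₂) : Runs (.loop t c) m m₂ (T₁ + T₂ + 1) := by
  classical
  refine ⟨fun κ f => ?_, fun a i h => ?_, fun a i h => ?_⟩
  · refine (wp_loop_le_unfold κ t c f m).trans ?_
    rw [if_pos ht]
    calc _ ≤ κ + (κ * T₁ + (κ * T₂ + f m₂)) :=
          add_le_add_right ((h₁.wp_le κ _).trans (add_le_add_right (h₂.wp_le κ f) _)) _
      _ = _ := by push_cast; ring
  · rw [h₂.frame.1 a i h]
    exact h₁.frame.1 a i h
  · rw [h₂.frame.2 a i h]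
    exact h₁.frame.2 a i h

end Runs

/-! ### Memory cells, variables and counting loops. -/

lemma Memory.nat_writeNat (m : Memory) (x y : Addr) (c : ℕ) :
    (m.writeNat x c).nat y = if y = x then c else m.nat y := Function.update_apply _ _ _ _

lemma Memory.real_writeNat (m : Memory) (x : Addr) (c : ℕ) :
    (m.writeNat x c).real = m.real := rfl

lemma Memory.real_writeReal (m : Memory) (x y : Addr) (r : ℝ) :
    (m.writeReal x r).real y = if y = x then r else m.real y := Function.update_apply _ _ _ _

lemma Memory.nat_writeReal (m : Memory) (x : Addr) (r : ℝ) :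
    (m.writeReal x r).nat = m.nat := rfl

/-- The cell of a variable: an array without indices. -/
abbrev varAddr (a : ℕ) : Addr := (a, 0, 0, 0, 0)

/-- The value of a variable. -/
abbrev NExp.var (a : ℕ) : NExp := .get a (.lit 0) (.lit 0) (.lit 0) (.lit 0)

/-- The address of a variable. -/
abbrev AExp.var (a : ℕ) : AExp := ⟨a, .lit 0, .lit 0, .lit 0, .lit 0⟩

/-- An entry of an array with one index. -/
abbrev NExp.get₁ (a : ℕ) (i : NExp) : NExp := .get a i (.lit 0) (.lit 0) (.lit 0)

/-- An entry of an array with two indices. -/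
abbrev NExp.get₂ (a : ℕ) (i j : NExp) : NExp := .get a i j (.lit 0) (.lit 0)

/-- Sequential execution. -/
infixr:60 " ;; " => Cmd.seq

/-- The loop `for i < N do body`. -/
def forLoop (i : ℕ) (N : NExp) (body : Cmd) : Cmd :=
  .setNat (.var i) (.lit 0) ;;
    .loop (.natLt (.var i) N) (body ;; .setNat (.var i) (.add (.var i) (.lit 1)))

/-- Each pass costs three steps besides the body: the unfolding of the loop, the sequencing and the
increment; initialisation, sequencing and the last test cost three more. The bound `B` on the number
of passes gives time bounds independent of the actual count. The invariant for `k + 1` is required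
after the increment, and the frame hypothesis hands every untouched array to the body for free. -/
lemma forLoop_runs {i : ℕ} {N : NExp} {body : Cmd} {m : Memory} (n B T : ℕ)
    (Inv : ℕ → Memory → Prop) (hn : n ≤ B) (hi : body.writesNat i = false)
    (h0 : Inv 0 (m.writeNat (varAddr i) 0))
    (hN : ∀ k ≤ n, ∀ m', Frame (forLoop i N body) m m' → Inv k m' → m'.nat (varAddr i) = k →
      N.eval m' = n)
    (hbody : ∀ k < n, ∀ m', Frame (forLoop i N body) m m' → Inv k m' → m'.nat (varAddr i) = k →
      ∃ m'', Runs body m' m'' T ∧ Inv (k + 1) (m''.writeNat (varAddr i) (k + 1))) :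
    ∃ m', Runs (forLoop i N body) m m' (B * (T + 3) + 3) ∧ Inv n m' ∧ m'.nat (varAddr i) = n := by
  have hw : ∀ a, (forLoop i N body).writesNat a = false ↔ i ≠ a ∧ body.writesNat a = false := by
    intro a
    simp only [forLoop, Cmd.writesNat, Bool.or_eq_false_iff, beq_eq_false_iff_ne, AExp.var]
    tauto
  have hr : ∀ a, (forLoop i N body).writesReal a = body.writesReal a := by
    intro a
    simp [forLoop, Cmd.writesReal]
  have key : ∀ r k, k + r = n → ∀ m', Frame (forLoop i N body) m m' → Inv k m' →
      m'.nat (varAddr i) = k → ∃ m'', Runs (.loop (.natLt (.var i) N)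
        (body ;; .setNat (.var i) (.add (.var i) (.lit 1)))) m' m'' (r * (T + 3) + 1) ∧
        Inv n m'' ∧ m''.nat (varAddr i) = n := by
    intro r
    induction r with
    | zero =>
      intro k hk m' hf hI hik
      obtain rfl : k = n := by omega
      refine ⟨m', (Runs.loop_false ?_).mono (by omega), hI, hik⟩
      have := hN k le_rfl m' hf hI hik
      simp only [Test.holds, NExp.eval, this]
      change ¬ m'.nat (varAddr i) < k
      omega
    | succ r ih =>
      intro k hk m' hf hI hik
      obtain ⟨m₁, h₁, hI₁⟩ := hbody k (by omega) m' hf hI hik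
      have hi₁ : m₁.nat (varAddr i) = k := by rw [h₁.frame.1 i _ hi]; exact hik
      have hset := Runs.setNat (m := m₁) (.var i) (.add (.var i) (.lit 1))
      have he : (AExp.var i).eval m₁ = varAddr i := rfl
      have he2 : (NExp.add (.var i) (.lit 1)).eval m₁ = k + 1 := by
        change m₁.nat (varAddr i) + 1 = k + 1
        rw [hi₁]
      rw [he, he2] at hset
      have hs := h₁.seq hset
      have hf' : Frame (forLoop i N body) m (m₁.writeNat (varAddr i) (k + 1)) := by
        refine ⟨fun a j ha => ?_, fun a j ha => ?_⟩
        · have ha' := (hw a).1 ha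
          rw [hs.frame.1 a j (by simp [Cmd.writesNat, ha'.1, ha'.2])]
          exact hf.1 a j ha
        · rw [hs.frame.2 a j (by rw [hr] at ha; simp [Cmd.writesReal, ha])]
          exact hf.2 a j ha
      obtain ⟨m₂, h₂, hI₂, hi₂⟩ := ih (k + 1) (by omega) _ hf' hI₁
        (by simp [Memory.nat_writeNat])
      refine ⟨m₂, (Runs.loop_true ?_ hs h₂).mono (le_of_eq (by ring)), hI₂, hi₂⟩
      have := hN k (by omega) m' hf hI hik
      simp only [Test.holds, NExp.eval, this]
      change m'.nat (varAddr i) < n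
      omega
  have hset := Runs.setNat (m := m) (.var i) (.lit 0)
  have he : (AExp.var i).eval m = varAddr i := rfl
  have he2 : (NExp.lit 0).eval m = 0 := rfl
  rw [he, he2] at hset
  obtain ⟨m₂, h₂, hI₂, hi₂⟩ := key n 0 (by omega) (m.writeNat (varAddr i) 0) (by
    refine ⟨fun a j ha => ?_, fun a j _ => rfl⟩
    exact hset.frame.1 a j (by simpa [Cmd.writesNat] using ((hw a).1 ha).1)) h0
    (by simp [Memory.nat_writeNat])
  refine ⟨m₂, (hset.seq h₂).mono ?_, hI₂, hi₂⟩
  have : n * (T + 3) ≤ B * (T + 3) := Nat.mul_le_mul_right _ hn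
  omega

namespace SpinSystem

/-! ### Conditional distributions -/

variable {n q : ℕ}

lemma mem_extensions {Λ : Finset (Fin n)} {σ ρ : Conf n q} :
    ρ ∈ extensions Λ σ ↔ ∀ v ∈ Λ, ρ v = σ v := by
  simp [extensions]

lemma extensions_congr {Λ : Finset (Fin n)} {σ τ : Conf n q} (h : ∀ v ∈ Λ, σ v = τ v) :
    extensions Λ σ = extensions Λ τ := by
  ext ρ
  simp only [mem_extensions]
  exact forall₂_congr fun v hv => by rw [h v hv]

/-- The configuration that equals `σ` on `Λ` and `ρ` elsewhere. -/
def glue (Λ : Finset (Fin n)) (σ ρ : Conf n q) : Conf n q := fun v => if v ∈ Λ then σ v else ρ v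

/-- Replacing the values on Λ is a bijection between the two sets of extensions, which allows a
termwise comparison of sums under different boundary conditions. -/
lemma sum_extensions_glue {M : Type*} [AddCommMonoid M] (Λ : Finset (Fin n)) (σ τ : Conf n q)
    (f : Conf n q → M) :
    ∑ ρ ∈ extensions Λ σ, f ρ = ∑ ρ ∈ extensions Λ τ, f (glue Λ σ ρ) := by
  refine Finset.sum_nbij' (glue Λ τ) (glue Λ σ) ?_ ?_ ?_ ?_ ?_
  · intro ρ _
    simp +contextual [mem_extensions, glue]
  · intro ρ _
    simp +contextual [mem_extensions, glue]
  · intro ρ hρ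
    rw [mem_extensions] at hρ
    ext v
    by_cases hv : v ∈ Λ <;> simp [glue, hv, hρ]
  · intro ρ hρ
    rw [mem_extensions] at hρ
    ext v
    by_cases hv : v ∈ Λ <;> simp [glue, hv, hρ]
  · intro ρ hρ
    rw [mem_extensions] at hρ
    congr 1
    ext v
    by_cases hv : v ∈ Λ <;> simp [glue, hv, hρ]

open Classical in
/-- Representatives of the restrictions to `Λ` of the extensions of `σ` from `R`. -/
noncomputable def classReps (R Λ : Finset (Fin n)) (σ : Conf n q) : Finset (Conf n q) :=
  Finset.univ.filter fun τ => (∀ v ∈ R, τ v = σ v) ∧ ∀ v, v ∉ Λ → τ v = σ v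

/-- Tower rule: the extensions of σ from R are sorted by their restriction to the larger set Λ. A
representative takes the values of σ off Λ, so that each class has exactly one. -/
lemma sum_extensions_classes {M : Type*} [AddCommMonoid M] {R Λ : Finset (Fin n)} (hR : R ⊆ Λ)
    (σ : Conf n q) (f : Conf n q → M) :
    ∑ ρ ∈ extensions R σ, f ρ = ∑ τ ∈ classReps R Λ σ, ∑ ρ ∈ extensions Λ τ, f ρ := by
  classical
  rw [← Finset.sum_fiberwise_of_maps_to (s := extensions R σ) (t := classReps R Λ σ)
    (g := fun ρ => glue Λ ρ σ)]
  · refine Finset.sum_congr rfl fun τ hτ => Finset.sum_congr ?_ fun _ _ => rfl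
    simp only [classReps, Finset.mem_filter, Finset.mem_univ, true_and] at hτ
    ext ρ
    simp only [Finset.mem_filter, mem_extensions]
    constructor
    · rintro ⟨_, h⟩ v hv
      rw [← h]
      simp [glue, hv]
    · intro h
      refine ⟨fun v hv => by rw [h v (hR hv), hτ.1 v hv], ?_⟩
      ext v
      by_cases hv : v ∈ Λ
      · simp [glue, hv, h v hv]
      · simp [glue, hv, hτ.2 v hv]
  · intro ρ hρ
    rw [mem_extensions] at hρ
    simp only [classReps, Finset.mem_filter, Finset.mem_univ, true_and]
    refine ⟨fun v hv => ?_, fun v hv => ?_⟩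
    · simp [glue, hR hv, hρ v hv]
    · simp [glue, hv]

variable (I : SpinSystem n q)

open Classical in
/-- The factors of the weight that are determined by the configuration on `Λ`. -/
noncomputable def innerWeight (Λ : Finset (Fin n)) (ρ : Conf n q) : ℝ≥0 :=
  (∏ v ∈ Λ, I.b v (ρ v)) * ∏ e ∈ I.edges.filter (fun e => ∀ v ∈ e, v ∈ Λ), I.A e (e.map ρ)

/-- A factor is either determined by Λ or involves a vertex off Λ. Among configurations with the
same values on Λ the weight is therefore proportional to the conditional weight. -/
lemma weight_eq (Λ : Finset (Fin n)) (ρ : Conf n q) :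
    I.weight ρ = I.innerWeight Λ ρ * I.condWeight Λ ρ := by
  classical
  unfold weight innerWeight condWeight
  have h1 : ∏ v, I.b v (ρ v) = (∏ v ∈ Λ, I.b v (ρ v))
      * ∏ v ∈ Finset.univ.filter (fun v => v ∉ Λ), I.b v (ρ v) := by
    rw [← Finset.prod_filter_mul_prod_filter_not Finset.univ (fun v => v ∈ Λ)]
    congr 2
    ext v
    simp
  have h2 : ∏ e ∈ I.edges, I.A e (e.map ρ)
      = (∏ e ∈ I.edges.filter (fun e => ∀ v ∈ e, v ∈ Λ), I.A e (e.map ρ))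
      * ∏ e ∈ I.edges.filter (fun e => ∃ v ∈ e, v ∉ Λ), I.A e (e.map ρ) := by
    rw [← Finset.prod_filter_mul_prod_filter_not I.edges (fun e => ∀ v ∈ e, v ∈ Λ)]
    congr 2
    ext e
    simp
  rw [h1, h2]
  ring

lemma map_congr_of_mem {e : Sym2 (Fin n)} {σ τ : Conf n q} (h : ∀ v ∈ e, σ v = τ v) :
    e.map σ = e.map τ := Sym2.map_congr h

lemma innerWeight_congr {Λ : Finset (Fin n)} {σ τ : Conf n q} (h : ∀ v ∈ Λ, σ v = τ v) :
    I.innerWeight Λ σ = I.innerWeight Λ τ := by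
  classical
  unfold innerWeight
  congr 1
  · exact Finset.prod_congr rfl fun v hv => by rw [h v hv]
  · refine Finset.prod_congr rfl fun e he => ?_
    rw [map_congr_of_mem fun v hv => h v ((Finset.mem_filter.1 he).2 v hv)]

/-- Configurations that agree off `Λ` and on the vertices of `Λ` that have a neighbour off `Λ` have
the same conditional weight. -/
lemma condWeight_congr {Λ : Finset (Fin n)} {σ τ : Conf n q} (h : ∀ v, v ∉ Λ → σ v = τ v)
    (h' : ∀ v w, v ∈ Λ → w ∉ Λ → I.graph.Adj w v → σ v = τ v) :
    I.condWeight Λ σ = I.condWeight Λ τ := by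
  classical
  unfold condWeight
  congr 1
  · exact Finset.prod_congr rfl fun v hv => by rw [h v (Finset.mem_filter.1 hv).2]
  · refine Finset.prod_congr rfl fun e he => ?_
    obtain ⟨he, w, hw, hwΛ⟩ := Finset.mem_filter.1 he
    rw [map_congr_of_mem]
    intro v hv
    by_cases hvΛ : v ∈ Λ
    · refine h' v w hvΛ hwΛ ?_
      have he : e ∈ I.graph.edgeSet := by simpa [edges] using he
      have hne : w ≠ v := fun h => hwΛ (h ▸ hvΛ)
      rw [(Sym2.mem_and_mem_iff hne).1 ⟨hw, hv⟩] at he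
      exact he
    · exact h v hvΛ

open Classical in
/-- The numerator of the conditional marginal. -/
noncomputable def condPart (Λ : Finset (Fin n)) (σ : Conf n q) (v : Fin n) (a : Fin q) : ℝ≥0 :=
  ∑ ρ ∈ (extensions Λ σ).filter (fun ρ => ρ v = a), I.condWeight Λ ρ

lemma condMarginal_eq (Λ : Finset (Fin n)) (σ : Conf n q) (v : Fin n) (a : Fin q) :
    I.condMarginal Λ σ v a = I.condPart Λ σ v a / I.condZ Λ σ := rfl

/-- Spatial Markov property: only the vertices of Λ with a neighbour off Λ enter the conditional
weights. Gluing σ into the extensions of τ preserves all of them. -/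
lemma condMarginal_congr {Λ : Finset (Fin n)} {σ τ : Conf n q} {u : Fin n} (hu : u ∉ Λ)
    (h : ∀ v w, v ∈ Λ → w ∉ Λ → I.graph.Adj w v → σ v = τ v) (a : Fin q) :
    I.condMarginal Λ σ u a = I.condMarginal Λ τ u a := by
  classical
  have hcw : ∀ ρ ∈ extensions Λ τ, I.condWeight Λ (glue Λ σ ρ) = I.condWeight Λ ρ := by
    intro ρ hρ
    rw [mem_extensions] at hρ
    refine I.condWeight_congr (fun v hv => by simp [glue, hv]) fun v w hv hw hvw => ?_
    simp [glue, hv, hρ v hv, h v w hv hw hvw]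
  have h1 : I.condZ Λ σ = I.condZ Λ τ := by
    unfold condZ
    rw [sum_extensions_glue Λ σ τ]
    exact Finset.sum_congr rfl hcw
  have h2 : I.condPart Λ σ u a = I.condPart Λ τ u a := by
    unfold condPart
    rw [Finset.sum_filter, Finset.sum_filter, sum_extensions_glue Λ σ τ]
    refine Finset.sum_congr rfl fun ρ hρ => ?_
    rw [hcw ρ hρ]
    simp [glue, hu]
  rw [condMarginal_eq, condMarginal_eq, h1, h2]

lemma condMarginal_congr_on {Λ : Finset (Fin n)} {σ τ : Conf n q} (h : ∀ v ∈ Λ, σ v = τ v)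
    (u : Fin n) (a : Fin q) : I.condMarginal Λ σ u a = I.condMarginal Λ τ u a := by
  unfold condMarginal condZ
  rw [extensions_congr h]

/-- The expectation of `H` when the configuration off `Λ` is sampled from the conditional
distribution given the configuration on `Λ`. -/
noncomputable def resample (Λ : Finset (Fin n)) (ρ : Conf n q) (H : Conf n q → ℝ≥0∞) : ℝ≥0∞ :=
  (∑ ρ' ∈ extensions Λ ρ, (I.condWeight Λ ρ' : ℝ≥0∞) * H ρ') / I.condZ Λ ρ

lemma resample_congr {Λ : Finset (Fin n)} {σ τ : Conf n q} (h : ∀ v ∈ Λ, σ v = τ v)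
    (H : Conf n q → ℝ≥0∞) : I.resample Λ σ H = I.resample Λ τ H := by
  unfold resample condZ
  rw [extensions_congr h]

variable {I}

lemma resample_const (hI : I.Permissive) (Λ : Finset (Fin n)) (ρ : Conf n q) (c : ℝ≥0∞) :
    I.resample Λ ρ (fun _ => c) = c := by
  unfold resample
  rw [← Finset.sum_mul]
  have h1 : (∑ ρ' ∈ extensions Λ ρ, (I.condWeight Λ ρ' : ℝ≥0∞)) = (I.condZ Λ ρ : ℝ≥0∞) := by
    unfold condZ
    push_cast
    rfl
  rw [h1, mul_comm, mul_div_assoc, ENNReal.div_self, mul_one]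
  · exact_mod_cast (hI Λ ρ).ne'
  · exact ENNReal.coe_ne_top

/-- Resampling from a configuration of positive weight reaches only configurations of positive
weight, so the bound on `H` is needed only there. This matters for a potential that is infinite
elsewhere. -/
lemma resample_le (hI : I.Permissive) {Λ : Finset (Fin n)} {ρ : Conf n q} (hρ : I.weight ρ ≠ 0)
    {H : Conf n q → ℝ≥0∞} {c : ℝ≥0∞} (hH : ∀ ρ', I.weight ρ' ≠ 0 → H ρ' ≤ c) :
    I.resample Λ ρ H ≤ c := by
  rw [← resample_const hI Λ ρ c]
  unfold resample
  refine ENNReal.div_le_div_right (Finset.sum_le_sum fun ρ' hρ' => ?_) _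
  by_cases h0 : I.condWeight Λ ρ' = 0
  · simp [h0]
  · refine mul_le_mul_right (hH ρ' ?_) _
    rw [I.weight_eq Λ, I.innerWeight_congr (mem_extensions.1 hρ')]
    rw [I.weight_eq Λ] at hρ
    exact mul_ne_zero (left_ne_zero_of_mul hρ) h0

/-! ### One step of the sampler -/

variable (I)

open Classical in
/-- The sphere, as a finset. -/
noncomputable def sphereFinset (ℓ : ℕ) (u : Fin n) : Finset (Fin n) :=
  Finset.univ.filter fun v => I.graph.edist u v = (ℓ : ℕ∞)

open Classical in
/-- The vertex `u` together with the vertices off `R` at distance less than `ℓ` from `u`. -/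
noncomputable def block (ℓ : ℕ) (R : Finset (Fin n)) (u : Fin n) : Finset (Fin n) :=
  Finset.univ.filter fun v => v = u ∨ (v ∉ R ∧ I.graph.edist u v < (ℓ : ℕ∞))

/-- The configuration that agrees with `X` on `R` and has the first spin elsewhere. -/
def refConf [NeZero q] (R : Finset (Fin n)) (X : Conf n q) : Conf n q :=
  fun v => if v ∈ R then X v else 0

/-- The probability of acceptance. -/
noncomputable def accept [NeZero q] (ℓ : ℕ) (R : Finset (Fin n)) (u : Fin n) (X : Conf n q) :
    ℝ≥0 :=
  I.condMarginal (I.block ℓ R u)ᶜ (refConf R X) u (X u) /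
    (I.condMarginal (I.block ℓ R u)ᶜ X u (X u) * (1 + 1 / (5 * (I.sphereFinset ℓ u).card)))

variable {I} {ℓ : ℕ} {R : Finset (Fin n)} {u : Fin n}

lemma mem_block {v : Fin n} :
    v ∈ I.block ℓ R u ↔ v = u ∨ (v ∉ R ∧ I.graph.edist u v < (ℓ : ℕ∞)) := by
  simp [block]

lemma mem_sphereFinset {v : Fin n} :
    v ∈ I.sphereFinset ℓ u ↔ I.graph.edist u v = (ℓ : ℕ∞) := by
  simp [sphereFinset]

lemma ncard_sphere : (I.sphere ℓ u).ncard = (I.sphereFinset ℓ u).card := by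
  rw [← Set.ncard_coe_finset]
  congr 1
  ext v
  simp [sphere, mem_sphereFinset]

/-- The neighbours of a block lie in `R` or on the sphere. -/
lemma mem_of_adj_block (hℓ : 1 ≤ ℓ) {v w : Fin n} (hv : v ∈ (I.block ℓ R u)ᶜ)
    (hw : w ∉ (I.block ℓ R u)ᶜ) (hvw : I.graph.Adj w v) : v ∈ R ∪ I.sphereFinset ℓ u := by
  rw [Finset.mem_compl, not_not, mem_block] at hw
  rw [Finset.mem_compl, mem_block] at hv
  rw [Finset.mem_union, mem_sphereFinset]
  by_contra hcon
  push Not at hcon hv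
  have h1 := hv.2 hcon.1
  have h2 : I.graph.edist u w + 1 ≤ (ℓ : ℕ∞) := by
    rcases hw with rfl | hw
    · rw [SimpleGraph.edist_self]
      exact_mod_cast hℓ
    · exact Order.add_one_le_of_lt hw.2
  have h3 : I.graph.edist u v ≤ I.graph.edist u w + 1 := by
    refine (SimpleGraph.edist_triangle (v := w)).trans ?_
    rw [SimpleGraph.edist_eq_one_iff_adj.2 hvw]
  exact hcon.2 (le_antisymm (h3.trans h2) h1)

/-- The reference depends on the spins in R only, and the true marginal on the neighbours of the
block, which lie in R or on the sphere. A rejection thus reveals nothing beyond R and the sphere. -/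
lemma accept_congr [NeZero q] (hℓ : 1 ≤ ℓ) (hu : u ∈ R) {X Y : Conf n q}
    (h : ∀ v ∈ R ∪ I.sphereFinset ℓ u, X v = Y v) :
    I.accept ℓ R u X = I.accept ℓ R u Y := by
  have h1 : refConf R X = refConf R Y := by
    ext v
    by_cases hv : v ∈ R
    · simp [refConf, hv, h v (Finset.mem_union_left _ hv)]
    · simp [refConf, hv]
  have h2 : X u = Y u := h u (Finset.mem_union_left _ hu)
  unfold accept
  rw [h1, h2, I.condMarginal_congr (σ := X) (τ := Y) (by simp [mem_block])]
  intro v w hv hw hvw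
  exact h v (mem_of_adj_block hℓ hv hw hvw)

/-- Spatial mixing compares the marginals for the boundary conditions `X` and `refConf R X`. -/
lemma marginal_ratio [NeZero q] (hssm : I.RatioSSM ℓ) (hℓ : 1 ≤ ℓ) (X : Conf n q)
    (a : Fin q) :
    (I.condMarginal (I.block ℓ R u)ᶜ (refConf R X) u a = 0 ∧
      I.condMarginal (I.block ℓ R u)ᶜ X u a = 0) ∨
    (I.condMarginal (I.block ℓ R u)ᶜ X u a ≠ 0 ∧
      |(I.condMarginal (I.block ℓ R u)ᶜ (refConf R X) u a : ℝ)
        / (I.condMarginal (I.block ℓ R u)ᶜ X u a : ℝ) - 1|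
          ≤ 1 / (5 * ((I.sphereFinset ℓ u).card : ℝ))) := by
  classical
  set Λ := (I.block ℓ R u)ᶜ with hΛ
  have huΛ : u ∉ Λ := by simp [hΛ, mem_block]
  -- Spatial mixing requires the differences to have minimal distance exactly ℓ. The intermediate
  -- `Y` differs from `X` on the sphere only, and it agrees with the reference on all neighbours of
  -- the block.
  let Y : Conf n q := fun v => if v ∈ I.sphereFinset ℓ u ∧ v ∉ R then 0 else X v
  have h1 : I.condMarginal Λ (refConf R X) u a = I.condMarginal Λ Y u a := by
    refine I.condMarginal_congr huΛ (fun v w hv hw hvw => ?_) a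
    have := mem_of_adj_block hℓ hv hw hvw
    by_cases hvR : v ∈ R
    · simp [refConf, hvR, Y]
    · have : v ∈ I.sphereFinset ℓ u := by simpa [hvR] using this
      simp [refConf, hvR, Y, this]
  rw [h1]
  -- If `Y` and `X` agree on Λ, the infimum of distances is infinite and the mixing hypothesis is
  -- silent; the marginals then coincide.
  by_cases hd : ∃ v ∈ Λ, Y v ≠ X v
  · rw [← ncard_sphere]
    refine hssm u Λ Y X huΛ ?_ a
    have hall : ∀ v ∈ {v : Fin n | v ∈ Λ ∧ Y v ≠ X v}, I.graph.edist u v = ℓ := by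
      rintro v ⟨_, hv⟩
      by_contra hne
      exact hv (by simp [Y, mem_sphereFinset, hne])
    obtain ⟨v, hv, hvY⟩ := hd
    refine le_antisymm ?_ (le_iInf₂ fun w hw => (hall w hw).ge)
    exact (iInf₂_le v ⟨hv, hvY⟩).trans (hall v ⟨hv, hvY⟩).le
  · push Not at hd
    rw [I.condMarginal_congr_on hd]
    by_cases h0 : I.condMarginal Λ X u a = 0
    · exact Or.inl ⟨h0, h0⟩
    · refine Or.inr ⟨h0, ?_⟩
      rw [div_self (by exact_mod_cast h0)]
      simp

/-- The factor 1 + 1/(5|S|) in the denominator is exactly the upper bound that mixing gives for the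
quotient of the marginals; a vanishing denominator gives 0. -/
lemma accept_le_one [NeZero q] (hssm : I.RatioSSM ℓ) (hℓ : 1 ≤ ℓ) (X : Conf n q) :
    I.accept ℓ R u X ≤ 1 := by
  have h := marginal_ratio hssm hℓ (R := R) (u := u) X (X u)
  unfold accept
  generalize I.condMarginal (I.block ℓ R u)ᶜ (refConf R X) u (X u) = x at h ⊢
  generalize I.condMarginal (I.block ℓ R u)ᶜ X u (X u) = y at h ⊢
  generalize (I.sphereFinset ℓ u).card = k at h ⊢
  rcases h with h | ⟨h0, h⟩
  · simp [h.1]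
  · refine div_le_one_of_le₀ ?_ zero_le
    rw [← NNReal.coe_le_coe]
    push_cast
    have h0' : (0 : ℝ) < y := NNReal.coe_pos.2 (pos_iff_ne_zero.2 h0)
    have := (abs_le.1 h).2
    rw [mul_comm, ← div_le_iff₀ h0']
    linarith

/-- On rejection at most `|S_ℓ|` vertices enter the stack; a rejection is so unlikely that the stack
shrinks in expectation. -/
lemma reject_le [NeZero q] (hssm : I.RatioSSM ℓ) (hℓ : 1 ≤ ℓ) (X : Conf n q)
    (hX : I.weight X ≠ 0) :
    (1 - I.accept ℓ R u X) * (1 + (I.sphereFinset ℓ u).card) ≤ 4 / 5 := by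
  classical
  -- `X` itself contributes a positive term to the marginal of its spin at `u`, so the alternative
  -- 0/0 in the mixing hypothesis is excluded.
  have hne : I.condMarginal (I.block ℓ R u)ᶜ X u (X u) ≠ 0 := by
    rw [I.weight_eq (I.block ℓ R u)ᶜ] at hX
    have hcw := right_ne_zero_of_mul hX
    have hpart : I.condPart (I.block ℓ R u)ᶜ X u (X u) ≠ 0 := by
      unfold condPart
      refine (lt_of_lt_of_le (pos_iff_ne_zero.2 hcw) (Finset.single_le_sum
        (f := fun ρ => I.condWeight (I.block ℓ R u)ᶜ ρ) (fun _ _ => zero_le) ?_)).ne'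
      simp [mem_extensions]
    have hZ : I.condZ (I.block ℓ R u)ᶜ X ≠ 0 := by
      unfold condZ
      refine (lt_of_lt_of_le (pos_iff_ne_zero.2 hcw) (Finset.single_le_sum
        (f := fun ρ => I.condWeight (I.block ℓ R u)ᶜ ρ) (fun _ _ => zero_le) ?_)).ne'
      simp [mem_extensions]
    rw [condMarginal_eq]
    exact div_ne_zero hpart hZ
  have hle : I.accept ℓ R u X ≤ 1 := accept_le_one hssm hℓ X
  rcases marginal_ratio hssm hℓ X (X u) with h | ⟨h0, h⟩
  · exact absurd h.2 hne
  rw [← NNReal.coe_le_coe]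
  rw [NNReal.coe_mul, NNReal.coe_sub hle]
  unfold accept
  push_cast
  have h0' : (0 : ℝ) < I.condMarginal (I.block ℓ R u)ᶜ X u (X u) :=
    NNReal.coe_pos.2 (pos_iff_ne_zero.2 h0)
  rw [← div_div]
  set r : ℝ := (I.condMarginal (I.block ℓ R u)ᶜ (refConf R X) u (X u) : ℝ)
    / (I.condMarginal (I.block ℓ R u)ᶜ X u (X u) : ℝ) with hr
  have h2 := (abs_le.1 h).1
  -- For an empty sphere the tolerance is 1/(5·0) = 0, so the quotient is 1 and a rejection has
  -- probability 0.
  rcases Nat.eq_zero_or_pos (I.sphereFinset ℓ u).card with hc | hc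
  · rw [hc] at h2 ⊢
    norm_num at h2 ⊢
    linarith
  · have hc' : (1 : ℝ) ≤ (I.sphereFinset ℓ u).card := by exact_mod_cast hc
    set k : ℝ := ((I.sphereFinset ℓ u).card : ℝ)
    set ε : ℝ := 1 / (5 * k) with hε
    have hεk : ε * k = 1 / 5 := by rw [hε]; field_simp
    have hε0 : 0 < ε := by positivity
    -- A rejection has probability at most 1 - (1 - ε)/(1 + ε) ≤ 2ε. Multiplied by 1 + k this is 2ε
    -- + 2/5, which is at most 4/5 since ε ≤ 1/5.
    have h3 : 1 - 2 * ε ≤ r / (1 + ε) := by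
      rw [le_div_iff₀ (by positivity)]
      nlinarith
    have hε5 : ε ≤ 1 / 5 := by nlinarith
    nlinarith

/-- Resampling the block of an accepted vertex has the effect of releasing this vertex. -/
lemma sum_accept [NeZero q] (hI : I.Permissive) (hssm : I.RatioSSM ℓ) (hℓ : 1 ≤ ℓ) (hu : u ∈ R)
    (σ : Conf n q) : ∃ c : ℝ≥0∞, ∀ H : Conf n q → ℝ≥0∞,
      ∑ ρ ∈ extensions R σ, (I.weight ρ : ℝ≥0∞) *
        ((I.accept ℓ R u ρ : ℝ≥0∞) * I.resample (I.block ℓ R u)ᶜ ρ H)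
      = c * ∑ ρ ∈ extensions (R.erase u) σ, (I.weight ρ : ℝ≥0∞) * H ρ := by
  classical
  set Λ := (I.block ℓ R u)ᶜ with hΛ
  have huΛ : u ∉ Λ := by simp [hΛ, mem_block]
  set m₀ := I.condMarginal Λ (refConf R σ) u (σ u) with hm₀
  set δ : ℝ≥0 := 1 + 1 / (5 * (I.sphereFinset ℓ u).card) with hδ
  have hδ0 : δ ≠ 0 := by positivity
  have hacc : ∀ ρ ∈ extensions R σ,
      I.accept ℓ R u ρ = m₀ / (I.condMarginal Λ ρ u (ρ u) * δ) := by
    intro ρ hρ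
    rw [mem_extensions] at hρ
    unfold accept
    rw [hm₀, ← hρ u hu]
    congr 2
    ext v
    by_cases hv : v ∈ R
    · simp [refConf, hv, hρ v hv]
    · simp [refConf, hv]
  -- If the reference marginal vanishes, no extension is ever accepted and c = 0 works.
  by_cases h0 : m₀ = 0
  · refine ⟨0, fun H => ?_⟩
    rw [zero_mul]
    refine Finset.sum_eq_zero fun ρ hρ => ?_
    simp [hacc ρ hρ, h0]
  -- Otherwise mixing forces all true marginals to be nonzero, since both marginals vanish together;
  -- the later cancellation is legitimate.
  have hne : ∀ ρ ∈ extensions R σ, I.condMarginal Λ ρ u (ρ u) ≠ 0 := by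
    intro ρ hρ hz
    rcases marginal_ratio hssm hℓ ρ (ρ u) with h | h
    · apply h0
      rw [hm₀, ← h.1]
      rw [mem_extensions] at hρ
      rw [hρ u hu]
      congr 1
      ext v
      by_cases hv : v ∈ R
      · simp [refConf, hv, hρ v hv]
      · simp [refConf, hv]
    · exact h.1 hz
  have hRΛ : R ⊆ insert u Λ := by
    intro v hv
    rw [Finset.mem_insert, hΛ, Finset.mem_compl, mem_block]
    tauto
  have hRΛ' : R.erase u ⊆ Λ := by
    intro v hv
    rw [Finset.mem_erase] at hv
    rw [hΛ, Finset.mem_compl, mem_block]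
    tauto
  -- On one side `u` belongs to the fixed set, on the other side it lies off Λ; in both cases a
  -- representative has the spin of σ at `u`. The two sums can therefore be compared class by class.
  have hreps : classReps R (insert u Λ) σ = classReps (R.erase u) Λ σ := by
    ext τ
    simp only [classReps, Finset.mem_filter, Finset.mem_univ, true_and, Finset.mem_insert,
      Finset.mem_erase, not_or]
    constructor
    · rintro ⟨h1, h2⟩
      refine ⟨fun v hv => h1 v hv.2, fun v hv => ?_⟩
      by_cases hvu : v = u
      · rw [hvu]; exact h1 u hu
      · exact h2 v ⟨hvu, hv⟩
    · rintro ⟨h1, h2⟩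
      refine ⟨fun v hv => ?_, fun v hv => h2 v hv.2⟩
      by_cases hvu : v = u
      · rw [hvu]; exact h2 u huΛ
      · exact h1 v ⟨hvu, hv⟩
  -- The constant is the numerator of the acceptance probability over its fixed correction factor;
  -- it depends on the spins in R only, hence is the same for all classes.
  refine ⟨((m₀ / δ : ℝ≥0) : ℝ≥0∞), fun H => ?_⟩
  rw [sum_extensions_classes hRΛ, sum_extensions_classes hRΛ', Finset.mul_sum, hreps]
  refine Finset.sum_congr rfl fun τ hτ => ?_
  have hτR : τ ∈ extensions R σ := by
    rw [← hreps] at hτ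
    rw [mem_extensions]
    exact (Finset.mem_filter.1 hτ).2.1
  -- Within a class the acceptance probability and the resampling kernel are constant, so summing
  -- only collects the conditional weights with the given spin at `u`.
  have h1 : ∀ ρ ∈ extensions (insert u Λ) τ, (I.weight ρ : ℝ≥0∞) *
        ((I.accept ℓ R u ρ : ℝ≥0∞) * I.resample Λ ρ H)
      = (I.innerWeight Λ τ : ℝ≥0∞) * (I.condWeight Λ ρ : ℝ≥0∞) *
        ((I.accept ℓ R u τ : ℝ≥0∞) * I.resample Λ τ H) := by
    intro ρ hρ
    rw [mem_extensions] at hρ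
    have hρΛ : ∀ v ∈ Λ, ρ v = τ v := fun v hv => hρ v (Finset.mem_insert_of_mem hv)
    have hρR : ρ ∈ extensions R σ := by
      rw [mem_extensions] at hτR ⊢
      exact fun v hv => (hρ v (hRΛ hv)).trans (hτR v hv)
    rw [I.weight_eq Λ, I.innerWeight_congr hρΛ, I.resample_congr hρΛ, hacc ρ hρR, hacc τ hτR,
      I.condMarginal_congr_on hρΛ, hρ u (Finset.mem_insert_self _ _)]
    push_cast
    rfl
  rw [Finset.sum_congr rfl h1, ← Finset.sum_mul, ← Finset.mul_sum]
  have h2 : (∑ ρ ∈ extensions (insert u Λ) τ, (I.condWeight Λ ρ : ℝ≥0∞))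
      = (I.condPart Λ τ u (τ u) : ℝ≥0∞) := by
    unfold condPart
    push_cast
    refine Finset.sum_congr ?_ fun _ _ => rfl
    ext ρ
    simp only [mem_extensions, Finset.mem_filter, Finset.mem_insert, forall_eq_or_imp]
    tauto
  have h3 : (∑ ρ ∈ extensions Λ τ, (I.weight ρ : ℝ≥0∞) * H ρ)
      = (I.innerWeight Λ τ : ℝ≥0∞) *
        ∑ ρ ∈ extensions Λ τ, (I.condWeight Λ ρ : ℝ≥0∞) * H ρ := by
    rw [Finset.mul_sum]
    refine Finset.sum_congr rfl fun ρ hρ => ?_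
    rw [I.weight_eq Λ, I.innerWeight_congr (mem_extensions.1 hρ)]
    push_cast
    ring
  have hZ : I.condZ Λ τ ≠ 0 := (hI Λ τ).ne'
  have hP : I.condPart Λ τ u (τ u) ≠ 0 := by
    have := hne τ hτR
    rw [condMarginal_eq] at this
    exact (div_ne_zero_iff.1 this).1
  -- The collected weight over the conditional partition function is the marginal in the denominator
  -- of the acceptance probability: it cancels.
  have h4 : I.innerWeight Λ τ * I.condPart Λ τ u (τ u) * I.accept ℓ R u τ / I.condZ Λ τ
      = m₀ / δ * I.innerWeight Λ τ := by
    rw [hacc τ hτR, condMarginal_eq]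
    field_simp
  rw [h2, h3, ← mul_assoc, ← mul_assoc, ← ENNReal.coe_mul (m₀ / δ), ← h4, resample,
    ENNReal.coe_div hZ]
  push_cast
  simp only [div_eq_mul_inv]
  ring

/-- The invariant of the sampler is preserved by one step. -/
lemma sum_step_le [NeZero q] (hI : I.Permissive) (hssm : I.RatioSSM ℓ) (hℓ : 1 ≤ ℓ) (hu : u ∈ R)
    {H H' : Conf n q → ℝ≥0∞} {μ : ℝ≥0∞}
    (hH : ∀ σ, ∑ ρ ∈ extensions (R.erase u) σ, (I.weight ρ : ℝ≥0∞) * H ρ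
      ≤ μ * ∑ ρ ∈ extensions (R.erase u) σ, (I.weight ρ : ℝ≥0∞))
    (hH' : ∀ σ, ∑ ρ ∈ extensions (R ∪ I.sphereFinset ℓ u) σ, (I.weight ρ : ℝ≥0∞) * H' ρ
      ≤ μ * ∑ ρ ∈ extensions (R ∪ I.sphereFinset ℓ u) σ, (I.weight ρ : ℝ≥0∞))
    (σ : Conf n q) :
    ∑ ρ ∈ extensions R σ, (I.weight ρ : ℝ≥0∞) *
        ((I.accept ℓ R u ρ : ℝ≥0∞) * I.resample (I.block ℓ R u)ᶜ ρ H
          + ((1 - I.accept ℓ R u ρ : ℝ≥0) : ℝ≥0∞) * H' ρ)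
      ≤ μ * ∑ ρ ∈ extensions R σ, (I.weight ρ : ℝ≥0∞) := by
  classical
  obtain ⟨c, hc⟩ := sum_accept hI hssm hℓ hu σ
  have hacc : ∑ ρ ∈ extensions R σ, (I.weight ρ : ℝ≥0∞) *
        ((I.accept ℓ R u ρ : ℝ≥0∞) * I.resample (I.block ℓ R u)ᶜ ρ H)
      ≤ μ * ∑ ρ ∈ extensions R σ, (I.weight ρ : ℝ≥0∞) * (I.accept ℓ R u ρ : ℝ≥0∞) := by
    -- The choice H = 1 evaluates the same constant `c` as the total accepted weight, so `c` need
    -- not be known.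
    have h1 := hc fun _ => 1
    simp only [resample_const hI, mul_one] at h1
    rw [hc H, h1, mul_left_comm]
    exact mul_le_mul_right (hH σ) c
  have hrej : ∑ ρ ∈ extensions R σ, (I.weight ρ : ℝ≥0∞) *
        (((1 - I.accept ℓ R u ρ : ℝ≥0) : ℝ≥0∞) * H' ρ)
      ≤ μ * ∑ ρ ∈ extensions R σ, (I.weight ρ : ℝ≥0∞) *
        ((1 - I.accept ℓ R u ρ : ℝ≥0) : ℝ≥0∞) := by
    -- Sorting by the spins on R and on the sphere makes the rejection probability constant on each
    -- class, where the hypothesis on `H'` applies.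
    rw [sum_extensions_classes (Finset.subset_union_left (s₂ := I.sphereFinset ℓ u)),
      sum_extensions_classes (Finset.subset_union_left (s₂ := I.sphereFinset ℓ u)),
      Finset.mul_sum]
    refine Finset.sum_le_sum fun τ _ => ?_
    have h1 : ∀ ρ ∈ extensions (R ∪ I.sphereFinset ℓ u) τ,
        I.accept ℓ R u ρ = I.accept ℓ R u τ := fun ρ hρ =>
      accept_congr hℓ hu (mem_extensions.1 hρ)
    calc ∑ ρ ∈ extensions (R ∪ I.sphereFinset ℓ u) τ, (I.weight ρ : ℝ≥0∞) *
          (((1 - I.accept ℓ R u ρ : ℝ≥0) : ℝ≥0∞) * H' ρ)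
        = ((1 - I.accept ℓ R u τ : ℝ≥0) : ℝ≥0∞) *
          ∑ ρ ∈ extensions (R ∪ I.sphereFinset ℓ u) τ, (I.weight ρ : ℝ≥0∞) * H' ρ := by
          rw [Finset.mul_sum]
          exact Finset.sum_congr rfl fun ρ hρ => by rw [h1 ρ hρ]; ring
      _ ≤ ((1 - I.accept ℓ R u τ : ℝ≥0) : ℝ≥0∞) *
          (μ * ∑ ρ ∈ extensions (R ∪ I.sphereFinset ℓ u) τ, (I.weight ρ : ℝ≥0∞)) :=
          mul_le_mul_right (hH' τ) _
      _ = _ := by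
          rw [mul_left_comm, Finset.mul_sum]
          congr 1
          exact Finset.sum_congr rfl fun ρ hρ => by rw [h1 ρ hρ]; ring
  calc _ = ∑ ρ ∈ extensions R σ, (I.weight ρ : ℝ≥0∞) *
        ((I.accept ℓ R u ρ : ℝ≥0∞) * I.resample (I.block ℓ R u)ᶜ ρ H)
        + ∑ ρ ∈ extensions R σ, (I.weight ρ : ℝ≥0∞) *
        (((1 - I.accept ℓ R u ρ : ℝ≥0) : ℝ≥0∞) * H' ρ) := by
        rw [← Finset.sum_add_distrib]
        simp only [mul_add]
    _ ≤ _ := add_le_add hacc hrej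
    _ = _ := by
        rw [← mul_add, ← Finset.sum_add_distrib]
        congr 1
        refine Finset.sum_congr rfl fun ρ _ => ?_
        rw [← mul_add, ← ENNReal.coe_add, add_tsub_cancel_of_le (accept_le_one hssm hℓ ρ),
          ENNReal.coe_one, mul_one]

end SpinSystem

attribute [simp] NExp.eval AExp.eval RExp.eval Test.holds Memory.nat_writeNat Memory.real_writeNat
  Memory.real_writeReal Memory.nat_writeReal

/-! ### The representation of spin systems and of lists of vertices in memory -/

section Lists

variable {α : Type*} [DecidableEq α]

/-- Appends an element to a list unless it is already there. -/
def pushNew (l : List α) (v : α) : List α := if v ∈ l then l else l ++ [v]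

/-- Appends the new elements of a list to another list. -/
def pushAll (l vs : List α) : List α := vs.foldl pushNew l

lemma mem_pushNew {l : List α} {v w : α} : w ∈ pushNew l v ↔ w ∈ l ∨ w = v := by
  unfold pushNew
  split_ifs with h
  · constructor
    · exact Or.inl
    · rintro (h' | rfl)
      · exact h'
      · exact h
  · simp

lemma nodup_pushNew {l : List α} (h : l.Nodup) (v : α) : (pushNew l v).Nodup := by
  unfold pushNew
  split_ifs with hv
  · exact h
  · exact List.nodup_append.2 ⟨h, List.nodup_singleton v, by
      intro a ha b hb
      rw [List.mem_singleton] at hb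
      rintro rfl
      exact hv (hb ▸ ha)⟩

lemma prefix_pushNew (l : List α) (v : α) : l <+: pushNew l v := by
  unfold pushNew
  split_ifs
  · exact List.prefix_rfl
  · exact List.prefix_append _ _

lemma pushAll_append (l vs ws : List α) :
    pushAll l (vs ++ ws) = pushAll (pushAll l vs) ws := List.foldl_append

lemma pushAll_snoc (l vs : List α) (v : α) :
    pushAll l (vs ++ [v]) = pushNew (pushAll l vs) v := by
  rw [pushAll_append]
  rfl

lemma mem_pushAll {l vs : List α} {w : α} : w ∈ pushAll l vs ↔ w ∈ l ∨ w ∈ vs := by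
  induction vs using List.reverseRecOn with
  | nil => simp [pushAll]
  | append_singleton vs v ih =>
    rw [pushAll_snoc, mem_pushNew, ih]
    simp [or_assoc]

lemma nodup_pushAll {l : List α} (h : l.Nodup) (vs : List α) : (pushAll l vs).Nodup := by
  induction vs using List.reverseRecOn with
  | nil => exact h
  | append_singleton vs v ih =>
    rw [pushAll_snoc]
    exact nodup_pushNew ih v

lemma prefix_pushAll (l vs : List α) : l <+: pushAll l vs := by
  induction vs using List.reverseRecOn with
  | nil => exact List.prefix_rfl
  | append_singleton vs v ih =>
    rw [pushAll_snoc]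
    exact ih.trans (prefix_pushNew _ _)

lemma pushAll_eq_append {l vs : List α} (hvs : vs.Nodup) :
    pushAll l vs = l ++ vs.filter (fun v => v ∉ l) := by
  induction vs using List.reverseRecOn with
  | nil => simp [pushAll]
  | append_singleton vs v ih =>
    have h1 := List.nodup_append.1 hvs
    have hv : v ∉ vs := fun h => h1.2.2 v h v (List.mem_singleton_self v) rfl
    rw [pushAll_snoc, ih h1.1]
    unfold pushNew
    by_cases hl : v ∈ l <;> simp [hl, hv]

end Lists

variable {n q : ℕ}

/-- The memory holds the numbers `q` and `ℓ`, the adjacency lists, the vectors and the matrices. -/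
structure HasSystem (I : SpinSystem n q) (adj : Fin n → List (Fin n)) (ℓ : ℕ) (m : Memory) :
    Prop where
  spins : m.nat (0, 1, 0, 0, 0) = q
  dist : m.nat (0, 2, 0, 0, 0) = ℓ
  deg : ∀ v : Fin n, m.nat (2, v, 0, 0, 0) = (adj v).length
  nbr : ∀ (v : Fin n) (i : ℕ) (h : i < (adj v).length), m.nat (3, v, i, 0, 0) = ((adj v)[i] : ℕ)
  vec : ∀ (v : Fin n) (a : Fin q), m.real (0, v, a, 0, 0) = I.b v a
  mat : ∀ (v : Fin n) (i : ℕ) (h : i < (adj v).length) (a c : Fin q),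
    m.real (1, v, i, a, c) = I.A s(v, (adj v)[i]) s(a, c)

/-- The memory holds a configuration. -/
def HasConf (X : Conf n q) (m : Memory) : Prop := ∀ v : Fin n, m.nat (1, v, 0, 0, 0) = X v

/-- The memory holds a sequence of lists of vertices, together with marks for their members. -/
structure HasRows (rows : ℕ → List (Fin n)) (m : Memory) : Prop where
  len : ∀ r, m.nat (9, r, 0, 0, 0) = (rows r).length
  item : ∀ r i (h : i < (rows r).length), m.nat (7, r, i, 0, 0) = ((rows r)[i] : ℕ)
  mark : ∀ r (v : Fin n), m.nat (8, r, v, 0, 0) = if v ∈ rows r then 1 else 0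

lemma HasSystem.congr {I : SpinSystem n q} {adj : Fin n → List (Fin n)} {ℓ : ℕ} {m m' : Memory}
    (h : HasSystem I adj ℓ m) (h0 : ∀ i, m'.nat (0, i) = m.nat (0, i))
    (h2 : ∀ i, m'.nat (2, i) = m.nat (2, i)) (h3 : ∀ i, m'.nat (3, i) = m.nat (3, i))
    (r0 : ∀ i, m'.real (0, i) = m.real (0, i)) (r1 : ∀ i, m'.real (1, i) = m.real (1, i)) :
    HasSystem I adj ℓ m' where
  spins := (h0 _).trans h.spins
  dist := (h0 _).trans h.dist
  deg v := (h2 _).trans (h.deg v)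
  nbr v i hi := (h3 _).trans (h.nbr v i hi)
  vec v a := (r0 _).trans (h.vec v a)
  mat v i hi a c := (r1 _).trans (h.mat v i hi a c)

lemma HasSystem.frame {I : SpinSystem n q} {adj : Fin n → List (Fin n)} {ℓ : ℕ} {m m' : Memory}
    {c : Cmd} (h : HasSystem I adj ℓ m) (hf : Frame c m m')
    (h0 : c.writesNat 0 = false := by rfl) (h2 : c.writesNat 2 = false := by rfl)
    (h3 : c.writesNat 3 = false := by rfl) (r0 : c.writesReal 0 = false := by rfl)
    (r1 : c.writesReal 1 = false := by rfl) : HasSystem I adj ℓ m' :=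
  h.congr (hf.nat 0 · h0) (hf.nat 2 · h2) (hf.nat 3 · h3) (hf.real 0 · r0) (hf.real 1 · r1)

lemma HasConf.frame {X : Conf n q} {m m' : Memory} {c : Cmd} (h : HasConf X m)
    (hf : Frame c m m') (h1 : c.writesNat 1 = false := by rfl) : HasConf X m' :=
  fun v => (hf.nat 1 _ h1).trans (h v)

lemma HasRows.congr {rows : ℕ → List (Fin n)} {m m' : Memory} (h : HasRows rows m)
    (h7 : ∀ i, m'.nat (7, i) = m.nat (7, i)) (h8 : ∀ i, m'.nat (8, i) = m.nat (8, i))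
    (h9 : ∀ i, m'.nat (9, i) = m.nat (9, i)) : HasRows rows m' where
  len r := (h9 _).trans (h.len r)
  item r i hi := (h7 _).trans (h.item r i hi)
  mark r v := (h8 _).trans (h.mark r v)

lemma HasRows.frame {rows : ℕ → List (Fin n)} {m m' : Memory} {c : Cmd} (h : HasRows rows m)
    (hf : Frame c m m') (h7 : c.writesNat 7 = false := by rfl)
    (h8 : c.writesNat 8 = false := by rfl) (h9 : c.writesNat 9 = false := by rfl) :
    HasRows rows m' :=
  h.congr (hf.nat 7 · h7) (hf.nat 8 · h8) (hf.nat 9 · h9)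

lemma HasRows.writeNat {rows : ℕ → List (Fin n)} {m : Memory} (h : HasRows rows m) (x : Addr)
    (c : ℕ) (hx : x.1 ≠ 7 ∧ x.1 ≠ 8 ∧ x.1 ≠ 9 := by decide) :
    HasRows rows (m.writeNat x c) := by
  refine h.congr ?_ ?_ ?_ <;>
  · intro i
    rw [Memory.nat_writeNat, if_neg]
    rintro rfl
    simp at hx

/-! ### Programs that extend lists of vertices. -/

/-- Pushes the vertex in variable `21` to the list whose number is in variable `20`, unless it is
marked. -/
def push : Cmd :=
  .ite (.natEq (.get₂ 8 (.var 20) (.var 21)) (.lit 0))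
    (.setNat ⟨7, .var 20, .get₁ 9 (.var 20), .lit 0, .lit 0⟩ (.var 21) ;;
      .setNat ⟨9, .var 20, .lit 0, .lit 0, .lit 0⟩ (.add (.get₁ 9 (.var 20)) (.lit 1)) ;;
      .setNat ⟨8, .var 20, .var 21, .lit 0, .lit 0⟩ (.lit 1))
    .skip

/-- The marks decide membership by one comparison, so the cost does not depend on the length of the
list. -/
lemma push_runs {rows : ℕ → List (Fin n)} {m : Memory} {r : ℕ} {v : Fin n} (h : HasRows rows m)
    (hr : m.nat (varAddr 20) = r) (hv : m.nat (varAddr 21) = v) :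
    ∃ m', Runs push m m' 6 ∧ HasRows (Function.update rows r (pushNew (rows r) v)) m' := by
  by_cases hmem : v ∈ rows r
  · refine ⟨m, (Runs.ite_false ?_ Runs.skip).mono (by norm_num), ?_⟩
    · simp [hr, hv, h.mark, hmem]
    · simpa [pushNew, hmem] using h
  · refine ⟨_, Runs.ite_true ?_ (Runs.seq (Runs.setNat _ _) (Runs.seq (Runs.setNat _ _)
      (Runs.setNat _ _))), ?_⟩
    · simp [hr, hv, h.mark, hmem]
    · constructor
      · intro r'
        by_cases hrr : r' = r
        · subst hrr
          simp [hr, hv, h.len, pushNew, hmem]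
        · simp [hr, hv, h.len, hrr]
      · intro r' i hi
        by_cases hrr : r' = r
        · subst hrr
          simp only [Function.update_self, pushNew, hmem, if_false, List.length_append,
            List.length_singleton] at hi ⊢
          by_cases hil : i = (rows r').length
          · subst hil
            simp [hr, hv, h.len]
          · have hil' : i < (rows r').length := by omega
            simp [hr, hv, h.len, hil, h.item _ _ hil', List.getElem_append_left hil']
        · simp only [Function.update_of_ne hrr] at hi ⊢
          simp [hr, hv, h.len, hrr, h.item _ _ hi]
      · intro r' w
        by_cases hrr : r' = r
        · subst hrr
          by_cases hw : w = v
          · subst hw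
            simp [hr, hv, pushNew, hmem]
          · have hw' : (w : ℕ) ≠ v := fun h => hw (Fin.ext h)
            simp [hr, hv, h.len, pushNew, hmem, hw, hw', h.mark]
        · simp [hr, hv, h.len, hrr, h.mark]

/-- Pushes a vertex to a list. -/
def pushTo (r v : NExp) : Cmd := .setNat (.var 21) v ;; .setNat (.var 20) r ;; push

lemma pushTo_runs {rows : ℕ → List (Fin n)} {m : Memory} {er ev : NExp} {r : ℕ} {v : Fin n}
    (h : HasRows rows m) (hv : ev.eval m = v) (hr : er.eval (m.writeNat (varAddr 21) v) = r) :
    ∃ m', Runs (pushTo er ev) m m' 10 ∧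
      HasRows (Function.update rows r (pushNew (rows r) v)) m' := by
  have h1 := Runs.setNat (m := m) (.var 21) ev
  have h2 := Runs.setNat (m := m.writeNat (varAddr 21) v) (.var 20) er
  rw [hv] at h1
  rw [hr] at h2
  obtain ⟨m', h3, h4⟩ := push_runs (r := r) (v := v)
    ((h.writeNat (varAddr 21) v).writeNat (varAddr 20) r) (by simp) (by simp)
  exact ⟨m', (h1.seq (h2.seq h3)).mono (by norm_num), h4⟩

/-- Pushes all neighbours of the first members of a list to this list; the number of the list is in
variable `26`, and the number of the members that are considered in variable `23`. -/
def expand : Cmd :=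
  forLoop 22 (.var 23) (.setNat (.var 24) (.get₂ 7 (.var 26) (.var 22)) ;;
    forLoop 25 (.get₁ 2 (.var 24)) (pushTo (.var 26) (.get₂ 3 (.var 24) (.var 25))))

/-- The list grows while it is being read. The number of members to be visited is fixed beforehand
in variable `23`, and new members are appended at the end, so the visited positions never change. -/
lemma expand_runs {I : SpinSystem n q} {adj : Fin n → List (Fin n)} {ℓ : ℕ}
    {rows : ℕ → List (Fin n)} {m : Memory} {r B d : ℕ} (hI : HasSystem I adj ℓ m)
    (h : HasRows rows m) (hr : m.nat (varAddr 26) = r) (hB : (rows r).length ≤ B)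
    (hc : m.nat (varAddr 23) = (rows r).length) (hd : ∀ v, (adj v).length ≤ d) :
    ∃ m', Runs expand m m' (B * (d * 13 + 8) + 3) ∧
      HasRows (Function.update rows r (pushAll (rows r) ((rows r).flatMap adj))) m' := by
  set L := rows r with hL
  obtain ⟨m', hm', hinv, -⟩ := forLoop_runs (i := 22) (N := .var 23)
    (body := .setNat (.var 24) (.get₂ 7 (.var 26) (.var 22)) ;;
      forLoop 25 (.get₁ 2 (.var 24)) (pushTo (.var 26) (.get₂ 3 (.var 24) (.var 25))))
    (m := m) L.length B (d * 13 + 5)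
    (fun k m' => HasRows (Function.update rows r (pushAll L ((L.take k).flatMap adj))) m')
    hB rfl (by simpa [pushAll, hL] using h.writeNat _ _)
    (fun k _ m' hf _ _ => by simpa [hc] using hf.nat 23 (0, 0, 0, 0))
    (by
      intro k hk m₁ hf hrows hik
      have hr1 : m₁.nat (varAddr 26) = r := (hf.nat 26 _).trans hr
      have hI1 : HasSystem I adj ℓ m₁ := hI.frame hf
      -- The original list is a prefix of the present one, hence position `k` still holds `L[k]`.
      obtain ⟨t, ht⟩ := prefix_pushAll L ((L.take k).flatMap adj)
      have hitem : m₁.nat (7, r, k, 0, 0) = (L[k] : ℕ) := by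
        rw [hrows.item r k (by simp [← ht]; omega)]
        simp [← ht, List.getElem_append_left hk]
      have hset := Runs.setNat (m := m₁) (.var 24) (.get₂ 7 (.var 26) (.var 22))
      have he : (NExp.get₂ 7 (.var 26) (.var 22)).eval m₁ = (L[k] : ℕ) := by
        simp [hr1, hik, hitem]
      rw [he] at hset
      have hI2 := hI1.frame hset.frame
      obtain ⟨m₂, hm₂, hinv₂, -⟩ := forLoop_runs (i := 25) (N := .get₁ 2 (.var 24))
        (body := pushTo (.var 26) (.get₂ 3 (.var 24) (.var 25)))
        (m := m₁.writeNat (varAddr 24) (L[k] : ℕ)) (adj L[k]).length d 10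
        (fun j m' => HasRows (Function.update rows r
          (pushAll L ((L.take k).flatMap adj ++ (adj L[k]).take j))) m')
        (hd _) rfl (by simpa using (hrows.writeNat _ _).writeNat _ _)
        (fun j _ m' hf' _ _ => by
          have h1 : m'.nat (varAddr 24) = L[k] := by simp [hf'.nat 24]
          simp [h1, (hI2.frame hf').deg])
        (by
          intro j hj m₃ hf3 hrows3 hij
          have h1 : m₃.nat (varAddr 24) = L[k] := by simp [hf3.nat 24]
          have h2 : m₃.nat (varAddr 26) = r := by simp [hf3.nat 26, hr1]
          obtain ⟨m₄, hm₄, hrows4⟩ := pushTo_runs (r := r) (v := (adj L[k])[j]) (er := .var 26)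
            (ev := .get₂ 3 (.var 24) (.var 25)) hrows3
            (by simp [h1, hij, (hI2.frame hf3).nbr _ _ hj]) (by simp [h2])
          refine ⟨m₄, hm₄, ?_⟩
          have h3 : (adj L[k]).take (j + 1) = (adj L[k]).take j ++ [(adj L[k])[j]] := by
            simp
          rw [h3, ← List.append_assoc, pushAll_snoc]
          simpa using hrows4.writeNat (varAddr 25) (j + 1))
      refine ⟨m₂, (hset.seq hm₂).mono (by omega), ?_⟩
      have h3 : L.take (k + 1) = L.take k ++ [L[k]] := by simp
      rw [h3, List.flatMap_append]
      simpa using hinv₂.writeNat (varAddr 22) (k + 1))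
  refine ⟨m', hm', ?_⟩
  simpa using hinv

/-! ### Balls -/

/-- The vertices at distance at most `d` from `u`. -/
def ballList (adj : Fin n → List (Fin n)) (u : Fin n) : ℕ → List (Fin n)
  | 0 => [u]
  | d + 1 => pushAll (ballList adj u d) ((ballList adj u d).flatMap adj)

section Ball

variable {adj : Fin n → List (Fin n)} {u : Fin n}

lemma nodup_ballList (adj : Fin n → List (Fin n)) (u : Fin n) (d : ℕ) :
    (ballList adj u d).Nodup := by
  induction d with
  | zero => exact List.nodup_singleton u
  | succ d ih => exact nodup_pushAll ih _

lemma ballList_prefix_succ (d : ℕ) : ballList adj u d <+: ballList adj u (d + 1) :=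
  prefix_pushAll _ _

lemma self_mem_ballList (d : ℕ) : u ∈ ballList adj u d := by
  induction d with
  | zero => exact List.mem_singleton_self u
  | succ d ih => exact (ballList_prefix_succ d).subset ih

/-- A prefix of equal length is equal, so one pass without growth is a fixed point of the recursion.
-/
lemma ballList_stable {d : ℕ}
    (h : (ballList adj u (d + 1)).length ≤ (ballList adj u d).length) {e : ℕ} (he : d ≤ e) :
    ballList adj u e = ballList adj u d := by
  have h1 : ballList adj u (d + 1) = ballList adj u d :=
    ((ballList_prefix_succ d).eq_of_length_le h).symm
  induction e, he using Nat.le_induction with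
  | base => rfl
  | succ e _ ih =>
    rw [ballList, ih]
    exact h1

lemma mem_ballList {G : SimpleGraph (Fin n)} (hadj : ∀ v w, w ∈ adj v ↔ G.Adj v w) {d : ℕ}
    {v : Fin n} : v ∈ ballList adj u d ↔ G.edist u v ≤ (d : ℕ∞) := by
  induction d generalizing v with
  | zero =>
    simp only [ballList, List.mem_singleton, Nat.cast_zero, nonpos_iff_eq_zero,
      SimpleGraph.edist_eq_zero_iff]
    exact eq_comm
  | succ d ih =>
    rw [ballList, mem_pushAll, List.mem_flatMap]
    simp only [ih, hadj]
    constructor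
    · rintro (h | ⟨w, hw, hwv⟩)
      · exact h.trans (by exact_mod_cast Nat.le_succ d)
      · refine (SimpleGraph.edist_triangle (v := w)).trans ?_
        rw [SimpleGraph.edist_eq_one_iff_adj.2 hwv]
        push_cast
        gcongr
    · intro h
      obtain ⟨p, hp⟩ := SimpleGraph.exists_walk_of_edist_ne_top
        (ne_top_of_le_ne_top (ENat.natCast_ne_top (d + 1)) h)
      rw [← hp] at h
      have hlen : p.length ≤ d + 1 := by exact_mod_cast h
      -- The recursion of the ball appends the last edge of a walk from `u`, whereas walks are built
      -- from their first edge; the reversed walk exposes the vertex before `v`.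
      generalize hr : p.reverse = r
      have hrl : r.length = p.length := by rw [← hr, SimpleGraph.Walk.length_reverse]
      cases r with
      | nil => left; simp
      | cons hvw r =>
        rename_i w
        right
        refine ⟨w, ?_, hvw.symm⟩
        refine (SimpleGraph.edist_le r.reverse).trans ?_
        rw [SimpleGraph.Walk.length_cons] at hrl
        rw [SimpleGraph.Walk.length_reverse]
        exact_mod_cast (by omega : r.length ≤ d)

lemma length_flatMap_le {d : ℕ} (hd : ∀ v, (adj v).length ≤ d) (l : List (Fin n)) :
    (l.flatMap adj).length ≤ l.length * d := by
  induction l with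
  | nil => simp
  | cons v l ih =>
    rw [List.flatMap_cons, List.length_append, List.length_cons, add_mul, one_mul]
    have := hd v
    omega

/-- For Δ = 1 every ball consists of `u` and its neighbours and has at most two vertices. For Δ ≥ 2
the sizes satisfy |B_{d+1}| ≤ 1 + Δ|B_d|. -/
lemma length_ballList_le {G : SimpleGraph (Fin n)} (hadj : ∀ v w, w ∈ adj v ↔ G.Adj v w) {Δ : ℕ}
    (hΔ : 1 ≤ Δ) (hd : ∀ v, (adj v).length ≤ Δ) (d : ℕ) :
    (ballList adj u d).length ≤ 2 * Δ ^ d := by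
  rcases hΔ.eq_or_lt with h1 | h2
  · have hsub : ballList adj u d ⊆ u :: adj u := by
      induction d with
      | zero => simp [ballList]
      | succ d ih =>
        intro w hw
        rw [ballList, mem_pushAll, List.mem_flatMap] at hw
        rcases hw with hw | ⟨x, hx, hxw⟩
        · exact ih hw
        · rcases List.mem_cons.1 (ih hx) with rfl | hx'
          · exact List.mem_cons_of_mem _ hxw
          · have hu : u ∈ adj x := (hadj x u).2 ((hadj u x).1 hx').symm
            have hl := hd x
            rw [← h1] at hl
            match hax : adj x, hl with
            | [], _ => rw [hax] at hu; simp at hu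
            | [y], _ =>
              rw [hax, List.mem_singleton] at hu hxw
              rw [hxw, hu]
              exact List.mem_cons_self
    have := ((nodup_ballList adj u d).subperm hsub).length_le
    rw [List.length_cons] at this
    have := hd u
    rw [← h1] at this ⊢
    simp
    omega
  · have hsub : ∀ d, ballList adj u (d + 1) ⊆ u :: (ballList adj u d).flatMap adj := by
      intro d
      induction d with
      | zero =>
        intro w hw
        rw [ballList, mem_pushAll] at hw
        simpa [ballList] using hw
      | succ d ih =>
        intro w hw
        rw [ballList, mem_pushAll] at hw
        rcases hw with hw | hw
        · rcases List.mem_cons.1 (ih hw) with rfl | h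
          · exact List.mem_cons_self
          · rw [List.mem_flatMap] at h
            obtain ⟨x, hx, hxw⟩ := h
            exact List.mem_cons_of_mem _
              (List.mem_flatMap.2 ⟨x, (ballList_prefix_succ d).subset hx, hxw⟩)
        · exact List.mem_cons_of_mem _ hw
    -- The summand 1 closes the induction: |B_{d+1}| + 1 ≤ Δ|B_d| + 2 ≤ Δ(|B_d| + 1) because Δ ≥ 2.
    have key : (ballList adj u d).length + 1 ≤ 2 * Δ ^ d := by
      induction d with
      | zero => simp [ballList]
      | succ d ih =>
        have h3 := ((nodup_ballList adj u (d + 1)).subperm (hsub d)).length_le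
        rw [List.length_cons] at h3
        have h4 := length_flatMap_le hd (ballList adj u d)
        have h5 := Nat.mul_le_mul_right Δ ih
        rw [pow_succ]
        nlinarith
    omega

end Ball

/-! ### Programs that compute balls and blocks. -/

/-- Grows the list whose number is in variable `26` from a single vertex to the ball of radius `ℓ`;
variable `23` receives the size of the ball of radius `ℓ - 1`. -/
def growBall : Cmd :=
  .setNat (.var 34) (.lit 0) ;; .setNat (.var 23) (.lit 0) ;;
    .loop (.conj (.natLt (.var 34) (.get₁ 0 (.lit 2))) (.natLt (.var 23) (.get₁ 9 (.var 26))))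
      (.setNat (.var 23) (.get₁ 9 (.var 26)) ;; expand ;;
        .setNat (.var 34) (.add (.var 34) (.lit 1)))

/-- The loop also stops when the ball ceases to grow. This is essential: for Δ = 1 the claimed
running time does not depend on ℓ, so ℓ passes would be too many. Since every pass that continues
adds a vertex, the number of passes is bounded by the size of the ball. -/
lemma growBall_runs {I : SpinSystem n q} {adj : Fin n → List (Fin n)} {ℓ : ℕ}
    {rows : ℕ → List (Fin n)} {m : Memory} {r B d : ℕ} {u : Fin n} (hI : HasSystem I adj ℓ m)
    (h : HasRows rows m) (hr : m.nat (varAddr 26) = r) (hu : rows r = [u]) (hℓ : 1 ≤ ℓ)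
    (hB : ∀ k ≤ ℓ, (ballList adj u k).length ≤ B) (hd : ∀ v, (adj v).length ≤ d) :
    ∃ m', Runs growBall m m' (B * (B * (d * 13 + 8) + 8) + 5) ∧
      HasRows (Function.update rows r (ballList adj u ℓ)) m' ∧
      m'.nat (varAddr 23) = (ballList adj u (ℓ - 1)).length := by
  set T := B * (d * 13 + 8) + 3 with hT
  -- `N` counts the remaining passes: the size `c` seen by the last test increases strictly from one
  -- pass to the next and stays at most `B`, so `B - c` is a budget. The last hypothesis records
  -- that `c` is the size of the preceding ball, with the value 0 before the first pass.
  have key : ∀ N k c m₁, N + c = B → HasSystem I adj ℓ m₁ →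
      HasRows (Function.update rows r (ballList adj u k)) m₁ → m₁.nat (varAddr 26) = r →
      m₁.nat (varAddr 34) = k → m₁.nat (varAddr 23) = c → k ≤ ℓ →
      (k = 0 ∧ c = 0 ∨ ∃ k', k = k' + 1 ∧ c = (ballList adj u k').length) →
      ∃ m', Runs (.loop (.conj (.natLt (.var 34) (.get₁ 0 (.lit 2)))
          (.natLt (.var 23) (.get₁ 9 (.var 26))))
        (.setNat (.var 23) (.get₁ 9 (.var 26)) ;; expand ;;
          .setNat (.var 34) (.add (.var 34) (.lit 1)))) m₁ m' (N * (T + 5) + 1) ∧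
        HasRows (Function.update rows r (ballList adj u ℓ)) m' ∧
        m'.nat (varAddr 23) = (ballList adj u (ℓ - 1)).length := by
    intro N
    induction N using Nat.strong_induction_on with
    | _ N ih =>
      intro k c m₁ hN hI1 hrows hr1 hk hc hkℓ hkc
      have hlen : m₁.nat (9, r, 0, 0, 0) = (ballList adj u k).length := by
        rw [hrows.len, Function.update_self]
      by_cases htest : k < ℓ ∧ c < (ballList adj u k).length
      · have hcB := hB k hkℓ
        have hset := Runs.setNat (m := m₁) (.var 23) (.get₁ 9 (.var 26))
        have he : (NExp.get₁ 9 (.var 26)).eval m₁ = (ballList adj u k).length := by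
          simp [hr1, hlen]
        rw [he] at hset
        obtain ⟨m₂, hm₂, hrows2⟩ := expand_runs (r := r) (B := B) (d := d)
          (hI1.frame hset.frame) (hrows.frame hset.frame)
          (by simp [hr1]) (by simpa using hcB) (by simp) hd
        have hset3 := Runs.setNat (m := m₂) (.var 34) (.add (.var 34) (.lit 1))
        have he3 : (NExp.add (.var 34) (.lit 1)).eval m₂ = k + 1 := by
          simp [hm₂.nat 34, hk]
        rw [he3] at hset3
        have hbody := hset.seq (hm₂.seq hset3)
        obtain ⟨m', hm', hfin⟩ := ih (B - (ballList adj u k).length) (by omega) (k + 1)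
          (ballList adj u k).length _ (by omega) (hI1.frame hbody.frame)
          (by simpa [ballList] using hrows2.writeNat (varAddr 34) (k + 1))
          (by simp [hm₂.nat 26, hr1]) (by simp) (by simp [hm₂.nat 23]) (by omega)
          (Or.inr ⟨k, rfl, rfl⟩)
        refine ⟨m', (Runs.loop_true ?_ hbody hm').mono ?_, hfin⟩
        · simp [hk, hc, hI1.dist, hr1, hlen, htest]
        · have h1 : B - (ballList adj u k).length + 1 ≤ N := by omega
          have h2 := Nat.mul_le_mul_right (T + 5) h1
          rw [add_mul] at h2
          omega
      · refine ⟨m₁, (Runs.loop_false ?_).mono (by omega), ?_⟩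
        · simpa [hk, hc, hI1.dist, hr1, hlen] using htest
        · rw [hc]
          rcases hkc with ⟨rfl, rfl⟩ | ⟨k', rfl, rfl⟩
          · exact absurd ⟨hℓ, by simp [ballList]⟩ htest
          · by_cases hkl : k' + 1 = ℓ
            · subst hkl
              exact ⟨hrows, rfl⟩
            -- The loop ended before radius ℓ, so the last pass added nothing and the balls of
            -- radius ℓ - 1 and ℓ both equal the present one.
            · have hle : (ballList adj u (k' + 1)).length ≤ (ballList adj u k').length := by
                by_contra hcon
                exact htest ⟨by omega, by omega⟩
              rw [ballList_stable hle (by omega : k' ≤ ℓ),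
                ballList_stable hle (by omega : k' ≤ ℓ - 1)]
              rw [ballList_stable hle (by omega : k' ≤ k' + 1)] at hrows
              exact ⟨hrows, rfl⟩
  have h1 := Runs.setNat (m := m) (.var 34) (.lit 0)
  have h2 := Runs.setNat (m := m.writeNat (varAddr 34) 0) (.var 23) (.lit 0)
  obtain ⟨m', hm', hfin⟩ := key B 0 0 ((m.writeNat (varAddr 34) 0).writeNat (varAddr 23) 0)
    (by omega) ((hI.frame h1.frame).frame h2.frame)
    (by
      have : Function.update rows r (ballList adj u 0) = rows := by
        rw [ballList, ← hu, Function.update_eq_self]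
      rw [this]
      exact (h.writeNat _ _).writeNat _ _)
    (by simp [hr]) (by simp) (by simp) (by omega) (Or.inl ⟨rfl, rfl⟩)
  refine ⟨m', (h1.seq (h2.seq hm')).mono ?_, hfin⟩
  have : B * (T + 5) = B * (B * (d * 13 + 8) + 8) := by rw [hT]
  omega

/-- The block of `u` as a list. -/
def blockList (adj : Fin n → List (Fin n)) (ℓ : ℕ) (s : List (Fin n)) (u : Fin n) :
    List (Fin n) :=
  pushAll [u] ((ballList adj u (ℓ - 1)).filter fun v => v ∉ s)

/-- Fills the list whose number is in variable `32` with the block of the vertex in variable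
`33`. -/
def buildBlock : Cmd :=
  pushTo (.var 32) (.var 33) ;;
    forLoop 36 (.var 23) (.setNat (.var 37) (.get₂ 7 (.var 31) (.var 36)) ;;
      .ite (.natEq (.get₂ 8 (.lit 0) (.var 37)) (.lit 0)) (pushTo (.var 32) (.var 37)) .skip)

lemma buildBlock_runs {adj : Fin n → List (Fin n)} {ℓ : ℕ}
    {rows : ℕ → List (Fin n)} {m : Memory} {ra rb B : ℕ} {u : Fin n}
    (h : HasRows rows m) (hra : m.nat (varAddr 31) = ra) (hrb : m.nat (varAddr 32) = rb)
    (h0b : rb ≠ 0) (hab : ra ≠ rb) (hu : m.nat (varAddr 33) = u)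
    (hball : rows ra = ballList adj u ℓ) (hblock : rows rb = [])
    (hc : m.nat (varAddr 23) = (ballList adj u (ℓ - 1)).length)
    (hB : (ballList adj u (ℓ - 1)).length ≤ B) :
    ∃ m', Runs buildBlock m m' (B * 16 + 14) ∧
      HasRows (Function.update rows rb (blockList adj ℓ (rows 0) u)) m' := by
  set L := ballList adj u (ℓ - 1) with hL
  have hpre : L <+: rows ra := by
    rw [hball]
    cases ℓ with
    | zero => exact List.prefix_rfl
    | succ ℓ => exact ballList_prefix_succ ℓ
  obtain ⟨m₁, hm₁, hrows1⟩ := pushTo_runs (r := rb) (v := u) (er := .var 32) (ev := .var 33) h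
    (by simp [hu]) (by simp [hrb])
  rw [hblock] at hrows1
  obtain ⟨m', hm', hinv, -⟩ := forLoop_runs (i := 36) (N := .var 23)
    (body := .setNat (.var 37) (.get₂ 7 (.var 31) (.var 36)) ;;
      .ite (.natEq (.get₂ 8 (.lit 0) (.var 37)) (.lit 0)) (pushTo (.var 32) (.var 37)) .skip)
    (m := m₁) L.length B 13
    (fun k m' => HasRows (Function.update rows rb
      (pushAll [u] ((L.take k).filter fun v => v ∉ rows 0))) m')
    hB rfl (by simpa [pushAll, pushNew] using hrows1.writeNat (varAddr 36) 0)
    (fun k _ m' hf _ _ => by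
      simpa using (hf.nat 23 (0, 0, 0, 0)).trans ((hm₁.nat 23 _).trans hc))
    (by
      intro k hk m₂ hf hrows hik
      have hr2 : m₂.nat (varAddr 31) = ra := by rw [hf.nat 31, hm₁.nat 31, hra]
      have hb2 : m₂.nat (varAddr 32) = rb := by rw [hf.nat 32, hm₁.nat 32, hrb]
      have hset := Runs.setNat (m := m₂) (.var 37) (.get₂ 7 (.var 31) (.var 36))
      have hk' : k < (rows ra).length := hk.trans_le hpre.length_le
      have hitem : (rows ra)[k] = L[k] := by
        obtain ⟨t, ht⟩ := hpre
        simp [← ht, List.getElem_append_left hk]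
      have he : (NExp.get₂ 7 (.var 31) (.var 36)).eval m₂ = (L[k] : ℕ) := by
        have := hrows.item ra k (by simpa [hab] using hk')
        simp only [Function.update_of_ne hab] at this
        simp [hr2, hik, this, hitem]
      rw [he] at hset
      have hrows2 := hrows.writeNat (varAddr 37) (L[k] : ℕ)
      have hmark : (m₂.writeNat (varAddr 37) (L[k] : ℕ)).nat (8, 0, (L[k] : ℕ), 0, 0)
          = if L[k] ∈ rows 0 then 1 else 0 := by
        rw [hrows2.mark 0, Function.update_of_ne h0b.symm]
      have htake : L.take (k + 1) = L.take k ++ [L[k]] := by simp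
      by_cases hmem : L[k] ∈ rows 0
      · refine ⟨_, (hset.seq (Runs.ite_false ?_ Runs.skip)).mono (by omega), ?_⟩
        · simp only [hmem, if_true] at hmark
          simpa using ne_of_eq_of_ne hmark one_ne_zero
        · rw [htake, List.filter_append]
          simpa [hmem] using hrows2.writeNat (varAddr 36) (k + 1)
      · obtain ⟨m₃, hm₃, hrows3⟩ := pushTo_runs (r := rb) (v := L[k]) (er := .var 32)
          (ev := .var 37) hrows2 (by simp) (by simp [hb2])
        refine ⟨m₃, (hset.seq (Runs.ite_true ?_ hm₃)).mono (by omega), ?_⟩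
        · simpa [hmem] using hmark
        · rw [htake, List.filter_append]
          have : [L[k]].filter (fun v => v ∉ rows 0) = [L[k]] := by simp [hmem]
          rw [this, pushAll_snoc]
          simpa using hrows3.writeNat (varAddr 36) (k + 1))
  refine ⟨m', (hm₁.seq hm').mono (by omega), ?_⟩
  rw [List.take_length] at hinv
  exact hinv

/-- Takes the last vertex of the stack and determines its ball and its block. -/
def setup : Cmd :=
  .setNat (.var 31) (.add (.var 30) (.lit 1)) ;; .setNat (.var 32) (.add (.var 30) (.lit 2)) ;;
    .setNat (.var 30) (.add (.var 30) (.lit 2)) ;; .setNat (.var 26) (.var 31) ;;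
    .setNat (.var 33) (.get₂ 7 (.lit 0) (.sub (.get₁ 9 (.lit 0)) (.lit 1))) ;;
    pushTo (.var 31) (.var 33) ;; growBall ;; buildBlock

/-- The situation after the setup: the lists `ra` and `rb` hold the ball and the block of `u`. -/
structure IsSetup (adj : Fin n → List (Fin n)) (ℓ : ℕ) (s : List (Fin n)) (u : Fin n) (ra rb : ℕ)
    (rows : ℕ → List (Fin n)) (m : Memory) : Prop where
  hasRows : HasRows rows m
  ra_pos : 0 < ra
  ra_lt : ra < rb
  ra_eq : m.nat (varAddr 31) = ra
  rb_eq : m.nat (varAddr 32) = rb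
  u_eq : m.nat (varAddr 33) = u
  clock_eq : m.nat (varAddr 30) = rb
  inner_eq : m.nat (varAddr 23) = (ballList adj u (ℓ - 1)).length
  stack : rows 0 = s
  ball : rows ra = ballList adj u ℓ
  block : rows rb = blockList adj ℓ s u
  fresh : ∀ r, rb < r → rows r = []

lemma IsSetup.frame {adj : Fin n → List (Fin n)} {ℓ : ℕ} {s : List (Fin n)} {u : Fin n}
    {ra rb : ℕ} {rows : ℕ → List (Fin n)} {m m' : Memory} {c : Cmd}
    (h : IsSetup adj ℓ s u ra rb rows m) (hf : Frame c m m')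
    (h7 : c.writesNat 7 = false := by rfl) (h8 : c.writesNat 8 = false := by rfl)
    (h9 : c.writesNat 9 = false := by rfl) (h31 : c.writesNat 31 = false := by rfl)
    (h32 : c.writesNat 32 = false := by rfl) (h33 : c.writesNat 33 = false := by rfl)
    (h30 : c.writesNat 30 = false := by rfl) (h23 : c.writesNat 23 = false := by rfl) :
    IsSetup adj ℓ s u ra rb rows m' :=
  { h with
    hasRows := h.hasRows.frame hf h7 h8 h9
    ra_eq := (hf.nat 31 _ h31).trans h.ra_eq
    rb_eq := (hf.nat 32 _ h32).trans h.rb_eq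
    u_eq := (hf.nat 33 _ h33).trans h.u_eq
    clock_eq := (hf.nat 30 _ h30).trans h.clock_eq
    inner_eq := (hf.nat 23 _ h23).trans h.inner_eq }

/-- Each round writes its ball and its block to two new rows, whose numbers come from the counter in
variable `30`. Old marks thus never have to be erased; `hfresh` says that all rows beyond the
counter are empty. -/
lemma setup_runs {I : SpinSystem n q} {adj : Fin n → List (Fin n)} {ℓ : ℕ}
    {rows : ℕ → List (Fin n)} {m : Memory} {B d : ℕ} {s : List (Fin n)} {u : Fin n}
    (hI : HasSystem I adj ℓ m) (h : HasRows rows m) (hs : rows 0 = s ++ [u])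
    (hfresh : ∀ r, m.nat (varAddr 30) < r → rows r = []) (hℓ : 1 ≤ ℓ)
    (hB : ∀ k ≤ ℓ, (ballList adj u k).length ≤ B) (hd : ∀ v, (adj v).length ≤ d) :
    ∃ m' ra rb rows', Runs setup m m' (B * (B * (d * 13 + 8) + 8) + B * 16 + 41) ∧
      IsSetup adj ℓ (s ++ [u]) u ra rb rows' m' := by
  set c := m.nat (varAddr 30) with hc
  have h1 := Runs.setNat (m := m) (.var 31) (.add (.var 30) (.lit 1))
  have e1 : (NExp.add (.var 30) (.lit 1)).eval m = c + 1 := by simp [hc]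
  rw [e1] at h1
  change Runs _ _ (m.writeNat (varAddr 31) (c + 1)) _ at h1
  have h2 := Runs.setNat (m := m.writeNat (varAddr 31) (c + 1)) (.var 32) (.add (.var 30) (.lit 2))
  have e2 : (NExp.add (.var 30) (.lit 2)).eval (m.writeNat (varAddr 31) (c + 1)) = c + 2 := by
    simp [hc]
  rw [e2] at h2
  change Runs _ _ ((m.writeNat (varAddr 31) (c + 1)).writeNat (varAddr 32) (c + 2)) _ at h2
  generalize hm2 : (m.writeNat (varAddr 31) (c + 1)).writeNat (varAddr 32) (c + 2) = m₂ at h2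
  have h3 := Runs.setNat (m := m₂) (.var 30) (.add (.var 30) (.lit 2))
  have e3 : (NExp.add (.var 30) (.lit 2)).eval m₂ = c + 2 := by
    simp [← hm2, hc]
  rw [e3] at h3
  change Runs _ _ (m₂.writeNat (varAddr 30) (c + 2)) _ at h3
  have h4 := Runs.setNat (m := m₂.writeNat (varAddr 30) (c + 2)) (.var 26) (.var 31)
  have e4 : (NExp.var 31).eval (m₂.writeNat (varAddr 30) (c + 2)) = c + 1 := by
    simp [← hm2]
  rw [e4] at h4
  change Runs _ _ ((m₂.writeNat (varAddr 30) (c + 2)).writeNat (varAddr 26) (c + 1)) _ at h4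
  generalize hm4 : (m₂.writeNat (varAddr 30) (c + 2)).writeNat (varAddr 26) (c + 1) = m₄ at h4
  have hrows4 : HasRows rows m₄ := by
    rw [← hm4, ← hm2]
    exact (((h.writeNat _ _).writeNat _ _).writeNat _ _).writeNat _ _
  have h5 := Runs.setNat (m := m₄) (.var 33) (.get₂ 7 (.lit 0) (.sub (.get₁ 9 (.lit 0)) (.lit 1)))
  have e5 : (NExp.get₂ 7 (.lit 0) (.sub (.get₁ 9 (.lit 0)) (.lit 1))).eval m₄ = u := by
    have h9 := hrows4.len 0
    have h7 := hrows4.item 0 s.length (by simp [hs])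
    simp only [hs] at h9 h7
    simp [h9, h7]
  rw [e5] at h5
  change Runs _ _ (m₄.writeNat (varAddr 33) u) _ at h5
  have hrows5 := hrows4.writeNat (varAddr 33) u
  have f30 : m₄.nat (varAddr 30) = c + 2 := by simp [← hm4]
  have f31 : m₄.nat (varAddr 31) = c + 1 := by simp [← hm4, ← hm2]
  have f32 : m₄.nat (varAddr 32) = c + 2 := by simp [← hm4, ← hm2]
  have f26 : m₄.nat (varAddr 26) = c + 1 := by simp [← hm4]
  obtain ⟨m₆, h6, hrows6⟩ := pushTo_runs (r := c + 1) (v := u) (er := .var 31) (ev := .var 33)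
    hrows5 (by simp) (by simp [f31])
  have hI6 : HasSystem I adj ℓ m₆ :=
    (((((hI.frame h1.frame).frame h2.frame).frame h3.frame).frame h4.frame).frame
      h5.frame).frame h6.frame
  obtain ⟨m₇, h7, hrows7, hc7⟩ := growBall_runs (r := c + 1) (u := u) (B := B) (d := d) hI6 hrows6
    (by rw [h6.nat 26]; simp [f26])
    (by simp [hfresh (c + 1) (by omega), pushNew]) hℓ hB hd
  obtain ⟨m₈, h8, hrows8⟩ := buildBlock_runs (ra := c + 1) (rb := c + 2) (u := u) (B := B)
    (adj := adj) (ℓ := ℓ) hrows7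
    (by rw [h7.nat 31, h6.nat 31]; simp [f31]) (by rw [h7.nat 32, h6.nat 32]; simp [f32])
    (by omega) (by omega) (by rw [h7.nat 33, h6.nat 33]; simp) (by simp)
    (by simp [hfresh (c + 2) (by omega)]) hc7 (hB _ (by omega))
  exact ⟨m₈, c + 1, c + 2, _, (h1.seq (h2.seq (h3.seq (h4.seq (h5.seq (h6.seq
    (h7.seq h8))))))).mono (by omega),
    { hasRows := hrows8
      ra_pos := by omega
      ra_lt := by omega
      ra_eq := by rw [h8.nat 31, h7.nat 31, h6.nat 31]; simp [f31]
      rb_eq := by rw [h8.nat 32, h7.nat 32, h6.nat 32]; simp [f32]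
      u_eq := by rw [h8.nat 33, h7.nat 33, h6.nat 33]; simp
      clock_eq := by rw [h8.nat 30, h7.nat 30, h6.nat 30]; simp [f30]
      inner_eq := by rw [h8.nat 23, hc7]
      stack := by simp [hs]
      ball := by simp
      block := by simp [hs]
      fresh := by
        intro r hr
        have h1 : r ≠ c + 2 := by omega
        have h2 : r ≠ c + 1 := by omega
        simp [h1, h2, hfresh r (by omega)] }⟩

/-! ### Tables of configurations -/

/-- All configurations that arise from those in a list by changing the spin of `y`. -/
def spread (L : List (Conf n q)) (y : Fin n) : List (Conf n q) :=
  (List.finRange q).flatMap fun a => L.map fun ρ => Function.update ρ y a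

/-- All configurations that agree with `base` off the list `B`. -/
def table (B : List (Fin n)) (base : Conf n q) : List (Conf n q) := B.foldl spread [base]

lemma table_snoc (B : List (Fin n)) (y : Fin n) (base : Conf n q) :
    table (B ++ [y]) base = spread (table B base) y := by
  simp [table]

lemma length_spread (L : List (Conf n q)) (y : Fin n) :
    (spread L y).length = q * L.length := by
  simp [spread, List.length_flatMap]

lemma length_table (B : List (Fin n)) (base : Conf n q) :
    (table B base).length = q ^ B.length := by
  induction B using List.reverseRecOn with
  | nil => simp [table]
  | append_singleton B y ih =>
    rw [table_snoc, length_spread, ih, List.length_append, List.length_singleton, pow_succ,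
      mul_comm]

lemma sum_map_spread {M : Type*} [AddCommMonoid M] (L : List (Conf n q)) (y : Fin n)
    (f : Conf n q → M) :
    ((spread L y).map f).sum = ∑ a : Fin q, (L.map fun ρ => f (Function.update ρ y a)).sum := by
  have h : ∀ as : List (Fin q),
      ((as.flatMap fun a => L.map fun ρ => Function.update ρ y a).map f).sum
        = (as.map fun a => (L.map fun ρ => f (Function.update ρ y a)).sum).sum := by
    intro as
    induction as with
    | nil => rfl
    | cons a as ih =>
      rw [List.flatMap_cons, List.map_append, List.sum_append, ih, List.map_cons, List.sum_cons,
        List.map_map]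
      rfl
  rw [spread, h, ← List.ofFn_eq_map, List.sum_ofFn]

/-- Since the block has no repetitions, varying its vertices one after the other meets every
extension exactly once. -/
lemma sum_map_table {M : Type*} [AddCommMonoid M] {B : List (Fin n)} (hB : B.Nodup)
    (base : Conf n q) (f : Conf n q → M) :
    ((table B base).map f).sum = ∑ ρ ∈ SpinSystem.extensions (B.toFinset)ᶜ base, f ρ := by
  induction B using List.reverseRecOn generalizing f with
  | nil =>
    have : SpinSystem.extensions (([] : List (Fin n)).toFinset)ᶜ base = {base} := by
      ext ρ
      simp [SpinSystem.mem_extensions, funext_iff]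
    rw [this]
    simp [table]
  | append_singleton B y ih =>
    have hnd := List.nodup_append.1 hB
    have hy : y ∉ B := fun h => hnd.2.2 y h y (List.mem_singleton_self y) rfl
    rw [table_snoc, sum_map_spread]
    simp only [ih hnd.1]
    rw [← Finset.sum_product']
    -- An extension corresponds to its spin at `y` together with the configuration in which `y` is
    -- reset to its base value.
    refine Finset.sum_nbij' (fun x => Function.update x.2 y x.1)
      (fun ρ => (ρ y, Function.update ρ y (base y))) ?_ ?_ ?_ ?_ ?_
    · rintro ⟨a, ρ⟩ h
      simp only [Finset.mem_product, Finset.mem_univ, true_and, SpinSystem.mem_extensions,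
        Finset.mem_compl, List.mem_toFinset] at h
      simp only [SpinSystem.mem_extensions, Finset.mem_compl, List.mem_toFinset, List.mem_append,
        List.mem_singleton, not_or]
      rintro v ⟨hv, hvy⟩
      rw [Function.update_of_ne hvy, h v hv]
    · intro ρ h
      simp only [SpinSystem.mem_extensions, Finset.mem_compl, List.mem_toFinset, List.mem_append,
        List.mem_singleton, not_or] at h
      simp only [Finset.mem_product, Finset.mem_univ, true_and, SpinSystem.mem_extensions,
        Finset.mem_compl, List.mem_toFinset]
      intro v hv
      by_cases hvy : v = y
      · subst hvy; simp
      · rw [Function.update_of_ne hvy, h v ⟨hv, hvy⟩]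
    · rintro ⟨a, ρ⟩ h
      simp only [Finset.mem_product, Finset.mem_univ, true_and, SpinSystem.mem_extensions,
        Finset.mem_compl, List.mem_toFinset] at h
      simp [← h y hy]
    · intro ρ _
      simp
    · intros
      rfl

/-- The vertices in `S` have the spins of the `j`-th configuration of `L` in the `j`-th row of
level `lev` of the table. -/
def HasTable (S : List (Fin n)) (lev : ℕ) (L : List (Conf n q)) (m : Memory) : Prop :=
  ∀ j (h : j < L.length), ∀ v ∈ S, m.nat (10, lev, j, v, 0) = (L[j] v : ℕ)

lemma HasTable.frame {S : List (Fin n)} {lev : ℕ} {L : List (Conf n q)} {m m' : Memory} {c : Cmd}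
    (h : HasTable S lev L m) (hf : Frame c m m') (h10 : c.writesNat 10 = false := by rfl) :
    HasTable S lev L m' :=
  fun j hj v hv => (hf.nat 10 _ h10).trans (h j hj v hv)

/-- Copies row `46` of level `42` of the table to row `44` of the next level. -/
def copyRow : Cmd :=
  forLoop 47 (.get₁ 9 (.var 31)) (.setNat (.var 48) (.get₂ 7 (.var 31) (.var 47)) ;;
    .setNat ⟨10, .add (.var 42) (.lit 1), .var 44, .var 48, .lit 0⟩
      (.get 10 (.var 42) (.var 46) (.var 48) (.lit 0)))

lemma copyRow_runs {rows : ℕ → List (Fin n)} {m : Memory} {ra lev j N D : ℕ}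
    (h : HasRows rows m) (hra : m.nat (varAddr 31) = ra) (hD : (rows ra).length ≤ D)
    (hlev : m.nat (varAddr 42) = lev) (hj : m.nat (varAddr 46) = j)
    (hN : m.nat (varAddr 44) = N) :
    ∃ m', Runs copyRow m m' (D * 6 + 3) ∧
      (∀ v ∈ rows ra, m'.nat (10, lev + 1, N, v, 0) = m.nat (10, lev, j, v, 0)) ∧
      ∀ l i x, l ≠ lev + 1 ∨ i ≠ N → m'.nat (10, l, i, x, 0) = m.nat (10, l, i, x, 0) := by
  obtain ⟨m', hm', hinv, -⟩ := forLoop_runs (i := 47) (N := .get₁ 9 (.var 31))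
    (body := .setNat (.var 48) (.get₂ 7 (.var 31) (.var 47)) ;;
      .setNat ⟨10, .add (.var 42) (.lit 1), .var 44, .var 48, .lit 0⟩
      (.get 10 (.var 42) (.var 46) (.var 48) (.lit 0)))
    (m := m) (rows ra).length D 3
    (fun k m' => (∀ i (hi : i < (rows ra).length), i < k →
        m'.nat (10, lev + 1, N, ((rows ra)[i] : ℕ), 0) = m.nat (10, lev, j, (rows ra)[i], 0)) ∧
      ∀ l i x, l ≠ lev + 1 ∨ i ≠ N → m'.nat (10, l, i, x, 0) = m.nat (10, l, i, x, 0))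
    hD rfl (by simp)
    (fun k _ m' hf _ _ => by
      have h1 := hf.nat 31 (0, 0, 0, 0)
      simp [h1, hra, (h.frame hf).len])
    (by
      rintro k hk m₁ hf ⟨hI1, hI2⟩ hik
      have h1 := Runs.setNat (m := m₁) (.var 48) (.get₂ 7 (.var 31) (.var 47))
      have e1 : (NExp.get₂ 7 (.var 31) (.var 47)).eval m₁ = ((rows ra)[k] : ℕ) := by
        have := hf.nat 31 (0, 0, 0, 0)
        simp [this, hra, hik, (h.frame hf).item ra k hk]
      rw [e1] at h1
      have f42 := hf.nat 42 (0, 0, 0, 0)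
      have f44 := hf.nat 44 (0, 0, 0, 0)
      have f46 := hf.nat 46 (0, 0, 0, 0)
      refine ⟨_, h1.seq (Runs.setNat _ _), ?_, ?_⟩
      · intro i hi hik'
        by_cases hik2 : i = k
        · subst hik2
          simp [f42, f44, f46, hlev, hj, hN, hI2]
        -- Repetitions in the list are not excluded here; a vertex that occurs again simply receives
        -- the same value a second time.
        · have hne : ((rows ra)[i] : ℕ) = (rows ra)[k] ∨ ((rows ra)[i] : ℕ) ≠ (rows ra)[k] :=
            em _
          rcases hne with hne | hne
          · simp [f42, f44, f46, hlev, hj, hN, hI2, hne]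
          · simp [f42, f44, f46, hlev, hN, hne, hI1 i hi (by omega)]
      · intro l i x hli
        have hne : ¬ (l = lev + 1 ∧ i = N ∧ x = ((rows ra)[k] : ℕ)) := by
          rintro ⟨h1, h2, -⟩
          rcases hli with h | h
          · exact h h1
          · exact h h2
        simp [f42, f44, hlev, hN, hne, hI2 l i x hli])
  refine ⟨m', hm', fun v hv => ?_, hinv.2⟩
  obtain ⟨i, hi, rfl⟩ := List.getElem_of_mem hv
  exact hinv.1 i hi hi

/-- Appends to the next level a copy of row `46` in which vertex `43` has spin `45`. -/
def addRow : Cmd :=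
  copyRow ;; .setNat ⟨10, .add (.var 42) (.lit 1), .var 44, .var 43, .lit 0⟩ (.var 45) ;;
    .setNat (.var 44) (.add (.var 44) (.lit 1))

lemma addRow_runs {rows : ℕ → List (Fin n)} {m : Memory} {ra lev j D : ℕ} {y : Fin n} {a : Fin q}
    {L L' : List (Conf n q)} (h : HasRows rows m) (hra : m.nat (varAddr 31) = ra)
    (hD : (rows ra).length ≤ D) (hlev : m.nat (varAddr 42) = lev) (hj : m.nat (varAddr 46) = j)
    (hjL : j < L.length) (hN : m.nat (varAddr 44) = L'.length) (hy : m.nat (varAddr 43) = y)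
    (ha : m.nat (varAddr 45) = a) (hL : HasTable (rows ra) lev L m)
    (hL' : HasTable (rows ra) (lev + 1) L' m) :
    ∃ m', Runs addRow m m' (D * 6 + 7) ∧ HasTable (rows ra) lev L m' ∧
      HasTable (rows ra) (lev + 1) (L' ++ [Function.update L[j] y a]) m' ∧
      m'.nat (varAddr 44) = L'.length + 1 := by
  obtain ⟨m₁, h1, hnew, hold⟩ := copyRow_runs h hra hD hlev hj hN
  have f42 := h1.nat 42 (0, 0, 0, 0)
  have f43 := h1.nat 43 (0, 0, 0, 0)
  have f44 := h1.nat 44 (0, 0, 0, 0)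
  have f45 := h1.nat 45 (0, 0, 0, 0)
  refine ⟨_, (h1.seq ((Runs.setNat _ _).seq (Runs.setNat _ _))).mono (by omega), ?_, ?_, ?_⟩
  · intro i hi v hv
    simp [f42, f44, hlev, hold lev i v (Or.inl (by omega)), hL i hi v hv]
  · intro i hi v hv
    rw [List.length_append, List.length_singleton] at hi
    by_cases hiL : i = L'.length
    · subst hiL
      by_cases hvy : v = y
      · subst hvy
        simp [f42, f43, f44, f45, hlev, hN, hy, ha]
      · have hvy' : (v : ℕ) ≠ y := fun h => hvy (Fin.ext h)
        simp [f42, f43, f44, hlev, hN, hy, hvy, hvy', hnew v hv, hL j hjL v hv]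
    · have hi' : i < L'.length := by omega
      simp [f42, f43, f44, hlev, hN, hiL, hold (lev + 1) i v (Or.inr hiL), hL' i hi' v hv,
        List.getElem_append_left hi']
  · simp [f44, hN]

/-- Builds the table of all configurations that agree with its first row off the block. -/
def fillTable : Cmd :=
  .setNat (.var 49) (.lit 1) ;;
    forLoop 42 (.get₁ 9 (.var 32)) (.setNat (.var 43) (.get₂ 7 (.var 32) (.var 42)) ;;
      .setNat (.var 44) (.lit 0) ;;
      forLoop 45 (.get₁ 0 (.lit 1)) (forLoop 46 (.var 49) addRow) ;;
      .setNat (.var 49) (.var 44))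

/-- Level `k` holds the configurations in which the first `k` vertices of the block vary, and each
level is written from the previous one, once for every spin. Only the spins on the ball are stored,
so a row costs time proportional to the ball and not to the graph. -/
lemma fillTable_runs {I : SpinSystem n q} {adj : Fin n → List (Fin n)} {ℓ : ℕ} {s : List (Fin n)}
    {u : Fin n} {ra rb : ℕ} {rows : ℕ → List (Fin n)} {m : Memory} {D K : ℕ} {base : Conf n q}
    (hI : HasSystem I adj ℓ m) (hS : IsSetup adj ℓ s u ra rb rows m)
    (hD : (ballList adj u ℓ).length ≤ D) (hDB : (blockList adj ℓ s u).length ≤ D)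
    (hK : q ^ (blockList adj ℓ s u).length ≤ K) (hq : 1 ≤ q)
    (hbase : HasTable (ballList adj u ℓ) 0 [base] m) :
    ∃ m', Runs fillTable m m' (D * (q * (K * (D * 6 + 10) + 6) + 12) + 5) ∧
      HasTable (ballList adj u ℓ) (blockList adj ℓ s u).length (table (blockList adj ℓ s u) base) m'
      ∧ m'.nat (varAddr 49) = (table (blockList adj ℓ s u) base).length := by
  set S := ballList adj u ℓ with hSdef
  set B := blockList adj ℓ s u with hBdef
  have h0 := Runs.setNat (m := m) (.var 49) (.lit 1)
  have e0 : (NExp.lit 1).eval m = 1 := rfl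
  rw [e0] at h0
  have hI0 := hI.frame h0.frame
  have hS0 := hS.frame h0.frame
  obtain ⟨m', hm', ⟨hT, hlen⟩, -⟩ := forLoop_runs (i := 42) (N := .get₁ 9 (.var 32))
    (body := .setNat (.var 43) (.get₂ 7 (.var 32) (.var 42)) ;; .setNat (.var 44) (.lit 0) ;;
      forLoop 45 (.get₁ 0 (.lit 1)) (forLoop 46 (.var 49) addRow) ;;
      .setNat (.var 49) (.var 44))
    (m := (m.writeNat (varAddr 49) 1)) B.length D (q * (K * (D * 6 + 10) + 6) + 9)
    (fun k m' => HasTable S k (table (B.take k) base) m' ∧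
      m'.nat (varAddr 49) = (table (B.take k) base).length) hDB rfl
    (by
      refine ⟨fun j hj v hv => ?_, by simp [table]⟩
      have := hbase j hj v hv
      simpa [table] using this)
    (fun k _ m' hf _ _ => by
      have hS1 := hS0.frame hf
      have := hS1.rb_eq
      simp [this, hS1.hasRows.len, hS1.block, hBdef])
    (by
      rintro k hk m₁ hf ⟨hT, hlen⟩ hik
      have hS1 := hS0.frame hf
      have hI1 := hI0.frame hf
      set L := table (B.take k) base with hL
      have hLK : L.length ≤ K := by
        rw [hL, length_table]
        refine (Nat.pow_le_pow_right hq ?_).trans hK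
        rw [List.length_take]
        omega
      have h1 := Runs.setNat (m := m₁) (.var 43) (.get₂ 7 (.var 32) (.var 42))
      have e1 : (NExp.get₂ 7 (.var 32) (.var 42)).eval m₁ = (B[k] : ℕ) := by
        have hrb := hS1.rb_eq
        have := hS1.hasRows.item rb k (by rw [hS1.block]; exact hk)
        simp only [hS1.block] at this
        simp [hrb, hik, this, hBdef]
      rw [e1] at h1
      have h2 := Runs.setNat (m := m₁.writeNat (varAddr 43) (B[k] : ℕ)) (.var 44) (.lit 0)
      have e2 : (NExp.lit 0).eval (m₁.writeNat (varAddr 43) (B[k] : ℕ)) = 0 := rfl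
      rw [e2] at h2
      change Runs _ _ ((m₁.writeNat (varAddr 43) (B[k] : ℕ)).writeNat (varAddr 44) 0) _ at h2
      change Runs _ _ (m₁.writeNat (varAddr 43) (B[k] : ℕ)) _ at h1
      have g43 : ((m₁.writeNat (varAddr 43) (B[k] : ℕ)).writeNat (varAddr 44) 0).nat (varAddr 43)
          = B[k] := by simp
      have g42 : ((m₁.writeNat (varAddr 43) (B[k] : ℕ)).writeNat (varAddr 44) 0).nat (varAddr 42)
          = k := by simpa using hik
      have g49 : ((m₁.writeNat (varAddr 43) (B[k] : ℕ)).writeNat (varAddr 44) 0).nat (varAddr 49)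
          = L.length := by simpa using hlen
      have g44 : ((m₁.writeNat (varAddr 43) (B[k] : ℕ)).writeNat (varAddr 44) 0).nat (varAddr 44)
          = 0 := by simp
      have hS2 := (hS1.frame h1.frame).frame h2.frame
      have hI2 := (hI1.frame h1.frame).frame h2.frame
      have hT2 := (hT.frame h1.frame).frame h2.frame
      generalize (m₁.writeNat (varAddr 43) (B[k] : ℕ)).writeNat (varAddr 44) 0 = m₂ at *
      obtain ⟨m₃, h3, ⟨hT3, hT3', hlen3⟩, -⟩ := forLoop_runs (i := 45) (N := .get₁ 0 (.lit 1))
        (body := forLoop 46 (.var 49) addRow) (m := m₂) q q (K * (D * 6 + 10) + 3)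
        (fun a m' => HasTable S k L m' ∧
          HasTable S (k + 1) (((List.finRange q).take a).flatMap fun a =>
            L.map fun ρ => Function.update ρ B[k] a) m' ∧
          m'.nat (varAddr 44) = (((List.finRange q).take a).flatMap fun a =>
            L.map fun ρ => Function.update ρ B[k] a).length) le_rfl rfl
        (by
          refine ⟨fun j hj v hv => by simpa using hT2 j hj v hv, fun j hj => ?_, ?_⟩
          · simp at hj
          · simpa using g44)
        (fun a _ m' hf' _ _ => by simpa using (hI2.frame hf').spins)
        (by
          rintro a ha m₄ hf4 ⟨hT4, hT4', hlen4⟩ hia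
          have hS4 := hS2.frame hf4
          obtain ⟨m₅, h5, ⟨hT5, hT5', hlen5⟩, -⟩ := forLoop_runs (i := 46) (N := .var 49)
            (body := addRow) (m := m₄) L.length K (D * 6 + 7)
            (fun j m' => HasTable S k L m' ∧
              HasTable S (k + 1) ((((List.finRange q).take a).flatMap fun a =>
                L.map fun ρ => Function.update ρ B[k] a) ++
                  (L.take j).map fun ρ => Function.update ρ B[k] (⟨a, ha⟩ : Fin q)) m' ∧
              m'.nat (varAddr 44) = ((((List.finRange q).take a).flatMap fun a =>
                L.map fun ρ => Function.update ρ B[k] a) ++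
                  (L.take j).map fun ρ => Function.update ρ B[k] (⟨a, ha⟩ : Fin q)).length)
            hLK rfl
            (by
              simp only [List.take_zero, List.map_nil, List.append_nil]
              refine ⟨fun j hj v hv => by simpa using hT4 j hj v hv, fun j hj v hv => ?_, ?_⟩
              · simpa using hT4' j hj v hv
              · simpa using hlen4)
            (fun j _ m' hf' _ _ => by
              have h1 := hf'.nat 49 (0, 0, 0, 0)
              have h2 := hf4.nat 49 (0, 0, 0, 0)
              simp [h1, h2, g49])
            (by
              rintro j hj m₆ hf6 ⟨hT6, hT6', hlen6⟩ hij
              have hS6 := hS4.frame hf6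
              obtain ⟨m₇, h7, hT7, hT7', hlen7⟩ := addRow_runs (ra := ra) (D := D) (y := B[k])
                (a := (⟨a, ha⟩ : Fin q)) (L := L) (lev := k) (j := j) hS6.hasRows hS6.ra_eq
                (by rw [hS6.ball]; exact hD)
                (by
                  have h1 := hf6.nat 42 (0, 0, 0, 0)
                  have h2 := hf4.nat 42 (0, 0, 0, 0)
                  rw [h1, h2, g42])
                hij hj hlen6
                (by
                  have h1 := hf6.nat 43 (0, 0, 0, 0)
                  have h2 := hf4.nat 43 (0, 0, 0, 0)
                  rw [h1, h2, g43])
                (by rw [hf6.nat 45 (0, 0, 0, 0), hia])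
                (by rw [hS6.ball]; exact hT6) (by rw [hS6.ball]; exact hT6')
              rw [hS6.ball] at hT7 hT7'
              have htake : (L.take (j + 1)).map (fun ρ => Function.update ρ B[k] (⟨a, ha⟩ : Fin q))
                  = (L.take j).map (fun ρ => Function.update ρ B[k] (⟨a, ha⟩ : Fin q))
                    ++ [Function.update L[j] B[k] (⟨a, ha⟩ : Fin q)] := by
                rw [List.take_succ_eq_append_getElem hj, List.map_append]
                rfl
              refine ⟨m₇, h7, fun i hi v hv => by simpa using hT7 i hi v hv, ?_, ?_⟩
              · rw [htake, ← List.append_assoc]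
                exact fun i hi v hv => by simpa using hT7' i hi v hv
              · rw [htake, ← List.append_assoc, List.length_append, List.length_singleton]
                simpa using hlen7)
          have htake : (List.finRange q).take (a + 1)
              = (List.finRange q).take a ++ [(⟨a, ha⟩ : Fin q)] := by
            rw [List.take_succ_eq_append_getElem (by simpa using ha)]
            simp
          rw [List.take_length] at hT5' hlen5
          refine ⟨m₅, h5, fun i hi v hv => by simpa using hT5 i hi v hv, ?_, ?_⟩
          · rw [htake, List.flatMap_append, List.flatMap_singleton]
            intro i hi v hv
            simpa using hT5' i hi v hv
          · rw [htake, List.flatMap_append, List.flatMap_singleton]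
            simpa using hlen5)
      have htake : B.take (k + 1) = B.take k ++ [B[k]] := by simp
      have hfull : ((List.finRange q).take q).flatMap (fun a =>
          L.map fun ρ => Function.update ρ B[k] a) = table (B.take (k + 1)) base := by
        rw [htake, table_snoc, List.take_of_length_le (by simp)]
        rfl
      rw [hfull] at hT3' hlen3
      refine ⟨_, (h1.seq (h2.seq (h3.seq (Runs.setNat _ _)))).mono (le_of_eq (by ring)), ?_, ?_⟩
      · intro i hi v hv
        simpa using hT3' i hi v hv
      · simpa using hlen3)
  rw [List.take_length] at hT hlen
  exact ⟨m', (h0.seq hm').mono (le_of_eq (by ring)), hT, hlen⟩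

/-! ### Blocks and their weights -/

section Block

variable {adj : Fin n → List (Fin n)} {u : Fin n} {s : List (Fin n)} {ℓ : ℕ}

lemma mem_blockList {v : Fin n} :
    v ∈ blockList adj ℓ s u ↔ v = u ∨ (v ∈ ballList adj u (ℓ - 1) ∧ v ∉ s) := by
  simp [blockList, mem_pushAll]

lemma nodup_blockList : (blockList adj ℓ s u).Nodup := nodup_pushAll (List.nodup_singleton u) _

lemma ballList_pred_prefix : ballList adj u (ℓ - 1) <+: ballList adj u ℓ := by
  cases ℓ with
  | zero => exact List.prefix_rfl
  | succ ℓ => exact ballList_prefix_succ ℓ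

lemma blockList_subset : blockList adj ℓ s u ⊆ ballList adj u ℓ := by
  intro v hv
  rcases mem_blockList.1 hv with rfl | h
  · exact self_mem_ballList ℓ
  · exact ballList_pred_prefix.subset h.1

/-- Members of the block have distance at most ℓ - 1 from `u`, so all edges at the block end in the
ball, where the table stores the spins. -/
lemma adj_blockList_subset (hℓ : 1 ≤ ℓ) {v : Fin n} (hv : v ∈ blockList adj ℓ s u) :
    adj v ⊆ ballList adj u ℓ := by
  intro w hw
  obtain ⟨k, rfl⟩ : ∃ k, ℓ = k + 1 := ⟨ℓ - 1, by omega⟩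
  rw [ballList, mem_pushAll]
  right
  rw [List.mem_flatMap]
  rcases mem_blockList.1 hv with rfl | h
  · exact ⟨v, self_mem_ballList k, hw⟩
  · exact ⟨v, h.1, hw⟩

variable {I : SpinSystem n q} (hadj : ∀ v w, w ∈ adj v ↔ I.graph.Adj v w)
include hadj

lemma blockList_toFinset (hℓ : 1 ≤ ℓ) :
    (blockList adj ℓ s u).toFinset = I.block ℓ s.toFinset u := by
  ext v
  rw [List.mem_toFinset, mem_blockList, SpinSystem.mem_block, mem_ballList hadj,
    List.mem_toFinset]
  have : I.graph.edist u v ≤ ((ℓ - 1 : ℕ) : ℕ∞) ↔ I.graph.edist u v < (ℓ : ℕ∞) := by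
    obtain ⟨k, rfl⟩ : ∃ k, ℓ = k + 1 := ⟨ℓ - 1, by omega⟩
    rw [Nat.add_sub_cancel]
    push_cast
    exact (ENat.lt_add_one_iff (ENat.natCast_ne_top k)).symm
  rw [this]
  tauto

/-- The list of the ball of radius ℓ begins with the list of the ball of radius ℓ - 1; the remaining
entries form the sphere, and no distances have to be stored. -/
lemma drop_ballList_toFinset (hℓ : 1 ≤ ℓ) :
    ((ballList adj u ℓ).drop (ballList adj u (ℓ - 1)).length).toFinset
      = I.sphereFinset ℓ u := by
  obtain ⟨t, ht⟩ := ballList_pred_prefix (adj := adj) (u := u) (ℓ := ℓ)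
  have hnd := nodup_ballList adj u ℓ
  rw [← ht] at hnd
  have hdisj := (List.nodup_append.1 hnd).2.2
  ext v
  rw [← ht, List.drop_left, List.mem_toFinset, SpinSystem.mem_sphereFinset]
  have h1 : v ∈ ballList adj u ℓ ↔ v ∈ ballList adj u (ℓ - 1) ∨ v ∈ t := by
    rw [← ht, List.mem_append]
  rw [mem_ballList hadj, mem_ballList hadj] at h1
  have h2 : I.graph.edist u v ≤ ((ℓ - 1 : ℕ) : ℕ∞) ↔ I.graph.edist u v < (ℓ : ℕ∞) := by
    obtain ⟨k, rfl⟩ : ∃ k, ℓ = k + 1 := ⟨ℓ - 1, by omega⟩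
    rw [Nat.add_sub_cancel]
    push_cast
    exact (ENat.lt_add_one_iff (ENat.natCast_ne_top k)).symm
  rw [h2] at h1
  constructor
  · intro hv
    have h3 := h1.2 (Or.inr hv)
    refine le_antisymm h3 (not_lt.1 fun h => ?_)
    rw [← h2] at h
    exact hdisj v ((mem_ballList hadj).2 h) v hv rfl
  · intro h
    exact (h1.1 h.le).resolve_left (by rw [h]; exact lt_irrefl _)

lemma length_drop_ballList (hℓ : 1 ≤ ℓ) :
    (ballList adj u ℓ).length - (ballList adj u (ℓ - 1)).length = (I.sphereFinset ℓ u).card := by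
  rw [← drop_ballList_toFinset hadj hℓ, List.toFinset_card_of_nodup, List.length_drop]
  exact (nodup_ballList adj u ℓ).sublist (List.drop_sublist _ _)

end Block

/-- The factor of an edge from `v` to `x` in the weight of a block; an edge inside of the block
contributes only once. -/
def edgeFactor (I : SpinSystem n q) (B : List (Fin n)) (ρ : Conf n q) (v x : Fin n) : ℝ≥0 :=
  if x ∈ B ∧ ¬ v < x then 1 else I.A s(v, x) s(ρ v, ρ x)

/-- The weight of a configuration on a block. -/
def blockWeight (I : SpinSystem n q) (adj : Fin n → List (Fin n)) (B : List (Fin n))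
    (ρ : Conf n q) : ℝ≥0 :=
  (B.map fun v => I.b v (ρ v) * ((adj v).map (edgeFactor I B ρ v)).prod).prod

/-- Every edge that meets the block is counted from one end: from its only end in the block or, if
both ends are in the block, from the smaller one. -/
lemma blockWeight_eq {I : SpinSystem n q} {adj : Fin n → List (Fin n)}
    (hadj : ∀ v w, w ∈ adj v ↔ I.graph.Adj v w) (hnd : ∀ v, (adj v).Nodup) {B : List (Fin n)}
    (hB : B.Nodup) (ρ : Conf n q) :
    blockWeight I adj B ρ = I.condWeight (B.toFinset)ᶜ ρ := by
  classical
  unfold blockWeight SpinSystem.condWeight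
  rw [← List.prod_toFinset _ hB, Finset.prod_mul_distrib]
  congr 1
  · refine Finset.prod_congr ?_ fun _ _ => rfl
    ext v
    simp
  · have h1 : ∀ v ∈ B.toFinset, ((adj v).map (edgeFactor I B ρ v)).prod
        = ∏ x ∈ (adj v).toFinset.filter (fun x => ¬ (x ∈ B ∧ ¬ v < x)),
          I.A s(v, x) s(ρ v, ρ x) := by
      intro v _
      rw [← List.prod_toFinset _ (hnd v), Finset.prod_filter]
      refine Finset.prod_congr rfl fun x _ => ?_
      unfold edgeFactor
      by_cases h : x ∈ B ∧ ¬ v < x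
      · rw [if_pos h, if_neg (not_not.2 h)]
      · rw [if_neg h, if_pos h]
    rw [Finset.prod_congr rfl h1, Finset.prod_sigma']
    -- The pairs that survive the filter are in bijection with the edges meeting the block.
    -- Injectivity fails only if both orders survive, which would require both v < x and x < v.
    refine Finset.prod_nbij (fun p => s(p.1, p.2)) ?_ ?_ ?_ ?_
    · rintro ⟨v, x⟩ hp
      simp only [Finset.mem_sigma, List.mem_toFinset, Finset.mem_filter] at hp
      simp only [SpinSystem.edges, Finset.mem_filter, Finset.mem_univ, true_and,
        Finset.mem_compl, List.mem_toFinset, not_not]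
      exact ⟨(hadj v x).1 hp.2.1, v, Sym2.mem_mk_left v x, hp.1⟩
    · rintro ⟨v, x⟩ hp ⟨v', x'⟩ hp' heq
      simp only [Finset.coe_sigma, Set.mem_sigma_iff, List.mem_toFinset, Finset.mem_coe,
        Finset.mem_filter] at hp hp'
      simp only [Sym2.eq_iff] at heq
      rcases heq with ⟨rfl, rfl⟩ | ⟨rfl, rfl⟩
      · rfl
      · exfalso
        have h2 : v < x := by
          by_contra h
          exact hp.2.2 ⟨hp'.1, h⟩
        have h3 : x < v := by
          by_contra h
          exact hp'.2.2 ⟨hp.1, h⟩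
        exact lt_asymm h2 h3
    · intro e he
      simp only [SpinSystem.edges, Finset.mem_filter, Finset.mem_univ, true_and, Finset.coe_filter,
        Set.mem_ofPred_eq, Finset.mem_compl, List.mem_toFinset, not_not] at he
      obtain ⟨he, v, hv, hvB⟩ := he
      obtain ⟨x, rfl⟩ := hv
      have hvx : I.graph.Adj v x := he
      simp only [Set.mem_image, Finset.coe_sigma, Set.mem_sigma_iff, List.mem_toFinset,
        Finset.mem_coe, Finset.mem_filter]
      by_cases h : x ∈ B ∧ ¬ v < x
      · refine ⟨⟨x, v⟩, ⟨h.1, (hadj x v).2 hvx.symm, ?_⟩, Sym2.eq_swap⟩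
        rintro ⟨-, h'⟩
        exact hvx.ne (le_antisymm (not_lt.1 h') (not_lt.1 h.2))
      · exact ⟨⟨v, x⟩, ⟨hvB, (hadj v x).2 hvx, h⟩, rfl⟩
    · rintro ⟨v, x⟩ _
      rfl

/-! ### Computing the weights of all configurations on a block. -/

/-- The spin of the vertex in variable `x` in row `50` of the last level of the table. -/
def spinAt (x : ℕ) : NExp := .get 10 (.get₁ 9 (.var 32)) (.var 50) (.var x) (.lit 0)

/-- Computes the weight of row `50` of the table. -/
def rowWeight : Cmd :=
  .setReal (.var 10) (.ofNat (.lit 1)) ;;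
    forLoop 51 (.get₁ 9 (.var 32)) (.setNat (.var 52) (.get₂ 7 (.var 32) (.var 51)) ;;
      .setReal (.var 10)
        (.mul (.get (.var 10)) (.get ⟨0, .var 52, spinAt 52, .lit 0, .lit 0⟩)) ;;
      forLoop 53 (.get₁ 2 (.var 52)) (.setNat (.var 54) (.get₂ 3 (.var 52) (.var 53)) ;;
        .ite (.conj (.neg (.natEq (.get₂ 8 (.var 32) (.var 54)) (.lit 0)))
            (.neg (.natLt (.var 52) (.var 54)))) .skip
          (.setReal (.var 10)
            (.mul (.get (.var 10)) (.get ⟨1, .var 52, .var 53, spinAt 52, spinAt 54⟩)))))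

lemma rowWeight_runs {I : SpinSystem n q} {adj : Fin n → List (Fin n)} {ℓ : ℕ} {s : List (Fin n)}
    {u : Fin n} {ra rb : ℕ} {rows : ℕ → List (Fin n)} {m : Memory} {D d j : ℕ} {ρ : Conf n q}
    (hI : HasSystem I adj ℓ m) (hS : IsSetup adj ℓ s u ra rb rows m) (hℓ : 1 ≤ ℓ)
    (hD : (blockList adj ℓ s u).length ≤ D) (hd : ∀ v, (adj v).length ≤ d)
    (hj : m.nat (varAddr 50) = j)
    (hρ : ∀ v ∈ ballList adj u ℓ, m.nat (10, (blockList adj ℓ s u).length, j, v, 0) = ρ v) :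
    ∃ m', Runs rowWeight m m' (D * (d * 7 + 10) + 5) ∧
      m'.real (varAddr 10) = (blockWeight I adj (blockList adj ℓ s u) ρ : ℝ) := by
  set B := blockList adj ℓ s u with hB
  have h0 := Runs.setReal (m := m) (.var 10) (.ofNat (.lit 1))
  have e0 : (RExp.ofNat (.lit 1)).eval m = 1 := by simp
  rw [e0] at h0
  change Runs _ _ (m.writeReal (varAddr 10) 1) _ at h0
  have hI0 := hI.frame h0.frame
  have hS0 := hS.frame h0.frame
  -- The level of the final table is the length of the block list, which `spinAt` reads from memory.
  have hspin : ∀ m₁ x (v : Fin n), IsSetup adj ℓ s u ra rb rows m₁ →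
      (∀ i, m₁.nat (10, i) = m.nat (10, i)) → m₁.nat (varAddr 50) = j →
      m₁.nat (varAddr x) = v → v ∈ ballList adj u ℓ → (spinAt x).eval m₁ = ρ v := by
    intro m₁ x v hS1 h10 h50 hx hv
    have h32 := hS1.rb_eq
    have h9 := hS1.hasRows.len rb
    rw [hS1.block] at h9
    simp [spinAt, h32, h9, h50, hx, h10, hρ v hv, ← hB]
  obtain ⟨m', hm', hinv, -⟩ := forLoop_runs (i := 51) (N := .get₁ 9 (.var 32))
    (body := .setNat (.var 52) (.get₂ 7 (.var 32) (.var 51)) ;;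
      .setReal (.var 10)
        (.mul (.get (.var 10)) (.get ⟨0, .var 52, spinAt 52, .lit 0, .lit 0⟩)) ;;
      forLoop 53 (.get₁ 2 (.var 52)) (.setNat (.var 54) (.get₂ 3 (.var 52) (.var 53)) ;;
        .ite (.conj (.neg (.natEq (.get₂ 8 (.var 32) (.var 54)) (.lit 0)))
            (.neg (.natLt (.var 52) (.var 54)))) .skip
          (.setReal (.var 10)
            (.mul (.get (.var 10)) (.get ⟨1, .var 52, .var 53, spinAt 52, spinAt 54⟩)))))
    (m := m.writeReal (varAddr 10) 1) B.length D (d * 7 + 7)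
    (fun k m' => m'.real (varAddr 10) = (((B.take k).map fun v => I.b v (ρ v) *
      ((adj v).map (edgeFactor I B ρ v)).prod).prod : ℝ≥0)) hD rfl (by simp)
    (fun k _ m' hf _ _ => by
      have hS1 := hS0.frame hf
      have := hS1.rb_eq
      simp [this, hS1.hasRows.len, hS1.block, hB])
    (by
      intro k hk m₁ hf hprod hik
      have hS1 := hS0.frame hf
      have hI1 := hI0.frame hf
      have hvB : B[k] ∈ B := List.getElem_mem hk
      have hvball := blockList_subset hvB
      have h1 := Runs.setNat (m := m₁) (.var 52) (.get₂ 7 (.var 32) (.var 51))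
      have e1 : (NExp.get₂ 7 (.var 32) (.var 51)).eval m₁ = (B[k] : ℕ) := by
        have hrb := hS1.rb_eq
        have := hS1.hasRows.item rb k (by rw [hS1.block]; exact hk)
        simp only [hS1.block] at this
        simp [hrb, hik, this, hB]
      rw [e1] at h1
      change Runs _ _ (m₁.writeNat (varAddr 52) (B[k] : ℕ)) _ at h1
      have hS2 := hS1.frame h1.frame
      have hI2 := hI1.frame h1.frame
      have g52 : (m₁.writeNat (varAddr 52) (B[k] : ℕ)).nat (varAddr 52) = B[k] := by simp
      have g50 : (m₁.writeNat (varAddr 52) (B[k] : ℕ)).nat (varAddr 50) = j := by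
        have := hf.nat 50 (0, 0, 0, 0)
        simp [this, hj]
      have g10 : ∀ i, (m₁.writeNat (varAddr 52) (B[k] : ℕ)).nat (10, i) = m.nat (10, i) :=
        fun i => (h1.nat 10 i).trans (hf.nat 10 i)
      have r10 : (m₁.writeNat (varAddr 52) (B[k] : ℕ)).real (varAddr 10)
        = m₁.real (varAddr 10) := rfl
      generalize m₁.writeNat (varAddr 52) (B[k] : ℕ) = m₂ at *
      have h2 := Runs.setReal (m := m₂) (.var 10)
        (.mul (.get (.var 10)) (.get ⟨0, .var 52, spinAt 52, .lit 0, .lit 0⟩))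
      have e2 : (RExp.mul (.get (.var 10)) (.get ⟨0, .var 52, spinAt 52, .lit 0, .lit 0⟩)).eval m₂
          = ((((B.take k).map fun v => I.b v (ρ v) *
            ((adj v).map (edgeFactor I B ρ v)).prod).prod * I.b B[k] (ρ B[k]) : ℝ≥0) : ℝ) := by
        have hsp := hspin m₂ 52 B[k] hS2 g10 g50 g52 hvball
        simp only [RExp.eval, AExp.eval, hsp, NExp.eval, g52, hI2.vec, r10, hprod, NNReal.coe_mul]
      rw [e2] at h2
      set W := ((B.take k).map fun v => I.b v (ρ v) *
            ((adj v).map (edgeFactor I B ρ v)).prod).prod * I.b B[k] (ρ B[k]) with hW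
      change Runs _ _ (m₂.writeReal (varAddr 10) W) _ at h2
      have hS3 := hS2.frame h2.frame
      have hI3 := hI2.frame h2.frame
      obtain ⟨m₃, h3, hinv3, -⟩ := forLoop_runs (i := 53) (N := .get₁ 2 (.var 52))
        (body := .setNat (.var 54) (.get₂ 3 (.var 52) (.var 53)) ;;
        .ite (.conj (.neg (.natEq (.get₂ 8 (.var 32) (.var 54)) (.lit 0)))
            (.neg (.natLt (.var 52) (.var 54)))) .skip
          (.setReal (.var 10)
            (.mul (.get (.var 10)) (.get ⟨1, .var 52, .var 53, spinAt 52, spinAt 54⟩))))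
        (m := m₂.writeReal (varAddr 10) W) (adj B[k]).length d 4
        (fun i m' => m'.real (varAddr 10)
          = ((W * (((adj B[k]).take i).map (edgeFactor I B ρ B[k])).prod : ℝ≥0) : ℝ))
        (hd _) rfl (by simp)
        (fun i _ m' hf' _ _ => by
          have := hf'.nat 52 (0, 0, 0, 0)
          have hI4 := hI3.frame hf'
          simp [this, g52, hI4.deg])
        (by
          intro i hi m₄ hf4 hprod4 hii
          have hS4 := hS3.frame hf4
          have hI4 := hI3.frame hf4
          have k52 : m₄.nat (varAddr 52) = B[k] := (hf4.nat 52 _).trans g52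
          set x := (adj B[k])[i] with hx
          have hxball : x ∈ ballList adj u ℓ :=
            adj_blockList_subset hℓ hvB (List.getElem_mem hi)
          have h5 := Runs.setNat (m := m₄) (.var 54) (.get₂ 3 (.var 52) (.var 53))
          have e5 : (NExp.get₂ 3 (.var 52) (.var 53)).eval m₄ = (x : ℕ) := by
            simp [k52, hii, hI4.nbr _ _ hi, hx]
          rw [e5] at h5
          change Runs _ _ (m₄.writeNat (varAddr 54) x) _ at h5
          have hS5 := hS4.frame h5.frame
          have hI5 := hI4.frame h5.frame
          have k54 : (m₄.writeNat (varAddr 54) x).nat (varAddr 54) = x := by simp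
          have k52' : (m₄.writeNat (varAddr 54) x).nat (varAddr 52) = B[k] := by simpa using k52
          have k53 : (m₄.writeNat (varAddr 54) x).nat (varAddr 53) = i := by simpa using hii
          have k50 : (m₄.writeNat (varAddr 54) x).nat (varAddr 50) = j := by
            have := hf4.nat 50 (0, 0, 0, 0)
            simp only [Memory.nat_writeNat]
            rw [if_neg (by simp), this]
            exact g50
          have k10 : ∀ i, (m₄.writeNat (varAddr 54) x).nat (10, i) = m.nat (10, i) := by
            intro i
            rw [h5.nat 10 i, hf4.nat 10 i]
            exact g10 i
          have kr10 : (m₄.writeNat (varAddr 54) x).real (varAddr 10)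
            = m₄.real (varAddr 10) := rfl
          generalize m₄.writeNat (varAddr 54) x = m₅ at *
          have htake : ((adj B[k]).take (i + 1)).map (edgeFactor I B ρ B[k])
              = ((adj B[k]).take i).map (edgeFactor I B ρ B[k]) ++ [edgeFactor I B ρ B[k] x] := by
            rw [List.take_succ_eq_append_getElem hi, List.map_append]
            rfl
          -- The marks of row `rb` decide membership in the block, so the test is the condition in
          -- `edgeFactor`.
          have htest : (Test.conj (.neg (.natEq (.get₂ 8 (.var 32) (.var 54)) (.lit 0)))
            (.neg (.natLt (.var 52) (.var 54)))).holds m₅ ↔ x ∈ B ∧ ¬ B[k] < x := by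
            have h8 := hS5.hasRows.mark rb x
            have h32 := hS5.rb_eq
            rw [hS5.block, ← hB] at h8
            simp only [Test.holds, NExp.eval, h32, k54, h8, k52', Fin.lt_def]
            simp
          by_cases hxB : x ∈ B ∧ ¬ B[k] < x
          · refine ⟨_, (h5.seq (Runs.ite_true (htest.2 hxB) Runs.skip)).mono (by omega), ?_⟩
            rw [htake, List.prod_append]
            simp only [Memory.real_writeNat, kr10, hprod4, edgeFactor, hxB, List.prod_singleton]
            simp
          · refine ⟨_, (h5.seq (Runs.ite_false (fun h => hxB (htest.1 h))
              (Runs.setReal _ _))).mono (by omega), ?_⟩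
            have hsp1 := hspin m₅ 52 B[k] hS5 k10 k50 k52' hvball
            have hsp2 := hspin m₅ 54 x hS5 k10 k50 k54 hxball
            have hmat := hI5.mat B[k] i hi (ρ B[k]) (ρ x)
            rw [htake, List.prod_append]
            simp only [Memory.real_writeNat, Memory.real_writeReal, RExp.eval, AExp.eval, hsp1,
              hsp2, NExp.eval, k52', k53, hmat, kr10, hprod4, edgeFactor, hxB, if_false,
              List.prod_singleton, NNReal.coe_mul, if_true, ← hx]
            ring)
      refine ⟨m₃, (h1.seq (h2.seq h3)).mono (by omega), ?_⟩
      have htake : B.take (k + 1) = B.take k ++ [B[k]] := by simp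
      rw [List.take_length] at hinv3
      rw [htake, List.map_append, List.prod_append, Memory.real_writeNat, hinv3, hW]
      simp [mul_assoc])
  rw [List.take_length] at hinv
  exact ⟨m', (h0.seq hm').mono (le_of_eq (by ring)), hinv⟩

/-- Computes the weights of all rows of the table, their sum, and the sum over the rows in which the
vertex `u` has its present spin. -/
def weigh : Cmd :=
  .setReal (.var 12) (.ofNat (.lit 0)) ;; .setReal (.var 13) (.ofNat (.lit 0)) ;;
    forLoop 50 (.var 49) (rowWeight ;;
      .setReal ⟨11, .var 50, .lit 0, .lit 0, .lit 0⟩ (.get (.var 10)) ;;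
      .setReal (.var 12) (.add (.get (.var 12)) (.get (.var 10))) ;;
      .ite (.natEq (spinAt 33) (.get₁ 1 (.var 33)))
        (.setReal (.var 13) (.add (.get (.var 13)) (.get (.var 10)))) .skip)

lemma weigh_runs {I : SpinSystem n q} {adj : Fin n → List (Fin n)} {ℓ : ℕ} {s : List (Fin n)}
    {u : Fin n} {ra rb : ℕ} {rows : ℕ → List (Fin n)} {m : Memory} {D d K : ℕ}
    {L : List (Conf n q)} {X : Conf n q}
    (hI : HasSystem I adj ℓ m) (hS : IsSetup adj ℓ s u ra rb rows m) (hX : HasConf X m)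
    (hℓ : 1 ≤ ℓ) (hD : (blockList adj ℓ s u).length ≤ D) (hd : ∀ v, (adj v).length ≤ d)
    (hK : L.length ≤ K) (h49 : m.nat (varAddr 49) = L.length)
    (hL : HasTable (ballList adj u ℓ) (blockList adj ℓ s u).length L m) :
    ∃ m', Runs weigh m m' (K * (D * (d * 7 + 10) + 15) + 7) ∧
      (∀ j (hj : j < L.length), m'.real (11, j, 0, 0, 0)
        = blockWeight I adj (blockList adj ℓ s u) L[j]) ∧
      m'.real (varAddr 12) = ((L.map (blockWeight I adj (blockList adj ℓ s u))).sum : ℝ≥0) ∧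
      m'.real (varAddr 13) = ((L.map fun ρ =>
        if ρ u = X u then blockWeight I adj (blockList adj ℓ s u) ρ else 0).sum : ℝ≥0) := by
  set B := blockList adj ℓ s u with hB
  have h0 := Runs.setReal (m := m) (.var 12) (.ofNat (.lit 0))
  have e0 : (RExp.ofNat (.lit 0)).eval m = 0 := by simp
  rw [e0] at h0
  change Runs _ _ (m.writeReal (varAddr 12) 0) _ at h0
  have h1 := Runs.setReal (m := m.writeReal (varAddr 12) 0) (.var 13) (.ofNat (.lit 0))
  have e1 : (RExp.ofNat (.lit 0)).eval (m.writeReal (varAddr 12) 0) = 0 := by simp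
  rw [e1] at h1
  change Runs _ _ ((m.writeReal (varAddr 12) 0).writeReal (varAddr 13) 0) _ at h1
  have hI1 := (hI.frame h0.frame).frame h1.frame
  have hS1 := (hS.frame h0.frame).frame h1.frame
  have hX1 := (hX.frame h0.frame).frame h1.frame
  have hL1 := (hL.frame h0.frame).frame h1.frame
  obtain ⟨m', hm', ⟨hw, hZ, hN⟩, -⟩ := forLoop_runs (i := 50) (N := .var 49)
    (body := rowWeight ;;
      .setReal ⟨11, .var 50, .lit 0, .lit 0, .lit 0⟩ (.get (.var 10)) ;;
      .setReal (.var 12) (.add (.get (.var 12)) (.get (.var 10))) ;;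
      .ite (.natEq (spinAt 33) (.get₁ 1 (.var 33)))
        (.setReal (.var 13) (.add (.get (.var 13)) (.get (.var 10)))) .skip)
    (m := (m.writeReal (varAddr 12) 0).writeReal (varAddr 13) 0) L.length K
    (D * (d * 7 + 10) + 12)
    (fun k m' => (∀ j (hj : j < L.length), j < k → m'.real (11, j, 0, 0, 0)
        = blockWeight I adj B L[j]) ∧
      m'.real (varAddr 12) = (((L.take k).map (blockWeight I adj B)).sum : ℝ≥0) ∧
      m'.real (varAddr 13) = (((L.take k).map fun ρ =>
        if ρ u = X u then blockWeight I adj B ρ else 0).sum : ℝ≥0)) hK rfl (by simp)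
    (fun k _ m' hf _ _ => by
      have := hf.nat 49 (0, 0, 0, 0)
      simp [this, h49])
    (by
      rintro k hk m₁ hf ⟨hw, hZ, hN⟩ hik
      have hS2 := hS1.frame hf
      have hI2 := hI1.frame hf
      have hX2 := hX1.frame hf
      have hL2 := hL1.frame hf
      obtain ⟨m₂, h2, hrow⟩ := rowWeight_runs (D := D) (d := d) (ρ := L[k]) hI2 hS2 hℓ hD hd hik
        (fun v hv => hL2 k hk v hv)
      rw [← hB] at hrow
      have hS3 := hS2.frame h2.frame
      have hX3 := hX2.frame h2.frame
      have hL3 := hL2.frame h2.frame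
      have g50 : m₂.nat (varAddr 50) = k := (h2.nat 50 _).trans hik
      have r11 : ∀ i, m₂.real (11, i) = m₁.real (11, i) := fun i => h2.real 11 i
      have r12 : m₂.real (varAddr 12) = m₁.real (varAddr 12) := h2.real 12 _
      have r13 : m₂.real (varAddr 13) = m₁.real (varAddr 13) := h2.real 13 _
      have h3 := Runs.setReal (m := m₂) ⟨11, .var 50, .lit 0, .lit 0, .lit 0⟩ (.get (.var 10))
      have h4 := Runs.setReal (m := m₂.writeReal ((⟨11, .var 50, .lit 0, .lit 0, .lit 0⟩ :
        AExp).eval m₂) ((RExp.get (.var 10)).eval m₂)) (.var 12)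
        (.add (.get (.var 12)) (.get (.var 10)))
      have hsp : ∀ m₃ : Memory, m₃.nat = m₂.nat →
          ((Test.natEq (spinAt 33) (.get₁ 1 (.var 33))).holds m₃ ↔ L[k] u = X u) := by
        intro m₃ hm
        have h33 := hS3.u_eq
        have h32 := hS3.rb_eq
        have h9 := hS3.hasRows.len rb
        rw [hS3.block, ← hB] at h9
        have h10 := hL3 k hk u (self_mem_ballList ℓ)
        have hx := hX3 u
        simp [spinAt, hm, h33, h32, h9, g50, h10, hx, Fin.ext_iff]
      have htake : L.take (k + 1) = L.take k ++ [L[k]] := by simp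
      have hwk : ∀ m₃ : Memory, (∀ i, m₃.real (11, i, 0, 0, 0)
          = if i = k then m₂.real (varAddr 10) else m₂.real (11, i, 0, 0, 0)) →
          ∀ j (hj : j < L.length), j < k + 1 → m₃.real (11, j, 0, 0, 0)
            = blockWeight I adj B L[j] := by
        intro m₃ hm j hj hjk
        rw [hm]
        by_cases h : j = k
        · subst h
          simp [hrow]
        · simp only [h, if_false]
          rw [r11]
          exact hw j hj (by omega)
      by_cases hu : L[k] u = X u
      · refine ⟨_, (h2.seq (h3.seq (h4.seq (Runs.ite_true ?_ (Runs.setReal _ _))))).mono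
          (by omega), hwk _ ?_, ?_, ?_⟩
        · refine (hsp _ ?_).2 hu
          rfl
        · intro i
          simp [g50]
        · rw [htake, List.map_append, List.sum_append]
          simp [r12, hZ, hrow]
        · rw [htake, List.map_append, List.sum_append]
          simp [r13, hN, hrow, hu]
      · refine ⟨_, (h2.seq (h3.seq (h4.seq (Runs.ite_false ?_ Runs.skip)))).mono
          (by omega), hwk _ ?_, ?_, ?_⟩
        · refine fun h => hu ((hsp _ ?_).1 h)
          rfl
        · intro i
          simp [g50]
        · rw [htake, List.map_append, List.sum_append]
          simp [r12, hZ, hrow]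
        · rw [htake, List.map_append, List.sum_append]
          simp [r13, hN, hu])
  rw [List.take_length] at hZ hN
  exact ⟨m', (h0.seq (h1.seq hm')).mono (le_of_eq (by ring)), fun j hj => hw j hj hj, hZ, hN⟩

/-- Writes the first row of the table: the present configuration, or the reference configuration. -/
def baseRow (b : Bool) : Cmd :=
  forLoop 40 (.get₁ 9 (.var 31)) (.setNat (.var 41) (.get₂ 7 (.var 31) (.var 40)) ;;
    .ite (if b then .natEq (.lit 0) (.lit 1) else .natEq (.get₂ 8 (.lit 0) (.var 41)) (.lit 0))
      (.setNat ⟨10, .lit 0, .lit 0, .var 41, .lit 0⟩ (.lit 0))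
      (.setNat ⟨10, .lit 0, .lit 0, .var 41, .lit 0⟩ (.get₁ 1 (.var 41))))

/-- The boundary condition of an enumeration. -/
def baseConf [NeZero q] (b : Bool) (s : List (Fin n)) (X : Conf n q) : Conf n q :=
  if b then X else SpinSystem.refConf s.toFinset X

lemma baseRow_runs [NeZero q] {adj : Fin n → List (Fin n)} {ℓ : ℕ} {s : List (Fin n)}
    {u : Fin n} {ra rb : ℕ} {rows : ℕ → List (Fin n)} {m : Memory} {D : ℕ} {X : Conf n q}
    (b : Bool) (hS : IsSetup adj ℓ s u ra rb rows m) (hX : HasConf X m)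
    (hD : (ballList adj u ℓ).length ≤ D) :
    ∃ m', Runs (baseRow b) m m' (D * 7 + 3) ∧
      HasTable (ballList adj u ℓ) 0 [baseConf b s X] m' := by
  set S := ballList adj u ℓ with hSdef
  obtain ⟨m', hm', hinv, -⟩ := forLoop_runs (i := 40) (N := .get₁ 9 (.var 31))
    (body := .setNat (.var 41) (.get₂ 7 (.var 31) (.var 40)) ;;
    .ite (if b then .natEq (.lit 0) (.lit 1) else .natEq (.get₂ 8 (.lit 0) (.var 41)) (.lit 0))
      (.setNat ⟨10, .lit 0, .lit 0, .var 41, .lit 0⟩ (.lit 0))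
      (.setNat ⟨10, .lit 0, .lit 0, .var 41, .lit 0⟩ (.get₁ 1 (.var 41))))
    (m := m) S.length D 4
    (fun k m' => ∀ i (hi : i < S.length), i < k →
      m'.nat (10, 0, 0, (S[i] : ℕ), 0) = baseConf b s X S[i]) hD rfl (by simp)
    (fun k _ m' hf _ _ => by
      have hS1 := hS.frame hf
      have := hS1.ra_eq
      simp [this, hS1.hasRows.len, hS1.ball, hSdef])
    (by
      intro k hk m₁ hf hI hik
      have hS1 := hS.frame hf
      have hX1 := hX.frame hf
      have h1 := Runs.setNat (m := m₁) (.var 41) (.get₂ 7 (.var 31) (.var 40))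
      have e1 : (NExp.get₂ 7 (.var 31) (.var 40)).eval m₁ = (S[k] : ℕ) := by
        have hra := hS1.ra_eq
        have := hS1.hasRows.item ra k (by rw [hS1.ball]; exact hk)
        simp only [hS1.ball] at this
        simp [hra, hik, this, hSdef]
      rw [e1] at h1
      change Runs _ _ (m₁.writeNat (varAddr 41) (S[k] : ℕ)) _ at h1
      have hmark := hS1.hasRows.mark 0 S[k]
      rw [hS1.stack] at hmark
      have key : ∀ (c : ℕ), c = baseConf b s X S[k] → ∀ i (hi : i < S.length), i < k + 1 →
          (if (S[i] : ℕ) = S[k] then c else m₁.nat (10, 0, 0, (S[i] : ℕ), 0))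
            = baseConf b s X S[i] := by
        intro c hc i hi hik'
        by_cases h : (S[i] : ℕ) = S[k]
        · rw [if_pos h, hc, Fin.ext h]
        · rw [if_neg h]
          refine hI i hi ?_
          have : i ≠ k := by rintro rfl; exact h rfl
          omega
      -- For `b = true` the test in the program is 0 = 1, which never holds, so the present spin is
      -- copied everywhere; for `b = false` the spin 0 is written off the stack.
      by_cases hcase : b = false ∧ S[k] ∉ s
      · refine ⟨_, h1.seq (Runs.ite_true ?_ (Runs.setNat _ _)), ?_⟩
        · simp [hcase.1, hcase.2, hmark]
        · intro i hi hik'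
          rw [← key 0 (by simp [hcase.1, hcase.2, baseConf, SpinSystem.refConf]) i hi hik']
          simp
      · refine ⟨_, h1.seq (Runs.ite_false ?_ (Runs.setNat _ _)), ?_⟩
        · cases b with
          | true => simp
          | false =>
            have : S[k] ∈ s := by simpa using hcase
            simp [this, hmark]
        · intro i hi hik'
          rw [← key (X S[k]) (by
            cases b with
            | true => simp [baseConf]
            | false =>
              have : S[k] ∈ s := by simpa using hcase
              simp [baseConf, SpinSystem.refConf, this]) i hi hik']
          have hx := hX1 S[k]
          simp [hx])
  refine ⟨m', hm', fun j hj v hv => ?_⟩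
  obtain ⟨i, hi, rfl⟩ := List.getElem_of_mem hv
  rw [List.length_singleton] at hj
  obtain rfl : j = 0 := by omega
  exact hinv i hi hi

/-- Enumerates the configurations on the block and their weights. -/
def enumerate (b : Bool) : Cmd := baseRow b ;; fillTable ;; weigh

/-- The quotient of the real variables `13` and `12` is a marginal at `u` of the present spin X_u.
This spin is the same for both boundary conditions; only the boundary changes with `b`. -/
lemma enumerate_runs [NeZero q] {I : SpinSystem n q} {adj : Fin n → List (Fin n)} {ℓ : ℕ}
    {s : List (Fin n)} {u : Fin n} {ra rb : ℕ} {rows : ℕ → List (Fin n)} {m : Memory}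
    {D d K : ℕ} {X : Conf n q} (b : Bool)
    (hI : HasSystem I adj ℓ m) (hS : IsSetup adj ℓ s u ra rb rows m) (hX : HasConf X m)
    (hadj : ∀ v w, w ∈ adj v ↔ I.graph.Adj v w) (hnd : ∀ v, (adj v).Nodup)
    (hℓ : 1 ≤ ℓ) (hD : (ballList adj u ℓ).length ≤ D) (hd : ∀ v, (adj v).length ≤ d)
    (hK : q ^ (blockList adj ℓ s u).length ≤ K) :
    ∃ m', Runs (enumerate b) m m' (D * (q * (K * (D * 6 + 10) + 6) + 12)
        + K * (D * (d * 7 + 10) + 15) + D * 7 + 17) ∧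
      HasTable (ballList adj u ℓ) (blockList adj ℓ s u).length
        (table (blockList adj ℓ s u) (baseConf b s X)) m' ∧
      m'.nat (varAddr 49) = (table (blockList adj ℓ s u) (baseConf b s X)).length ∧
      (∀ j (hj : j < (table (blockList adj ℓ s u) (baseConf b s X)).length),
        m'.real (11, j, 0, 0, 0) = I.condWeight (I.block ℓ s.toFinset u)ᶜ
          (table (blockList adj ℓ s u) (baseConf b s X))[j]) ∧
      m'.real (varAddr 12) = I.condZ (I.block ℓ s.toFinset u)ᶜ (baseConf b s X) ∧
      m'.real (varAddr 13)
        = I.condPart (I.block ℓ s.toFinset u)ᶜ (baseConf b s X) u (X u) := by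
  classical
  have hDB : (blockList adj ℓ s u).length ≤ D :=
    ((nodup_blockList.subperm blockList_subset).length_le).trans hD
  obtain ⟨m₁, h1, hT1⟩ := baseRow_runs b hS hX hD
  obtain ⟨m₂, h2, hT2, h49⟩ := fillTable_runs (hI.frame h1.frame) (hS.frame h1.frame) hD hDB hK
    (NeZero.one_le) hT1
  obtain ⟨m₃, h3, hw, hZ, hN⟩ := weigh_runs (K := K) ((hI.frame h1.frame).frame h2.frame)
    ((hS.frame h1.frame).frame h2.frame) ((hX.frame h1.frame).frame h2.frame) hℓ hDB hd
    (by rw [length_table]; exact hK) h49 hT2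
  have hbw : blockWeight I adj (blockList adj ℓ s u)
      = I.condWeight (I.block ℓ s.toFinset u)ᶜ := by
    funext ρ
    rw [blockWeight_eq hadj hnd nodup_blockList, blockList_toFinset hadj hℓ]
  simp only [hbw] at hw hZ hN
  rw [sum_map_table nodup_blockList, blockList_toFinset hadj hℓ] at hZ hN
  refine ⟨m₃, (h1.seq (h2.seq h3)).mono (le_of_eq (by ring)), hT2.frame h3.frame,
    (h3.nat 49 _).trans h49, hw, hZ, ?_⟩
  rw [hN, SpinSystem.condPart, Finset.sum_filter]

/-! ### Random choices -/

/-- Chooses a row of the table at random according to the weights. -/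
def sample : Cmd :=
  .setReal (.var 16) (.ofNat (.lit 0)) ;; .setNat (.var 56) (.lit 0) ;;
    forLoop 55 (.var 49) (
      .setReal (.var 16)
        (.add (.get (.var 16)) (.get ⟨11, .var 55, .lit 0, .lit 0, .lit 0⟩)) ;;
      .toss (.var 57) (.div (.get ⟨11, .var 55, .lit 0, .lit 0, .lit 0⟩) (.get (.var 16))) ;;
      .ite (.natEq (.var 57) (.lit 1)) (.setNat (.var 56) (.var 55)) .skip)

/-- Reservoir sampling: row `j` replaces the current choice with probability w_j / (w_0 + … + w_j).
Row `j` is the final choice with probability w_j / W, as the factors for the later rows telescope.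
One pass suffices, and every probability is computed from a running sum. -/
lemma sample_wp {κ : ℝ≥0∞} {f : Memory → ℝ≥0∞} {m : Memory} {w : ℕ → ℝ≥0} {N : ℕ}
    (h49 : m.nat (varAddr 49) = N) (hw : ∀ j < N, m.real (11, j, 0, 0, 0) = w j)
    (hpos : ∑ j ∈ Finset.range N, w j ≠ 0) {g : ℕ → ℝ≥0∞}
    (hg : ∀ j < N, ∀ m', Frame sample m m' → m'.nat (varAddr 56) = j → f m' ≤ g j) :
    wp κ sample f m ≤ κ * (N * 9 + 7 : ℕ)
      + ∑ j ∈ Finset.range N, ((w j / ∑ i ∈ Finset.range N, w i : ℝ≥0) : ℝ≥0∞) * g j := by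
  set W := ∑ i ∈ Finset.range N, w i with hW
  have hN : 0 < N := by
    rcases Nat.eq_zero_or_pos N with h | h
    · exact absurd (by simp [hW, h]) hpos
    · exact h
  have hstep : ∀ m₁ x c, Frame sample m m₁ → sample.writesNat x = true →
      Frame sample m (m₁.writeNat (varAddr x) c) := by
    intro m₁ x c hf hx
    refine ⟨fun a i ha => ?_, fun a i ha => hf.2 a i ha⟩
    rw [Memory.nat_writeNat, if_neg, hf.1 a i ha]
    intro h
    obtain rfl : a = x := congrArg Prod.fst h
    rw [ha] at hx
    exact absurd hx (by simp)
  have hstep' : ∀ m₁ c, Frame sample m m₁ → Frame sample m (m₁.writeReal (varAddr 16) c) := by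
    intro m₁ c hf
    refine ⟨fun a i ha => hf.1 a i ha, fun a i ha => ?_⟩
    rw [Memory.real_writeReal, if_neg, hf.2 a i ha]
    intro h
    obtain rfl : a = 16 := congrArg Prod.fst h
    exact absurd ha (by decide)
  -- After `k` rows the current choice survives to the end with probability (w_0 + … + w_{k-1}) / W,
  -- and each later row `j` is the final choice with probability w_j / W.
  have key : ∀ r k p m₁, k + r = N → p < N → Frame sample m m₁ → m₁.nat (varAddr 55) = k →
      m₁.nat (varAddr 56) = p →
      m₁.real (varAddr 16) = ((∑ i ∈ Finset.range k, w i : ℝ≥0) : ℝ) →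
      wp κ (.loop (.natLt (.var 55) (.var 49)) ((
        .setReal (.var 16)
          (.add (.get (.var 16)) (.get ⟨11, .var 55, .lit 0, .lit 0, .lit 0⟩)) ;;
        .toss (.var 57) (.div (.get ⟨11, .var 55, .lit 0, .lit 0, .lit 0⟩) (.get (.var 16))) ;;
        .ite (.natEq (.var 57) (.lit 1)) (.setNat (.var 56) (.var 55)) .skip) ;;
        .setNat (.var 55) (.add (.var 55) (.lit 1)))) f m₁
      ≤ κ * (r * 9 + 1 : ℕ) + (((∑ i ∈ Finset.range k, w i) / W : ℝ≥0) : ℝ≥0∞) * g p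
        + ∑ j ∈ Finset.Ico k N, ((w j / W : ℝ≥0) : ℝ≥0∞) * g j := by
    intro r
    induction r with
    | zero =>
      intro k p m₁ hk hp hf h55 h56 h16
      obtain rfl : k = N := by omega
      refine (wp_loop_le_unfold _ _ _ _ _).trans ?_
      rw [if_neg (by
        have := hf.nat 49 (0, 0, 0, 0)
        simp [h55, this, h49])]
      rw [Finset.Ico_self, Finset.sum_empty, add_zero, ← hW, div_self hpos, ENNReal.coe_one,
        one_mul]
      simpa using add_le_add_right (hg p hp m₁ hf h56) κ
    | succ r ih =>
      intro k p m₁ hk hp hf h55 h56 h16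
      have hkN : k < N := by omega
      refine (wp_loop_le_unfold _ _ _ _ _).trans ?_
      rw [if_pos (by
        have := hf.nat 49 (0, 0, 0, 0)
        simp [h55, this, h49, hkN])]
      set S := ∑ i ∈ Finset.range k, w i with hS
      set S' := ∑ i ∈ Finset.range (k + 1), w i with hS'
      have hSS : S' = S + w k := Finset.sum_range_succ w k
      have h11 : m₁.real (11, k, 0, 0, 0) = w k := (hf.real 11 _).trans (hw k hkN)
      set π : ℝ≥0 := w k / S' with hπ
      have hπ1 : π ≤ 1 := div_le_one_of_le₀ (by rw [hSS]; exact le_add_self) zero_le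
      have hmin : min π 1 = π := min_eq_left hπ1
      have h1 : π * (S' / W) = w k / W := by
        rw [hπ]
        -- While all weights so far are 0, the quotient 0/0 is read as 0 and nothing is chosen; the
        -- initial choice then has survival factor 0.
        by_cases h0 : S' = 0
        · have : w k = 0 := by
            rw [hSS, add_eq_zero] at h0
            exact h0.2
          simp [this]
        · field_simp
      have h2 : (1 - π) * (S' / W) = S / W := by
        rw [tsub_mul, h1, one_mul, hSS, add_div, add_tsub_cancel_right]
      have hR : ∑ j ∈ Finset.Ico k N, ((w j / W : ℝ≥0) : ℝ≥0∞) * g j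
          = ((w k / W : ℝ≥0) : ℝ≥0∞) * g k
            + ∑ j ∈ Finset.Ico (k + 1) N, ((w j / W : ℝ≥0) : ℝ≥0∞) * g j :=
        Finset.sum_eq_sum_Ico_succ_bot hkN _
      set m₂ := m₁.writeReal (varAddr 16) S' with hm2
      have hf2 : Frame sample m m₂ := hstep' _ _ hf
      have i1 := ih (k + 1) k (((m₂.writeNat (varAddr 57) 1).writeNat (varAddr 56) k).writeNat
        (varAddr 55) (k + 1)) (by omega) hkN
        (hstep _ _ _ (hstep _ _ _ (hstep _ _ _ hf2 rfl) rfl) rfl) (by simp) (by simp)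
        (by simp [hm2, hS'])
      have i2 := ih (k + 1) p ((m₂.writeNat (varAddr 57) 0).writeNat
        (varAddr 55) (k + 1)) (by omega) hp
        (hstep _ _ _ (hstep _ _ _ hf2 rfl) rfl) (by simp) (by simp [hm2, h56])
        (by simp [hm2, hS'])
      have hreal : ((RExp.get (.var 16)).add (.get ⟨11, .var 55, .lit 0, .lit 0, .lit 0⟩)).eval m₁
          = (S' : ℝ) := by
        simp [h16, h55, h11, hSS]
      have hp2 : ((RExp.get ⟨11, .var 55, .lit 0, .lit 0, .lit 0⟩).div (.get (.var 16))).eval m₂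
          = (π : ℝ) := by
        simp [hm2, h55, h11, hπ]
      have e55 : (NExp.var 55).eval (m₂.writeNat (varAddr 57) 1) = k := by simp [hm2, h55]
      have e55' : (NExp.add (.var 55) (.lit 1)).eval
          ((m₂.writeNat (varAddr 57) 1).writeNat (varAddr 56) k) = k + 1 := by simp [hm2, h55]
      have e55'' : (NExp.add (.var 55) (.lit 1)).eval (m₂.writeNat (varAddr 57) 0) = k + 1 := by
        simp [hm2, h55]
      have t1 : (Test.natEq (.var 57) (.lit 1)).holds (m₂.writeNat (varAddr 57) 1) := by simp
      have t0 : ¬ (Test.natEq (.var 57) (.lit 1)).holds (m₂.writeNat (varAddr 57) 0) := by simp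
      have a16 : ∀ m, (AExp.var 16).eval m = varAddr 16 := fun _ => rfl
      have a55 : ∀ m, (AExp.var 55).eval m = varAddr 55 := fun _ => rfl
      have a56 : ∀ m, (AExp.var 56).eval m = varAddr 56 := fun _ => rfl
      have a57 : ∀ m, (AExp.var 57).eval m = varAddr 57 := fun _ => rfl
      rw [wp, wp, wp, a16, hreal, ← hm2, wp, wp, coin_expect, hp2, Real.toNNReal_coe, hmin]
      simp only [if_true, Bool.false_eq_true, if_false, a57]
      rw [wp, if_pos t1, wp, wp, a56, a55, e55, e55']
      rw [wp, if_neg t0, wp, wp, a55, e55'']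
      refine (add_le_add_right (add_le_add_right (add_le_add_right (add_le_add_right
        (add_le_add_right (add_le_add_right (add_le_add
        (mul_le_mul_right (add_le_add_right (add_le_add_right (add_le_add_right i1 κ) κ) κ) _)
        (mul_le_mul_right (add_le_add_right (add_le_add_right (add_le_add_right i2 κ) κ) κ) _))
        κ) κ) κ) κ) κ) κ).trans ?_
      rw [hR, ← h1, ← h2]
      set R := ∑ j ∈ Finset.Ico (k + 1) N, ((w j / W : ℝ≥0) : ℝ≥0∞) * g j
      have hsum : (π : ℝ≥0∞) + ((1 - π : ℝ≥0) : ℝ≥0∞) = 1 := by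
        rw [← ENNReal.coe_add, add_tsub_cancel_of_le hπ1, ENNReal.coe_one]
      rw [ENNReal.coe_mul, ENNReal.coe_mul]
      set α : ℝ≥0∞ := (π : ℝ≥0∞)
      set β : ℝ≥0∞ := ((1 - π : ℝ≥0) : ℝ≥0∞)
      set γ : ℝ≥0∞ := ((S' / W : ℝ≥0) : ℝ≥0∞)
      push_cast
      refine le_of_eq ?_
      calc _ = 6 * κ + (α + β) * (3 * κ + κ * (r * 9 + 1) + R) + α * γ * g k
            + β * γ * g p := by ring
        _ = _ := by rw [hsum]; ring
  have hz : (RExp.ofNat (.lit 0)).eval m = 0 := by simp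
  have a16 : (AExp.var 16).eval m = varAddr 16 := rfl
  have k0 := key N 0 0 (((m.writeReal (varAddr 16) 0).writeNat (varAddr 56) 0).writeNat
    (varAddr 55) 0) (by omega) hN (hstep _ _ _ (hstep _ _ _ (hstep' _ _ (Frame.refl _ _)) rfl) rfl)
    (by simp) (by simp) (by simp)
  have hu : wp κ sample f m = κ + (κ + (κ + (κ + (κ + (κ + wp κ
      (.loop (.natLt (.var 55) (.var 49)) ((
        .setReal (.var 16)
          (.add (.get (.var 16)) (.get ⟨11, .var 55, .lit 0, .lit 0, .lit 0⟩)) ;;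
        .toss (.var 57) (.div (.get ⟨11, .var 55, .lit 0, .lit 0, .lit 0⟩) (.get (.var 16))) ;;
        .ite (.natEq (.var 57) (.lit 1)) (.setNat (.var 56) (.var 55)) .skip) ;;
        .setNat (.var 55) (.add (.var 55) (.lit 1)))) f
      (((m.writeReal (varAddr 16) 0).writeNat (varAddr 56) 0).writeNat
    (varAddr 55) 0)))))) := by
    rw [sample, wp, wp, a16, hz, wp, wp, forLoop, wp, wp]
    rfl
  rw [hu]
  refine (add_le_add_right (add_le_add_right (add_le_add_right (add_le_add_right
    (add_le_add_right (add_le_add_right k0 κ) κ) κ) κ) κ) κ).trans (le_of_eq ?_)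
  rw [Finset.range_zero, Finset.sum_empty, zero_div, ENNReal.coe_zero, zero_mul, add_zero,
    Nat.Ico_zero_eq_range]
  push_cast
  ring

lemma mem_table {B : List (Fin n)} {base ρ : Conf n q} (h : ρ ∈ table B base) {v : Fin n}
    (hv : v ∉ B) : ρ v = base v := by
  induction B using List.reverseRecOn generalizing ρ with
  | nil =>
    simp only [table, List.foldl_nil, List.mem_singleton] at h
    rw [h]
  | append_singleton B y ih =>
    rw [table_snoc, spread, List.mem_flatMap] at h
    obtain ⟨a, -, h⟩ := h
    obtain ⟨τ, hτ, rfl⟩ := List.mem_map.1 h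
    simp only [List.mem_append, List.mem_singleton, not_or] at hv
    rw [Function.update_of_ne hv.2, ih hτ hv.1]

/-! ### Acceptance, rejection and one round of the sampler. -/

/-- The situation between two rounds: the stack is `s`, the present configuration is `X`. -/
structure Ready (I : SpinSystem n q) (adj : Fin n → List (Fin n)) (ℓ : ℕ) (s : List (Fin n))
    (X : Conf n q) (m : Memory) : Prop where
  hasSystem : HasSystem I adj ℓ m
  hasConf : HasConf X m
  nodup : s.Nodup
  hasRows : ∃ rows, HasRows rows m ∧ rows 0 = s ∧ ∀ r, m.nat (varAddr 30) < r → rows r = []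

/-- Replaces the configuration on the ball by the chosen row of the table. -/
def copyBack : Cmd :=
  forLoop 59 (.get₁ 9 (.var 31)) (.setNat (.var 60) (.get₂ 7 (.var 31) (.var 59)) ;;
    .setNat ⟨1, .var 60, .lit 0, .lit 0, .lit 0⟩
      (.get 10 (.get₁ 9 (.var 32)) (.var 56) (.var 60) (.lit 0)))

lemma copyBack_runs {adj : Fin n → List (Fin n)} {ℓ : ℕ} {s : List (Fin n)}
    {u : Fin n} {ra rb : ℕ} {rows : ℕ → List (Fin n)} {m : Memory} {D j : ℕ} {X ρ : Conf n q}
    (hS : IsSetup adj ℓ s u ra rb rows m) (hX : HasConf X m)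
    (hD : (ballList adj u ℓ).length ≤ D) (h56 : m.nat (varAddr 56) = j)
    (hρ : ∀ v ∈ ballList adj u ℓ, m.nat (10, (blockList adj ℓ s u).length, j, v, 0) = ρ v)
    (hXρ : ∀ v, v ∉ ballList adj u ℓ → ρ v = X v) :
    ∃ m', Runs copyBack m m' (D * 6 + 3) ∧ HasConf ρ m' := by
  set S := ballList adj u ℓ with hSdef
  obtain ⟨m', hm', hinv, -⟩ := forLoop_runs (i := 59) (N := .get₁ 9 (.var 31))
    (body := .setNat (.var 60) (.get₂ 7 (.var 31) (.var 59)) ;;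
      .setNat ⟨1, .var 60, .lit 0, .lit 0, .lit 0⟩
      (.get 10 (.get₁ 9 (.var 32)) (.var 56) (.var 60) (.lit 0)))
    (m := m) S.length D 3
    (fun k m' => ∀ v : Fin n, m'.nat (1, v, 0, 0, 0) = if v ∈ S.take k then ρ v else X v) hD rfl
    (by
      intro v
      have := hX v
      simpa using this)
    (fun k _ m' hf _ _ => by
      have hS1 := hS.frame hf
      have := hS1.ra_eq
      simp [this, hS1.hasRows.len, hS1.ball, hSdef])
    (by
      intro k hk m₁ hf hI hik
      have hS1 := hS.frame hf
      have h1 := Runs.setNat (m := m₁) (.var 60) (.get₂ 7 (.var 31) (.var 59))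
      have e1 : (NExp.get₂ 7 (.var 31) (.var 59)).eval m₁ = (S[k] : ℕ) := by
        have hra := hS1.ra_eq
        have := hS1.hasRows.item ra k (by rw [hS1.ball]; exact hk)
        simp only [hS1.ball] at this
        simp [hra, hik, this, hSdef]
      rw [e1] at h1
      change Runs _ _ (m₁.writeNat (varAddr 60) (S[k] : ℕ)) _ at h1
      refine ⟨_, h1.seq (Runs.setNat _ _), fun v => ?_⟩
      have hrb := hS1.rb_eq
      have h9 := hS1.hasRows.len rb
      rw [hS1.block] at h9
      have g56 := hf.nat 56 (0, 0, 0, 0)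
      have g10 := fun i => hf.nat 10 i
      have hρk := hρ S[k] (List.getElem_mem hk)
      have htake : S.take (k + 1) = S.take k ++ [S[k]] := by simp
      rw [htake]
      by_cases hv : v = S[k]
      · rw [← hv] at hρk
        simp [← hv, hrb, h9, g56, g10, h56, hρk]
      · have hv' : (v : ℕ) ≠ S[k] := fun h => hv (Fin.ext h)
        have := hI v
        simp only [List.mem_append, List.mem_singleton, hv, or_false]
        rw [← this]
        simp [hv'])
  refine ⟨m', hm', fun v => ?_⟩
  rw [hinv v, List.take_length]
  split_ifs with h
  · rfl
  · rw [hXρ v h]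

/-- Resamples the block and removes the last vertex from the stack. -/
def acceptCmd : Cmd :=
  sample ;; copyBack ;;
    .setNat ⟨9, .lit 0, .lit 0, .lit 0, .lit 0⟩ (.sub (.get₁ 9 (.lit 0)) (.lit 1)) ;;
    .setNat ⟨8, .lit 0, .var 33, .lit 0, .lit 0⟩ (.lit 0)

/-- The rows of the table enumerate the configurations that extend the boundary condition, with
their conditional weights; choosing a row by weight is the kernel `resample`. -/
lemma acceptCmd_wp {I : SpinSystem n q} {adj : Fin n → List (Fin n)} {ℓ : ℕ} {s : List (Fin n)}
    {u : Fin n} {ra rb : ℕ} {rows : ℕ → List (Fin n)} {m : Memory} {D K : ℕ} {X : Conf n q}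
    (hI : HasSystem I adj ℓ m) (hS : IsSetup adj ℓ (s ++ [u]) u ra rb rows m) (hX : HasConf X m)
    (hnd : (s ++ [u]).Nodup) (hperm : I.Permissive) (hadj : ∀ v w, w ∈ adj v ↔ I.graph.Adj v w)
    (hℓ : 1 ≤ ℓ) (hD : (ballList adj u ℓ).length ≤ D)
    (hK : q ^ (blockList adj ℓ (s ++ [u]) u).length ≤ K)
    (hT : HasTable (ballList adj u ℓ) (blockList adj ℓ (s ++ [u]) u).length
      (table (blockList adj ℓ (s ++ [u]) u) X) m)
    (h49 : m.nat (varAddr 49) = (table (blockList adj ℓ (s ++ [u]) u) X).length)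
    (hw : ∀ j (hj : j < (table (blockList adj ℓ (s ++ [u]) u) X).length),
      m.real (11, j, 0, 0, 0) = I.condWeight (I.block ℓ (s ++ [u]).toFinset u)ᶜ
        (table (blockList adj ℓ (s ++ [u]) u) X)[j])
    {κ : ℝ≥0∞} {f : Memory → ℝ≥0∞} {g : Conf n q → ℝ≥0∞}
    (hfg : ∀ X' m', Ready I adj ℓ s X' m' → f m' ≤ g X') :
    wp κ acceptCmd f m ≤ κ * (K * 9 + D * 6 + 15 : ℕ)
      + I.resample (I.block ℓ (s ++ [u]).toFinset u)ᶜ X g := by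
  classical
  set B := blockList adj ℓ (s ++ [u]) u with hB
  set L := table B X with hL
  set Λ := (I.block ℓ (s ++ [u]).toFinset u)ᶜ with hΛ
  have hBΛ : (B.toFinset)ᶜ = Λ := by rw [hB, blockList_toFinset hadj hℓ]
  let w : ℕ → ℝ≥0 := fun j => if h : j < L.length then I.condWeight Λ L[j] else 0
  -- Sums over row numbers become sums over extensions; this is used for the normalising constant
  -- and for the expectation.
  have hsumgen : ∀ {M : Type} [AddCommMonoid M] (F : Conf n q → M) (G : ℕ → M),
      (∀ j (h : j < L.length), G j = F L[j]) →
      ∑ j ∈ Finset.range L.length, G j = ∑ ρ ∈ SpinSystem.extensions Λ X, F ρ := by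
    intro M _ F G hFG
    rw [← hBΛ, ← sum_map_table nodup_blockList, Finset.sum_range, ← hL, ← List.sum_ofFn]
    congr 1
    refine List.ext_getElem (by simp) fun i h1 h2 => ?_
    simp only [List.getElem_ofFn, List.getElem_map]
    exact hFG i _
  have hW : ∑ j ∈ Finset.range L.length, w j = I.condZ Λ X :=
    hsumgen _ _ fun j h => by simp [w, h]
  have hZ : I.condZ Λ X ≠ 0 := (hperm Λ X).ne'
  -- The deterministic cost of copying the row back and popping the stack is charged to every
  -- outcome; as the probabilities add up to 1 it comes out unchanged.
  set gj : ℕ → ℝ≥0∞ := fun j =>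
    κ * (D * 6 + 7 : ℕ) + if h : j < L.length then g L[j] else 0 with hgj
  rw [acceptCmd, wp]
  have hmain := sample_wp (κ := κ) (f := wp κ (copyBack ;;
    .setNat ⟨9, .lit 0, .lit 0, .lit 0, .lit 0⟩ (.sub (.get₁ 9 (.lit 0)) (.lit 1)) ;;
    .setNat ⟨8, .lit 0, .var 33, .lit 0, .lit 0⟩ (.lit 0)) f) (w := w) h49
    (fun j hj => by rw [hw j hj]; simp [w, hj]) (by rw [hW]; exact hZ) (g := gj) (by
      intro j hj m₁ hf h56
      have hS1 := hS.frame hf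
      have hT1 := hT.frame hf
      have hmem : L[j] ∈ L := List.getElem_mem hj
      obtain ⟨m₂, h2, hX2⟩ := copyBack_runs (ρ := L[j]) hS1 (hX.frame hf) hD h56
        (fun v hv => hT1 j hj v hv)
        (fun v hv => mem_table hmem fun h => hv (blockList_subset h))
      have hrun := h2.seq ((Runs.setNat (m := m₂) ⟨9, .lit 0, .lit 0, .lit 0, .lit 0⟩
        (.sub (.get₁ 9 (.lit 0)) (.lit 1))).seq
        (Runs.setNat ⟨8, .lit 0, .var 33, .lit 0, .lit 0⟩ (.lit 0)))
      refine (hrun.wp_le κ f).trans ?_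
      rw [hgj]
      simp only [dif_pos hj]
      refine add_le_add (mul_le_mul_right (by norm_cast) κ) (hfg _ _ ?_)
      have hI2 := ((hI.frame hf).frame h2.frame).frame
        ((Runs.setNat (m := m₂) ⟨9, .lit 0, .lit 0, .lit 0, .lit 0⟩
        (.sub (.get₁ 9 (.lit 0)) (.lit 1))).seq
        (Runs.setNat ⟨8, .lit 0, .var 33, .lit 0, .lit 0⟩ (.lit 0))).frame
      have hS2 := hS1.frame h2.frame
      have hnd' := List.nodup_append.1 hnd
      have hus : u ∉ s := fun h => hnd'.2.2 u h u (List.mem_singleton_self u) rfl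
      have h33 := hS2.u_eq
      have h30 := hS2.clock_eq
      -- To pop `u` it is enough to decrease the length and to clear one mark; the stale entry
      -- beyond the length is never read.
      refine ⟨hI2, ?_, hnd'.1, Function.update rows 0 s, ⟨?_, ?_, ?_⟩, by simp, ?_⟩
      · intro v
        have := hX2 v
        simpa using this
      · intro r
        have := hS2.hasRows.len r
        by_cases hr : r = 0
        · subst hr
          rw [hS2.stack] at this
          simp [this]
        · simp [hr, this]
      · intro r i hi
        by_cases hr : r = 0
        · subst hr
          simp only [Function.update_self] at hi ⊢
          have := hS2.hasRows.item 0 i (by rw [hS2.stack, List.length_append]; omega)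
          simp only [hS2.stack] at this
          rw [List.getElem_append_left hi] at this
          simpa using this
        · simp only [Function.update_of_ne hr] at hi ⊢
          simpa using hS2.hasRows.item r i hi
      · intro r v
        have := hS2.hasRows.mark r v
        by_cases hr : r = 0
        · subst hr
          rw [hS2.stack] at this
          by_cases hv : v = u
          · subst hv
            simp [h33, hus]
          · have hv' : (v : ℕ) ≠ u := fun h => hv (Fin.ext h)
            simp [h33, hv', this, hv]
        · simp [hr, this]
      · intro r hr
        have h1 : rb < r := by simpa [h30] using hr
        have h2 := hS2.ra_pos
        have h3 := hS2.ra_lt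
        rw [Function.update_of_ne (by omega), hS2.fresh r h1])
  refine (add_le_add_right hmain κ).trans ?_
  have hmain2 : ∑ j ∈ Finset.range L.length,
      ((w j / ∑ i ∈ Finset.range L.length, w i : ℝ≥0) : ℝ≥0∞) * gj j
      = κ * (D * 6 + 7 : ℕ) + I.resample Λ X g := by
    have hconst := SpinSystem.resample_const hperm Λ X (κ * (D * 6 + 7 : ℕ))
    have hres : ∀ H : Conf n q → ℝ≥0∞, I.resample Λ X H
        = ∑ ρ ∈ SpinSystem.extensions Λ X,
          ((I.condWeight Λ ρ / I.condZ Λ X : ℝ≥0) : ℝ≥0∞) * H ρ := by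
      intro H
      rw [SpinSystem.resample, div_eq_mul_inv, Finset.sum_mul]
      refine Finset.sum_congr rfl fun ρ _ => ?_
      rw [ENNReal.coe_div hZ, div_eq_mul_inv]
      ring
    rw [← hconst, hres, hres, ← Finset.sum_add_distrib, hW]
    refine hsumgen _ _ fun j h => ?_
    simp only [hgj, w, dif_pos h]
    ring
  rw [hmain2]
  have hlen : L.length ≤ K := by rw [hL, length_table]; exact hK
  calc _ = κ * (L.length * 9 + D * 6 + 15 : ℕ) + I.resample Λ X g := by
        push_cast
        ring
    _ ≤ _ := by gcongr

/-- Pushes the sphere to the stack. -/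
def rejectCmd : Cmd :=
  forLoop 61 (.get₁ 9 (.var 31)) (.ite (.natLt (.var 61) (.var 23)) .skip
    (pushTo (.lit 0) (.get₂ 7 (.var 31) (.var 61))))

lemma rejectCmd_runs {I : SpinSystem n q} {adj : Fin n → List (Fin n)} {ℓ : ℕ}
    {s : List (Fin n)} {u : Fin n} {ra rb : ℕ} {rows : ℕ → List (Fin n)} {m : Memory} {D : ℕ}
    {X : Conf n q} (hI : HasSystem I adj ℓ m) (hS : IsSetup adj ℓ s u ra rb rows m)
    (hX : HasConf X m) (hnd : s.Nodup) (hD : (ballList adj u ℓ).length ≤ D) :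
    ∃ m', Runs rejectCmd m m' (D * 14 + 3) ∧ Ready I adj ℓ
      (pushAll s ((ballList adj u ℓ).drop (ballList adj u (ℓ - 1)).length)) X m' := by
  set S := ballList adj u ℓ with hSdef
  set c := (ballList adj u (ℓ - 1)).length with hc
  -- The row of the ball is not row 0, so pushing to the stack does not disturb the list that is
  -- being read.
  have hra0 := hS.ra_pos
  have hralt := hS.ra_lt
  obtain ⟨m', hm', hinv, -⟩ := forLoop_runs (i := 61) (N := .get₁ 9 (.var 31))
    (body := .ite (.natLt (.var 61) (.var 23)) .skip
      (pushTo (.lit 0) (.get₂ 7 (.var 31) (.var 61))))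
    (m := m) S.length D 11
    (fun k m' => HasRows (Function.update rows 0 (pushAll s ((S.take k).drop c))) m') hD rfl
    (by
      have : Function.update rows 0 (pushAll s ((S.take 0).drop c)) = rows := by
        simp [pushAll, ← hS.stack]
      rw [this]
      exact hS.hasRows.writeNat _ _)
    (fun k _ m' hf hrows _ => by
      have h31 := (hf.nat 31 (0, 0, 0, 0)).trans hS.ra_eq
      have := hrows.len ra
      rw [Function.update_of_ne hra0.ne', hS.ball] at this
      simp [h31, this, hSdef])
    (by
      intro k hk m₁ hf hrows hik
      have h31 := (hf.nat 31 (0, 0, 0, 0)).trans hS.ra_eq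
      have h23 := (hf.nat 23 (0, 0, 0, 0)).trans hS.inner_eq
      have htake : S.take (k + 1) = S.take k ++ [S[k]] := by simp
      by_cases hkc : k < c
      · refine ⟨m₁, (Runs.ite_true ?_ Runs.skip).mono (by omega), ?_⟩
        · simp [hik, h23, hkc, ← hc]
        -- The first `c` entries form the inner ball; while they are passed, nothing is pushed.
        · have e : (S.take (k + 1)).drop c = (S.take k).drop c := by
            rw [List.drop_eq_nil_of_le (by rw [List.length_take]; omega),
              List.drop_eq_nil_of_le (by rw [List.length_take]; omega)]
          rw [e]
          exact hrows.writeNat _ _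
      · have hitem := hrows.item ra k (by
          rw [Function.update_of_ne hra0.ne', hS.ball]; exact hk)
        simp only [Function.update_of_ne hra0.ne', hS.ball] at hitem
        obtain ⟨m₂, h2, hrows2⟩ := pushTo_runs (r := 0) (v := S[k]) (er := .lit 0)
          (ev := .get₂ 7 (.var 31) (.var 61)) hrows (by simp [h31, hik, hitem, hSdef]) (by simp)
        refine ⟨m₂, Runs.ite_false ?_ h2, ?_⟩
        · simp [hik, h23, hkc, ← hc]
        · rw [htake, List.drop_append_of_le_length (by rw [List.length_take]; omega), pushAll_snoc]
          simpa using hrows2.writeNat (varAddr 61) (k + 1))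
  rw [List.take_length] at hinv
  refine ⟨m', hm', hI.frame hm'.frame, hX.frame hm'.frame, nodup_pushAll hnd _, _, hinv, by simp,
    fun r hr => ?_⟩
  have h30 := (hm'.nat 30 (0, 0, 0, 0)).trans hS.clock_eq
  rw [h30] at hr
  rw [Function.update_of_ne (by omega), hS.fresh r hr]

/-- The probability of acceptance as an expression. -/
def acceptExp : RExp :=
  .div (.div (.get (.var 15)) (.get (.var 14))) (.mul (.div (.get (.var 13)) (.get (.var 12)))
    (.add (.ofNat (.lit 1)) (.div (.ofNat (.lit 1)) (.mul (.ofNat (.lit 5))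
      (.ofNat (.sub (.get₁ 9 (.var 31)) (.var 23)))))))

/-- One round of the sampler. -/
def round : Cmd :=
  setup ;; enumerate false ;; .setReal (.var 14) (.get (.var 12)) ;;
    .setReal (.var 15) (.get (.var 13)) ;; enumerate true ;; .toss (.var 58) acceptExp ;;
    .ite (.natEq (.var 58) (.lit 1)) acceptCmd rejectCmd

/-- The expected value of `G` after one round with the stack `s ++ [u]`. -/
noncomputable def roundExpect [NeZero q] (I : SpinSystem n q) (adj : Fin n → List (Fin n)) (ℓ : ℕ)
    (G : List (Fin n) → Conf n q → ℝ≥0∞) (s : List (Fin n)) (u : Fin n) (X : Conf n q) : ℝ≥0∞ :=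
  (I.accept ℓ (s ++ [u]).toFinset u X : ℝ≥0∞)
      * I.resample (I.block ℓ (s ++ [u]).toFinset u)ᶜ X (G s)
    + ((1 - I.accept ℓ (s ++ [u]).toFinset u X : ℝ≥0) : ℝ≥0∞)
      * G (pushAll (s ++ [u]) ((ballList adj u ℓ).drop (ballList adj u (ℓ - 1)).length)) X

/-- A bound for the running time of one round. -/
def roundTime (q D d K : ℕ) : ℕ :=
  (D * (D * (d * 13 + 8) + 8) + D * 16 + 41) +
    2 * (D * (q * (K * (D * 6 + 10) + 6) + 12) + K * (D * (d * 7 + 10) + 15) + D * 7 + 17) +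
    (K * 9 + D * 14 + 15) + 10

/-- The order of the two enumerations matters: the reference comes first and its two sums are saved
in variables `14` and `15`; the enumeration for the present configuration comes second, because its
table and weights are needed for the resampling. The two branches are bounded by a common cost, so
that the coin weights add up to 1 in the time bound. -/
lemma round_wp [NeZero q] {I : SpinSystem n q} {adj : Fin n → List (Fin n)} {ℓ : ℕ}
    {s : List (Fin n)} {u : Fin n} {m : Memory} {D d K : ℕ} {X : Conf n q}
    (h : Ready I adj ℓ (s ++ [u]) X m) (hperm : I.Permissive) (hssm : I.RatioSSM ℓ)
    (hadj : ∀ v w, w ∈ adj v ↔ I.graph.Adj v w) (hnd : ∀ v, (adj v).Nodup) (hℓ : 1 ≤ ℓ)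
    (hD : ∀ k ≤ ℓ, (ballList adj u k).length ≤ D) (hd : ∀ v, (adj v).length ≤ d)
    (hK : q ^ D ≤ K) {κ : ℝ≥0∞} {f : Memory → ℝ≥0∞} {G : List (Fin n) → Conf n q → ℝ≥0∞}
    (hfG : ∀ s' X' m', Ready I adj ℓ s' X' m' → f m' ≤ G s' X') :
    wp κ round f m ≤ κ * (roundTime q D d K : ℕ) + roundExpect I adj ℓ G s u X := by
  classical
  obtain ⟨rows, hrows, hr0, hfresh⟩ := h.hasRows
  obtain ⟨m₁, ra, rb, rows', h1, hS1⟩ := setup_runs h.hasSystem hrows hr0 hfresh hℓ hD hd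
  have hI1 := h.hasSystem.frame h1.frame
  have hX1 := h.hasConf.frame h1.frame
  have hDℓ := hD ℓ le_rfl
  have hKB : q ^ (blockList adj ℓ (s ++ [u]) u).length ≤ K :=
    (Nat.pow_le_pow_right NeZero.one_le
      (((nodup_blockList.subperm blockList_subset).length_le).trans hDℓ)).trans hK
  obtain ⟨m₂, h2, -, -, -, hZ2, hN2⟩ :=
    enumerate_runs false hI1 hS1 hX1 hadj hnd hℓ hDℓ hd hKB
  have h3 := Runs.setReal (m := m₂) (.var 14) (.get (.var 12))
  have e3 : (RExp.get (.var 12)).eval m₂ = m₂.real (varAddr 12) := rfl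
  rw [e3, hZ2] at h3
  change Runs _ _ (m₂.writeReal (varAddr 14) _) _ at h3
  set z0 := I.condZ (I.block ℓ (s ++ [u]).toFinset u)ᶜ (baseConf false (s ++ [u]) X) with hz0
  set p0 := I.condPart (I.block ℓ (s ++ [u]).toFinset u)ᶜ (baseConf false (s ++ [u]) X) u (X u)
    with hp0
  have h4 := Runs.setReal (m := m₂.writeReal (varAddr 14) z0) (.var 15) (.get (.var 13))
  have e4 : (RExp.get (.var 13)).eval (m₂.writeReal (varAddr 14) z0) = p0 := by
    simp [hN2]
  rw [e4] at h4
  change Runs _ _ ((m₂.writeReal (varAddr 14) z0).writeReal (varAddr 15) p0) _ at h4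
  have g14 : ((m₂.writeReal (varAddr 14) z0).writeReal (varAddr 15) p0).real (varAddr 14) = z0 := by
    simp
  have g15 : ((m₂.writeReal (varAddr 14) z0).writeReal (varAddr 15) p0).real (varAddr 15) = p0 := by
    simp
  have hI4 := ((hI1.frame h2.frame).frame h3.frame).frame h4.frame
  have hS4 := ((hS1.frame h2.frame).frame h3.frame).frame h4.frame
  have hX4 := ((hX1.frame h2.frame).frame h3.frame).frame h4.frame
  generalize (m₂.writeReal (varAddr 14) z0).writeReal (varAddr 15) p0 = m₄ at *
  obtain ⟨m₅, h5, hT5, h49, hw5, hZ5, hN5⟩ :=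
    enumerate_runs true hI4 hS4 hX4 hadj hnd hℓ hDℓ hd hKB
  have hI5 := hI4.frame h5.frame
  have hS5 := hS4.frame h5.frame
  have hX5 := hX4.frame h5.frame
  simp only [baseConf, if_true] at hT5 h49 hw5 hZ5 hN5
  -- The machine and `accept` treat zero denominators alike: both read them as 0, in particular
  -- 1/(5·0) for an empty sphere.
  have hp : acceptExp.eval m₅ = (I.accept ℓ (s ++ [u]).toFinset u X : ℝ) := by
    have f14 := (h5.real 14 (0, 0, 0, 0)).trans g14
    have f15 := (h5.real 15 (0, 0, 0, 0)).trans g15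
    have h31 := hS5.ra_eq
    have h23 := hS5.inner_eq
    have h9 := hS5.hasRows.len ra
    rw [hS5.ball] at h9
    simp only [acceptExp, RExp.eval, AExp.eval, NExp.eval, f14, f15, h31, h23, h9, hZ5, hN5,
      length_drop_ballList hadj hℓ, hz0, hp0]
    rw [SpinSystem.accept, SpinSystem.condMarginal_eq, SpinSystem.condMarginal_eq]
    simp [baseConf]
  have hacc := SpinSystem.accept_le_one hssm hℓ (R := (s ++ [u]).toFinset) (u := u) X
  set a := I.accept ℓ (s ++ [u]).toFinset u X with ha
  have hmin : min a 1 = a := min_eq_left hacc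
  -- the two outcomes of the coin
  have hframe : ∀ c, Frame (.toss (.var 58) acceptExp) m₅ (m₅.writeNat (varAddr 58) c) := by
    intro c
    refine ⟨fun b i hb => ?_, fun _ _ _ => rfl⟩
    simp only [Cmd.writesNat, beq_eq_false_iff_ne] at hb
    rw [Memory.nat_writeNat, if_neg]
    intro h
    exact hb (congrArg Prod.fst h).symm
  have hwacc : wp κ acceptCmd f (m₅.writeNat (varAddr 58) 1) ≤ κ * (K * 9 + D * 14 + 15 : ℕ)
      + I.resample (I.block ℓ (s ++ [u]).toFinset u)ᶜ X (G s) := by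
    have hf := hframe 1
    refine (acceptCmd_wp (g := G s) (hI5.frame hf) (hS5.frame hf) (hX5.frame hf) h.nodup hperm hadj
      hℓ hDℓ hKB (hT5.frame hf) ((hf.nat 49 _).trans h49)
      (fun j hj => (hf.real 11 _).trans (hw5 j hj)) (fun X' m' => hfG s X' m')).trans ?_
    gcongr
    omega
  have hwrej : wp κ rejectCmd f (m₅.writeNat (varAddr 58) 0) ≤ κ * (K * 9 + D * 14 + 15 : ℕ)
      + G (pushAll (s ++ [u]) ((ballList adj u ℓ).drop (ballList adj u (ℓ - 1)).length)) X := by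
    have hf := hframe 0
    obtain ⟨m₆, h6, hR⟩ := rejectCmd_runs (hI5.frame hf) (hS5.frame hf) (hX5.frame hf) h.nodup hDℓ
    refine ((h6.wp_le κ f).trans (add_le_add_right (hfG _ _ _ hR) _)).trans ?_
    exact add_le_add_left (mul_le_mul_right (by norm_cast; omega) κ) _
  have hcoin : wp κ (.toss (.var 58) acceptExp ;;
      .ite (.natEq (.var 58) (.lit 1)) acceptCmd rejectCmd) f m₅
      ≤ κ * (K * 9 + D * 14 + 15 + 3 : ℕ) + roundExpect I adj ℓ G s u X := by
    have t1 : (Test.natEq (.var 58) (.lit 1)).holds (m₅.writeNat (varAddr 58) 1) := by simp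
    have t0 : ¬ (Test.natEq (.var 58) (.lit 1)).holds (m₅.writeNat (varAddr 58) 0) := by simp
    have a58 : (AExp.var 58).eval m₅ = varAddr 58 := rfl
    rw [wp, wp, coin_expect, hp, Real.toNNReal_coe, hmin, a58]
    simp only [if_true, Bool.false_eq_true, if_false]
    rw [wp, wp, if_pos t1, if_neg t0]
    refine (add_le_add_right (add_le_add_right (add_le_add
      (mul_le_mul_right (add_le_add_right hwacc κ) _)
      (mul_le_mul_right (add_le_add_right hwrej κ) _)) κ) κ).trans ?_
    have hsum : (a : ℝ≥0∞) + ((1 - a : ℝ≥0) : ℝ≥0∞) = 1 := by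
      rw [← ENNReal.coe_add, add_tsub_cancel_of_le hacc, ENNReal.coe_one]
    rw [roundExpect, ← ha]
    generalize (a : ℝ≥0∞) = α at *
    generalize ((1 - a : ℝ≥0) : ℝ≥0∞) = β at *
    push_cast
    refine le_of_eq ?_
    calc _ = 2 * κ + (α + β) * (κ + κ * (K * 9 + D * 14 + 15))
            + (α * I.resample (I.block ℓ (s ++ [u]).toFinset u)ᶜ X (G s) + β * G (pushAll (s ++ [u])
              ((ballList adj u ℓ).drop (ballList adj u (ℓ - 1)).length)) X) := by ring
      _ = _ := by rw [hsum]; ring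
  have hfin := (((h1.seq h2).seq (h3.seq h4)).seq h5)
  have hassoc : wp κ round f m ≤ κ * ((D * (D * (d * 13 + 8) + 8) + D * 16 + 41) +
      2 * (D * (q * (K * (D * 6 + 10) + 6) + 12) + K * (D * (d * 7 + 10) + 15) + D * 7 + 17)
      + 7 : ℕ) + wp κ (.toss (.var 58) acceptExp ;;
      .ite (.natEq (.var 58) (.lit 1)) acceptCmd rejectCmd) f m₅ := by
    rw [round, wp]
    refine (add_le_add_right (h1.wp_le κ _) κ).trans ?_
    rw [wp]
    refine (add_le_add_right (add_le_add_right (add_le_add_right (h2.wp_le κ _) κ) _) κ).trans ?_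
    rw [wp]
    refine (add_le_add_right (add_le_add_right (add_le_add_right (add_le_add_right
      (add_le_add_right (h3.wp_le κ _) κ) _) κ) _) κ).trans ?_
    rw [wp]
    refine (add_le_add_right (add_le_add_right (add_le_add_right (add_le_add_right
      (add_le_add_right (add_le_add_right (add_le_add_right (h4.wp_le κ _) κ) _) κ) _) κ) _)
      κ).trans ?_
    rw [wp]
    refine (add_le_add_right (add_le_add_right (add_le_add_right (add_le_add_right
      (add_le_add_right (add_le_add_right (add_le_add_right (add_le_add_right (add_le_add_right
      (h5.wp_le κ _) κ) _) κ) _) κ) _) κ) _) κ).trans (le_of_eq ?_)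
    push_cast
    ring
  refine (hassoc.trans (add_le_add_right hcoin _)).trans (le_of_eq ?_)
  rw [roundTime]
  push_cast
  ring

/-! ### The main loop -/

section RoundExpect

variable [NeZero q] {I : SpinSystem n q} {adj : Fin n → List (Fin n)} {ℓ : ℕ} {s : List (Fin n)}
  {u : Fin n} {X : Conf n q}

lemma roundExpect_mono {G G' : List (Fin n) → Conf n q → ℝ≥0∞} (h : ∀ s X, G s X ≤ G' s X) :
    roundExpect I adj ℓ G s u X ≤ roundExpect I adj ℓ G' s u X := by
  unfold roundExpect SpinSystem.resample
  gcongr with ρ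
  · exact h s ρ
  · exact h _ X

/-- Monotone convergence, elementary because a round has finitely many outcomes. It turns statements
about truncated runs into statements about `sampler`. -/
lemma roundExpect_iSup {W : ℕ → List (Fin n) → Conf n q → ℝ≥0∞}
    (hW : ∀ s X, Monotone fun k => W k s X) :
    roundExpect I adj ℓ (fun s X => ⨆ k, W k s X) s u X = ⨆ k, roundExpect I adj ℓ (W k) s u X := by
  unfold roundExpect SpinSystem.resample
  have h1 : ∀ Λ : Finset (Fin n), Monotone fun k => (∑ ρ ∈ SpinSystem.extensions Λ X,
      (I.condWeight Λ ρ : ℝ≥0∞) * W k s ρ) / I.condZ Λ X := by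
    intro Λ i j hij
    refine ENNReal.div_le_div_right (Finset.sum_le_sum fun ρ _ => ?_) _
    exact mul_le_mul_right (hW s ρ hij) _
  rw [← ENNReal.iSup_add_iSup_of_monotone, ← ENNReal.mul_iSup, ← ENNReal.mul_iSup]
  · rw [← ENNReal.iSup_div, ← ENNReal.finsetSum_iSup_of_monotone]
    · simp only [ENNReal.mul_iSup]
    · exact fun ρ i j hij => mul_le_mul_right (hW s ρ hij) _
  · exact fun i j hij => mul_le_mul_right (h1 _ hij) _
  · exact fun i j hij => mul_le_mul_right (hW _ X hij) _

variable (I adj ℓ) in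
/-- The expectation of `f` after at most `k` rounds of the sampler that end with the empty stack. -/
noncomputable def iterate (f : Conf n q → ℝ≥0∞) : ℕ → List (Fin n) → Conf n q → ℝ≥0∞
  | 0, _, _ => 0
  | k + 1, s, X => if h : s = [] then f X
      else roundExpect I adj ℓ (iterate f k) s.dropLast (s.getLast h) X

lemma iterate_succ_nil (f : Conf n q → ℝ≥0∞) (k : ℕ) : iterate I adj ℓ f (k + 1) [] X = f X := by
  simp [iterate]

lemma iterate_succ_append (f : Conf n q → ℝ≥0∞) (k : ℕ) :
    iterate I adj ℓ f (k + 1) (s ++ [u]) X = roundExpect I adj ℓ (iterate I adj ℓ f k) s u X := by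
  simp [iterate]

lemma monotone_iterate (f : Conf n q → ℝ≥0∞) (s : List (Fin n)) (X : Conf n q) :
    Monotone fun k => iterate I adj ℓ f k s X := by
  refine monotone_nat_of_le_succ fun k => ?_
  induction k generalizing s X with
  | zero => exact zero_le
  | succ k ih =>
    rcases List.eq_nil_or_concat s with rfl | ⟨s, u, rfl⟩
    · simp [iterate_succ_nil]
    · rw [List.concat_eq_append, iterate_succ_append, iterate_succ_append]
      exact roundExpect_mono ih

variable (I adj ℓ) in
/-- The expectation of `f` at the end of the sampler. -/
noncomputable def sampler (f : Conf n q → ℝ≥0∞) (s : List (Fin n)) (X : Conf n q) : ℝ≥0∞ :=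
  ⨆ k, iterate I adj ℓ f k s X

/-- Induction on the number of rounds with `sum_step_le`. Runs cut off by the truncation count 0,
which is harmless for an upper bound; with the empty stack all configurations are extensions and the
hypothesis on `f` is the claim. -/
lemma sum_iterate_le (hperm : I.Permissive) (hssm : I.RatioSSM ℓ) (hℓ : 1 ≤ ℓ)
    (hadj : ∀ v w, w ∈ adj v ↔ I.graph.Adj v w) {f : Conf n q → ℝ≥0∞} {μ : ℝ≥0∞}
    (hμ : ∑ ρ, (I.weight ρ : ℝ≥0∞) * f ρ ≤ μ * ∑ ρ, (I.weight ρ : ℝ≥0∞)) (k : ℕ) :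
    ∀ {s : List (Fin n)}, s.Nodup → ∀ σ, ∑ ρ ∈ SpinSystem.extensions s.toFinset σ,
      (I.weight ρ : ℝ≥0∞) * iterate I adj ℓ f k s ρ
      ≤ μ * ∑ ρ ∈ SpinSystem.extensions s.toFinset σ, (I.weight ρ : ℝ≥0∞) := by
  induction k with
  | zero => intro s _ σ; simp [iterate]
  | succ k ih =>
    intro s hs σ
    rcases List.eq_nil_or_concat s with rfl | ⟨s, u, rfl⟩
    · have : SpinSystem.extensions (List.toFinset []) σ = Finset.univ := by
        ext ρ
        simp [SpinSystem.mem_extensions]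
      simp only [iterate_succ_nil, this]
      exact hμ
    · rw [List.concat_eq_append] at hs ⊢
      simp only [iterate_succ_append, roundExpect]
      refine SpinSystem.sum_step_le (R := (s ++ [u]).toFinset) (u := u) hperm hssm hℓ (by simp)
        (fun σ => ?_) (fun σ => ?_) σ
      · have hs' := List.nodup_append.1 hs
        have hus : u ∉ s := fun h => hs'.2.2 u h u (List.mem_singleton_self u) rfl
        have : (s ++ [u]).toFinset.erase u = s.toFinset := by
          ext v
          simp only [Finset.mem_erase, List.mem_toFinset, List.mem_append, List.mem_singleton]
          constructor
          · tauto
          · exact fun h => ⟨fun e => hus (e ▸ h), Or.inl h⟩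
        rw [this]
        exact ih hs'.1 σ
      · have : (s ++ [u]).toFinset ∪ I.sphereFinset ℓ u = (pushAll (s ++ [u])
            ((ballList adj u ℓ).drop (ballList adj u (ℓ - 1)).length)).toFinset := by
          rw [← drop_ballList_toFinset hadj hℓ]
          ext v
          simp only [Finset.mem_union, List.mem_toFinset, mem_pushAll]
        rw [this]
        exact ih (nodup_pushAll hs _) σ

lemma sum_sampler_le (hperm : I.Permissive) (hssm : I.RatioSSM ℓ) (hℓ : 1 ≤ ℓ)
    (hadj : ∀ v w, w ∈ adj v ↔ I.graph.Adj v w) {f : Conf n q → ℝ≥0∞} {μ : ℝ≥0∞}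
    (hμ : ∑ ρ, (I.weight ρ : ℝ≥0∞) * f ρ ≤ μ * ∑ ρ, (I.weight ρ : ℝ≥0∞))
    (hs : s.Nodup) (σ : Conf n q) :
    ∑ ρ ∈ SpinSystem.extensions s.toFinset σ, (I.weight ρ : ℝ≥0∞) * sampler I adj ℓ f s ρ
      ≤ μ * ∑ ρ ∈ SpinSystem.extensions s.toFinset σ, (I.weight ρ : ℝ≥0∞) := by
  simp only [sampler, ENNReal.mul_iSup]
  rw [ENNReal.finsetSum_iSup_of_monotone
    (f := fun ρ k => (I.weight ρ : ℝ≥0∞) * iterate I adj ℓ f k s ρ)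
    (fun ρ i j hij => mul_le_mul_right (monotone_iterate f s ρ hij) _)]
  exact iSup_le fun k => sum_iterate_le hperm hssm hℓ hadj hμ k hs σ

end RoundExpect

/-- Rounds until the stack is empty. -/
def mainLoop : Cmd := .loop (.natLt (.lit 0) (.get₁ 9 (.lit 0))) round

section MainLoop

variable [NeZero q] {I : SpinSystem n q} {adj : Fin n → List (Fin n)} {ℓ D d K : ℕ}

/-- A supersolution `G` on pairs of a stack and a configuration is lifted to memories, where it
becomes a loop invariant. -/
lemma mainLoop_wp_le (hperm : I.Permissive) (hssm : I.RatioSSM ℓ)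
    (hadj : ∀ v w, w ∈ adj v ↔ I.graph.Adj v w) (hnd : ∀ v, (adj v).Nodup) (hℓ : 1 ≤ ℓ)
    (hD : ∀ u, ∀ k ≤ ℓ, (ballList adj u k).length ≤ D) (hd : ∀ v, (adj v).length ≤ d)
    (hK : q ^ D ≤ K) {κ : ℝ≥0∞} {f : Memory → ℝ≥0∞} {G : List (Fin n) → Conf n q → ℝ≥0∞}
    (h0 : ∀ X m, Ready I adj ℓ [] X m → κ + f m ≤ G [] X)
    (hstep : ∀ s u X, κ + (κ * (roundTime q D d K : ℕ) + roundExpect I adj ℓ G s u X)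
      ≤ G (s ++ [u]) X) {s : List (Fin n)} {X : Conf n q} {m : Memory} (h : Ready I adj ℓ s X m) :
    wp κ mainLoop f m ≤ G s X := by
  -- The lifted function is the infimum of `G` over all pairs represented by the memory; memories
  -- that represent none get the value ∞ and need no argument.
  refine (wp_loop_le (X := fun m => ⨅ (s) (X) (_ : Ready I adj ℓ s X m), G s X)
    (fun m => ?_) m).trans (iInf_le_of_le s (iInf_le_of_le X (iInf_le _ h)))
  refine le_iInf fun s => le_iInf fun X => le_iInf fun h => ?_
  obtain ⟨rows, hrows, hr0, -⟩ := h.hasRows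
  have hlen := hrows.len 0
  rw [hr0] at hlen
  rcases List.eq_nil_or_concat s with rfl | ⟨s, u, rfl⟩
  · rw [if_neg (by simp [hlen])]
    exact h0 X m h
  · rw [List.concat_eq_append] at h hlen ⊢
    rw [if_pos (by simp [hlen])]
    refine (add_le_add_right (round_wp (G := G) h hperm hssm hadj hnd hℓ (hD u) hd hK ?_) κ).trans
      (hstep s u X)
    exact fun s' X' m' h' => iInf_le_of_le s' (iInf_le_of_le X' (iInf_le _ h'))

/-- With cost 0 the time bounds are irrelevant, so `n` serves as a crude bound for balls and
degrees. -/
lemma mainLoop_wp_le_sampler (hperm : I.Permissive) (hssm : I.RatioSSM ℓ)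
    (hadj : ∀ v w, w ∈ adj v ↔ I.graph.Adj v w) (hnd : ∀ v, (adj v).Nodup) (hℓ : 1 ≤ ℓ)
    {f : Memory → ℝ≥0∞} {g : Conf n q → ℝ≥0∞}
    (h0 : ∀ X m, Ready I adj ℓ [] X m → f m ≤ g X)
    {s : List (Fin n)} {X : Conf n q} {m : Memory} (h : Ready I adj ℓ s X m) :
    wp 0 mainLoop f m ≤ sampler I adj ℓ g s X := by
  have hcard : ∀ {l : List (Fin n)}, l.Nodup → l.length ≤ n := fun h => by
    simpa using h.length_le_card
  refine mainLoop_wp_le (D := n) (d := n) hperm hssm hadj hnd hℓ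
    (fun u k _ => hcard (nodup_ballList adj u k)) (fun v => hcard (hnd v)) le_rfl
    (fun X m h => ?_) (fun s u X => ?_) h
  · rw [zero_add]
    refine (h0 X m h).trans (le_iSup_of_le 1 ?_)
    rw [iterate_succ_nil]
  · rw [zero_add, zero_mul, zero_add]
    refine (roundExpect_iSup (monotone_iterate g)).le.trans (iSup_le fun k => ?_)
    refine le_iSup_of_le (k + 1) ?_
    rw [iterate_succ_append]

/-- Drift argument with the potential 1 + 5T|s|, where T bounds the cost of a round with its loop
test. Acceptance leaves |s| entries, rejection at most |s| + 1 + |S|; by `reject_le` the potential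
falls by T per round in expectation. -/
lemma mainLoop_time (hperm : I.Permissive) (hssm : I.RatioSSM ℓ)
    (hadj : ∀ v w, w ∈ adj v ↔ I.graph.Adj v w) (hnd : ∀ v, (adj v).Nodup) (hℓ : 1 ≤ ℓ)
    (hD : ∀ u, ∀ k ≤ ℓ, (ballList adj u k).length ≤ D) (hd : ∀ v, (adj v).length ≤ d)
    (hK : q ^ D ≤ K) {s : List (Fin n)} {X : Conf n q} {m : Memory} (h : Ready I adj ℓ s X m)
    (hX : I.weight X ≠ 0) :
    wp 1 mainLoop (fun _ => 0) m ≤ (1 + 5 * (roundTime q D d K + 1) * s.length : ℕ) := by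
  classical
  set T := roundTime q D d K + 1 with hT
  -- The value ∞ on infeasible configurations removes them from the drift inequality; neither
  -- resampling nor rejection leads to one.
  set G : List (Fin n) → Conf n q → ℝ≥0∞ := fun s X =>
    if I.weight X ≠ 0 then ((1 + 5 * T * s.length : ℕ) : ℝ≥0∞) else ⊤ with hG
  have key := mainLoop_wp_le (κ := 1) (f := fun _ => 0) (G := G) hperm hssm hadj hnd hℓ hD hd hK
    (fun X m _ => ?_) (fun s u X => ?_) h
  · simpa [hG, hX] using key
  · by_cases hX : I.weight X = 0 <;> simp [hG, hX]
  by_cases hX : I.weight X = 0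
  · simp [hG, hX]
  set a := I.accept ℓ (s ++ [u]).toFinset u X with ha
  have hacc : a ≤ 1 := SpinSystem.accept_le_one hssm hℓ X
  have hrej := SpinSystem.reject_le (R := (s ++ [u]).toFinset) (u := u) hssm hℓ X hX
  rw [← ha] at hrej
  set S := (I.sphereFinset ℓ u).card with hS
  have hres : I.resample (I.block ℓ (s ++ [u]).toFinset u)ᶜ X (G s)
      ≤ ((1 + 5 * T * s.length : ℕ) : ℝ≥0∞) :=
    SpinSystem.resample_le hperm hX fun ρ hρ => by simp [hG, hρ]
  set s' := pushAll (s ++ [u]) ((ballList adj u ℓ).drop (ballList adj u (ℓ - 1)).length) with hs'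
  have hlen : s'.length ≤ s.length + 1 + S := by
    have hnd' : ((ballList adj u ℓ).drop (ballList adj u (ℓ - 1)).length).Nodup :=
      (nodup_ballList adj u ℓ).sublist (List.drop_sublist _ _)
    rw [hs', pushAll_eq_append hnd', List.length_append, List.length_append, hS,
      ← length_drop_ballList hadj hℓ, ← List.length_drop]
    exact Nat.add_le_add_left (List.length_filter_le _ _) _
  have hG' : G s' X ≤ ((1 + 5 * T * (s.length + 1 + S) : ℕ) : ℝ≥0∞) := by
    simp only [hG, if_pos (show I.weight X ≠ 0 from hX)]
    exact_mod_cast Nat.add_le_add_left (Nat.mul_le_mul_left _ hlen) 1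
  -- The potential before the round is 1 + 5T(|s| + 1); the expected potential afterwards is T
  -- smaller, which pays for the round.
  have hr : roundExpect I adj ℓ G s u X ≤ ((1 + 5 * T * s.length + 4 * T : ℝ≥0) : ℝ≥0∞) := by
    rw [roundExpect, ← ha, ← hs']
    refine (add_le_add (mul_le_mul_right hres _) (mul_le_mul_right hG' _)).trans ?_
    have : (a : ℝ≥0∞) * ((1 + 5 * T * s.length : ℕ) : ℝ≥0∞)
        + ((1 - a : ℝ≥0) : ℝ≥0∞) * ((1 + 5 * T * (s.length + 1 + S) : ℕ) : ℝ≥0∞)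
        = ((a * (1 + 5 * T * s.length) + (1 - a) * (1 + 5 * T * (s.length + 1 + S)) : ℝ≥0) :
          ℝ≥0∞) := by
      push_cast
      rfl
    rw [this, ENNReal.coe_le_coe]
    calc _ = (a + (1 - a)) * (1 + 5 * T * s.length) + 5 * T * ((1 - a) * (1 + S)) := by ring
      _ ≤ 1 * (1 + 5 * T * s.length) + 5 * T * (4 / 5) := by
          rw [add_tsub_cancel_of_le hacc]
          gcongr
      _ = _ := by field_simp
  refine (add_le_add_right (add_le_add_right hr _) _).trans ?_
  simp only [hG, if_pos (show I.weight X ≠ 0 from hX)]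
  rw [one_mul, List.length_append, List.length_singleton, hT]
  push_cast
  refine le_of_eq ?_
  ring

end MainLoop

/-! ### Updating the instance in memory -/

/-- The memory holds `q` and `ℓ`, adjacency lists, vectors, and matrices `M v w` for the pairs of a
vertex `v` and an entry `w` of its list. -/
structure HasTables (b : Fin n → Fin q → ℝ≥0) (adj : Fin n → List (Fin n))
    (M : Fin n → Fin n → Sym2 (Fin q) → ℝ≥0) (ℓ : ℕ) (m : Memory) : Prop where
  spins : m.nat (0, 1, 0, 0, 0) = q
  dist : m.nat (0, 2, 0, 0, 0) = ℓ
  deg : ∀ v : Fin n, m.nat (2, v, 0, 0, 0) = (adj v).length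
  nbr : ∀ (v : Fin n) (i : ℕ) (h : i < (adj v).length), m.nat (3, v, i, 0, 0) = ((adj v)[i] : ℕ)
  vec : ∀ (v : Fin n) (a : Fin q), m.real (0, v, a, 0, 0) = b v a
  mat : ∀ (v : Fin n) (i : ℕ) (h : i < (adj v).length) (a c : Fin q),
    m.real (1, v, i, a, c) = M v (adj v)[i] s(a, c)

lemma HasTables.congr {b : Fin n → Fin q → ℝ≥0} {adj : Fin n → List (Fin n)}
    {M : Fin n → Fin n → Sym2 (Fin q) → ℝ≥0} {ℓ : ℕ} {m m' : Memory}
    (h : HasTables b adj M ℓ m) (h0 : ∀ i, m'.nat (0, i) = m.nat (0, i))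
    (h2 : ∀ i, m'.nat (2, i) = m.nat (2, i)) (h3 : ∀ i, m'.nat (3, i) = m.nat (3, i))
    (r0 : ∀ i, m'.real (0, i) = m.real (0, i)) (r1 : ∀ i, m'.real (1, i) = m.real (1, i)) :
    HasTables b adj M ℓ m' where
  spins := (h0 _).trans h.spins
  dist := (h0 _).trans h.dist
  deg v := (h2 _).trans (h.deg v)
  nbr v i hi := (h3 _).trans (h.nbr v i hi)
  vec v a := (r0 _).trans (h.vec v a)
  mat v i hi a c := (r1 _).trans (h.mat v i hi a c)

lemma HasTables.frame {b : Fin n → Fin q → ℝ≥0} {adj : Fin n → List (Fin n)}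
    {M : Fin n → Fin n → Sym2 (Fin q) → ℝ≥0} {ℓ : ℕ} {m m' : Memory} {c : Cmd}
    (h : HasTables b adj M ℓ m) (hf : Frame c m m')
    (h0 : c.writesNat 0 = false := by rfl) (h2 : c.writesNat 2 = false := by rfl)
    (h3 : c.writesNat 3 = false := by rfl) (r0 : c.writesReal 0 = false := by rfl)
    (r1 : c.writesReal 1 = false := by rfl) : HasTables b adj M ℓ m' :=
  h.congr (hf.nat 0 · h0) (hf.nat 2 · h2) (hf.nat 3 · h3) (hf.real 0 · r0) (hf.real 1 · r1)

lemma HasTables.writeNat {b : Fin n → Fin q → ℝ≥0} {adj : Fin n → List (Fin n)}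
    {M : Fin n → Fin n → Sym2 (Fin q) → ℝ≥0} {ℓ : ℕ} {m : Memory} (h : HasTables b adj M ℓ m)
    (x : Addr) (c : ℕ) (hx : x.1 ≠ 0 ∧ x.1 ≠ 2 ∧ x.1 ≠ 3 := by decide) :
    HasTables b adj M ℓ (m.writeNat x c) := by
  refine h.congr ?_ ?_ ?_ (fun _ => rfl) (fun _ => rfl) <;>
  · intro i
    rw [Memory.nat_writeNat, if_neg]
    rintro rfl
    simp at hx

/-- Replaces the vectors of the vertices in the list, and pushes these vertices to the stack. -/
def updateVertices : Cmd :=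
  forLoop 62 (.get 0 (.lit 3) (.lit 0) (.lit 0) (.lit 0)) (
    .setNat (.var 63) (.get₁ 4 (.var 62)) ;;
    forLoop 64 (.get₁ 0 (.lit 1))
      (.setReal ⟨0, .var 63, .var 64, .lit 0, .lit 0⟩
        (.get ⟨2, .var 62, .var 64, .lit 0, .lit 0⟩)) ;;
    pushTo (.lit 0) (.var 63))

lemma updateVertices_runs {b b' : Fin n → Fin q → ℝ≥0} {adj : Fin n → List (Fin n)}
    {M : Fin n → Fin n → Sym2 (Fin q) → ℝ≥0} {ℓ : ℕ} {m : Memory} {rows : ℕ → List (Fin n)}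
    {dv : List (Fin n)} (h : HasTables b adj M ℓ m) (hrows : HasRows rows m)
    (hlen : m.nat (0, 3, 0, 0, 0) = dv.length)
    (hdv : ∀ i (hi : i < dv.length), m.nat (4, i, 0, 0, 0) = (dv[i] : ℕ))
    (hb : ∀ i (hi : i < dv.length) (a : Fin q), m.real (2, i, a, 0, 0) = b' dv[i] a) :
    ∃ m', Runs updateVertices m m' (dv.length * (q * 4 + 19) + 3) ∧
      HasTables (fun v => if v ∈ dv then b' v else b v) adj M ℓ m' ∧
      HasRows (Function.update rows 0 (pushAll (rows 0) dv)) m' := by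
  obtain ⟨m', hm', ⟨hT, hR⟩, -⟩ := forLoop_runs (i := 62)
    (N := .get 0 (.lit 3) (.lit 0) (.lit 0) (.lit 0))
    (body := .setNat (.var 63) (.get₁ 4 (.var 62)) ;;
      forLoop 64 (.get₁ 0 (.lit 1))
        (.setReal ⟨0, .var 63, .var 64, .lit 0, .lit 0⟩
          (.get ⟨2, .var 62, .var 64, .lit 0, .lit 0⟩)) ;;
      pushTo (.lit 0) (.var 63))
    (m := m) dv.length dv.length (q * 4 + 16)
    (fun k m' => HasTables (fun v => if v ∈ dv.take k then b' v else b v) adj M ℓ m' ∧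
      HasRows (Function.update rows 0 (pushAll (rows 0) (dv.take k))) m') le_rfl rfl
    ⟨by simpa using h.writeNat _ _, by simpa [pushAll] using hrows.writeNat _ _⟩
    (fun k _ m' hf _ _ => by simpa [hlen] using hf.nat 0 (3, 0, 0, 0))
    (by
      rintro k hk m₁ hf ⟨hT, hR⟩ hik
      have h1 := Runs.setNat (m := m₁) (.var 63) (.get₁ 4 (.var 62))
      have e1 : (NExp.get₁ 4 (.var 62)).eval m₁ = (dv[k] : ℕ) := by
        have := (hf.nat 4 (k, 0, 0, 0)).trans (hdv k hk)
        simp [hik, this]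
      rw [e1] at h1
      change Runs _ _ (m₁.writeNat (varAddr 63) (dv[k] : ℕ)) _ at h1
      have hT1 := hT.writeNat (varAddr 63) (dv[k] : ℕ)
      obtain ⟨m₂, h2, hI2, -⟩ := forLoop_runs (i := 64) (N := .get₁ 0 (.lit 1))
        (body := .setReal ⟨0, .var 63, .var 64, .lit 0, .lit 0⟩
          (.get ⟨2, .var 62, .var 64, .lit 0, .lit 0⟩))
        (m := m₁.writeNat (varAddr 63) (dv[k] : ℕ)) q q 1
        (fun j m' => ∀ (v : Fin n) (a : Fin q), m'.real (0, v, a, 0, 0) =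
          if v = dv[k] ∧ (a : ℕ) < j then b' v a else
            if v ∈ dv.take k then b' v a else b v a) le_rfl rfl
        (by
          intro v a
          have := hT.vec v a
          simp [this]
          split_ifs <;> rfl)
        (fun j _ m' hf' _ _ => by
          have := (hf'.nat 0 (1, 0, 0, 0)).trans hT1.spins
          simp [this])
        (by
          intro j hj m₂ hf2 hI2 hij
          refine ⟨_, Runs.setReal _ _, fun v a => ?_⟩
          have h63 : m₂.nat (varAddr 63) = dv[k] := by
            have := hf2.nat 63 (0, 0, 0, 0)
            simpa using this
          have h62 : m₂.nat (varAddr 62) = k := by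
            have := hf2.nat 62 (0, 0, 0, 0)
            simpa [hik] using this
          have hr : m₂.real (2, k, j, 0, 0) = b' dv[k] ⟨j, hj⟩ := by
            have h3 := hf2.real 2 (k, j, 0, 0)
            have h4 := hf.real 2 (k, j, 0, 0)
            have h5 := hb k hk ⟨j, hj⟩
            simp only [Memory.real_writeNat] at h3
            rw [h3, h4]
            exact h5
          have hold := hI2 v a
          by_cases hv : v = dv[k]
          · by_cases ha : (a : ℕ) = j
            · obtain rfl : a = ⟨j, hj⟩ := Fin.ext ha
              subst hv
              simp [h63, h62, hij, hr]
            · have e : (a : ℕ) < j + 1 ↔ (a : ℕ) < j := by omega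
              simp only [hv, true_and, e] at hold ⊢
              rw [← hold]
              simp [h63, hij, ha]
          · have hv' : (v : ℕ) ≠ dv[k] := fun h => hv (Fin.ext h)
            simp only [hv, false_and, if_false] at hold ⊢
            rw [← hold]
            simp [h63, hv'])
      have hf2 := h2.frame
      have hR2 := (hR.writeNat (varAddr 63) (dv[k] : ℕ)).frame hf2
      have h63 : m₂.nat (varAddr 63) = dv[k] := by
        have := hf2.nat 63 (0, 0, 0, 0)
        simpa using this
      obtain ⟨m₃, h3, hR3⟩ := pushTo_runs (er := .lit 0) (ev := .var 63) (r := 0) (v := dv[k]) hR2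
        (by simpa using h63) rfl
      have htake : dv.take (k + 1) = dv.take k ++ [dv[k]] := by simp
      have hT2 : HasTables (fun v => if v ∈ dv.take (k + 1) then b' v else b v) adj M ℓ m₂ := by
        refine ⟨(hf2.nat 0 _).trans hT1.spins, (hf2.nat 0 _).trans hT1.dist,
          fun v => (hf2.nat 2 _).trans (hT1.deg v),
          fun v i hi => (hf2.nat 3 _).trans (hT1.nbr v i hi),
          fun v a => ?_, fun v i hi a c => (hf2.real 1 _).trans (hT1.mat v i hi a c)⟩
        rw [hI2 v a, htake]
        simp only [List.mem_append, List.mem_singleton]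
        by_cases hv : v = dv[k]
        · simp [hv]
        · by_cases hv' : v ∈ dv.take k <;> simp [hv, hv']
      refine ⟨m₃, (h1.seq (h2.seq h3)).mono (by omega), (hT2.frame h3.frame).writeNat _ _, ?_⟩
      rw [htake, pushAll_snoc]
      simpa using hR3.writeNat (varAddr 62) (k + 1))
  rw [List.take_length] at hT hR
  exact ⟨m', hm'.mono (le_of_eq (by ring)), hT, hR⟩

/-- Copies the matrix with the number in variable `67` to the slot in variable `68` of the vertex in
variable `65`. -/
def copyMatrix : Cmd :=
  forLoop 70 (.get₁ 0 (.lit 1)) (forLoop 71 (.get₁ 0 (.lit 1))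
    (.setReal ⟨1, .var 65, .var 68, .var 70, .var 71⟩
      (.get ⟨3, .var 67, .var 70, .var 71, .lit 0⟩)))

lemma copyMatrix_runs {m : Memory} {x i p q : ℕ} (hq : m.nat (0, 1, 0, 0, 0) = q)
    (hx : m.nat (varAddr 65) = x) (hi : m.nat (varAddr 67) = i) (hp : m.nat (varAddr 68) = p) :
    ∃ m', Runs copyMatrix m m' (q * (q * 4 + 6) + 3) ∧
      ∀ v j a c, a < q → c < q → m'.real (1, v, j, a, c)
        = if v = x ∧ j = p then m.real (3, i, a, c, 0) else m.real (1, v, j, a, c) := by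
  obtain ⟨m', hm', hI, -⟩ := forLoop_runs (i := 70) (N := .get₁ 0 (.lit 1))
    (body := forLoop 71 (.get₁ 0 (.lit 1))
      (.setReal ⟨1, .var 65, .var 68, .var 70, .var 71⟩
        (.get ⟨3, .var 67, .var 70, .var 71, .lit 0⟩)))
    (m := m) q q (q * 4 + 3)
    (fun k m' => ∀ v j a c, c < q → m'.real (1, v, j, a, c)
        = if v = x ∧ j = p ∧ a < k then m.real (3, i, a, c, 0) else m.real (1, v, j, a, c))
    le_rfl rfl (by simp) (fun k _ m' hf _ _ => by simpa [hq] using hf.nat 0 (1, 0, 0, 0))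
    (by
      intro k hk m₁ hf hI hik
      obtain ⟨m₂, h2, hI2, -⟩ := forLoop_runs (i := 71) (N := .get₁ 0 (.lit 1))
        (body := .setReal ⟨1, .var 65, .var 68, .var 70, .var 71⟩
          (.get ⟨3, .var 67, .var 70, .var 71, .lit 0⟩))
        (m := m₁) q q 1
        (fun k' m' => ∀ v j a c, c < q → m'.real (1, v, j, a, c)
          = if v = x ∧ j = p ∧ (a < k ∨ a = k ∧ c < k') then m.real (3, i, a, c, 0)
            else m.real (1, v, j, a, c))
        le_rfl rfl (by simpa using hI) (fun k _ m' hf' _ _ => by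
          have h1 := hf'.nat 0 (1, 0, 0, 0)
          have h2 := hf.nat 0 (1, 0, 0, 0)
          simp [h1, h2, hq])
        (by
          intro k' hk' m₂ hf2 hI2 hik'
          refine ⟨_, Runs.setReal _ _, fun v j a c hc => ?_⟩
          have g65 := (hf2.nat 65 (0, 0, 0, 0)).trans ((hf.nat 65 _).trans hx)
          have g67 := (hf2.nat 67 (0, 0, 0, 0)).trans ((hf.nat 67 _).trans hi)
          have g68 := (hf2.nat 68 (0, 0, 0, 0)).trans ((hf.nat 68 _).trans hp)
          have g70 := (hf2.nat 70 (0, 0, 0, 0)).trans hik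
          have g3 := (hf2.real 3 (i, k, k', 0)).trans (hf.real 3 _)
          have hold := hI2 v j a c hc
          by_cases hh : v = x ∧ j = p ∧ a = k ∧ c = k'
          · obtain ⟨rfl, rfl, rfl, rfl⟩ := hh
            simp [g65, g67, g68, g70, hik', g3]
          · have e : (v = x ∧ j = p ∧ (a < k ∨ a = k ∧ c < k' + 1)) ↔
                (v = x ∧ j = p ∧ (a < k ∨ a = k ∧ c < k')) := by
              constructor
              · rintro ⟨h1, h2, h3 | ⟨h3, h4⟩⟩
                · exact ⟨h1, h2, Or.inl h3⟩
                · exact ⟨h1, h2, Or.inr ⟨h3, by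
                    have : c ≠ k' := fun h => hh ⟨h1, h2, h3, h⟩
                    omega⟩⟩
              · rintro ⟨h1, h2, h3 | ⟨h3, h4⟩⟩
                · exact ⟨h1, h2, Or.inl h3⟩
                · exact ⟨h1, h2, Or.inr ⟨h3, by omega⟩⟩
            simp only [e]
            rw [← hold]
            have hne : ((1, v, j, a, c) : Addr) ≠ (1, x, p, k, k') := by
              intro h
              simp only [Prod.mk.injEq, true_and] at h
              exact hh h
            simp only [Memory.real_writeNat, Memory.real_writeReal, AExp.eval, NExp.eval, NExp.var]
            rw [if_neg]
            simpa [g65, g68, g70, hik', varAddr] using hne)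
      refine ⟨m₂, h2, fun v j a c hc => ?_⟩
      have := hI2 v j a c hc
      have e : (v = x ∧ j = p ∧ (a < k ∨ a = k ∧ c < q)) ↔ (v = x ∧ j = p ∧ a < k + 1) := by
        constructor
        · rintro ⟨h1, h2, h3⟩
          exact ⟨h1, h2, by omega⟩
        · rintro ⟨h1, h2, h3⟩
          exact ⟨h1, h2, by omega⟩
      simp only [e] at this
      simpa using this)
  refine ⟨m', hm'.mono (le_of_eq (by ring)), fun v j a c ha hc => ?_⟩
  have := hI v j a c hc
  simpa [ha] using this

/-- Sets the matrix of the pair of the vertices in variables `65` and `66` in the list of the first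
vertex, where an entry is added if necessary, and pushes the first vertex to the stack. -/
def setArc : Cmd :=
  pushTo (.lit 0) (.var 65) ;;
    .setNat (.var 68) (.get₁ 2 (.var 65)) ;;
    forLoop 69 (.get₁ 2 (.var 65)) (.ite (.natEq (.get₂ 3 (.var 65) (.var 69)) (.var 66))
      (.setNat (.var 68) (.var 69)) .skip) ;;
    .ite (.natEq (.var 68) (.get₁ 2 (.var 65)))
      (.setNat ⟨3, .var 65, .var 68, .lit 0, .lit 0⟩ (.var 66) ;;
        .setNat ⟨2, .var 65, .lit 0, .lit 0, .lit 0⟩ (.add (.var 68) (.lit 1))) .skip ;;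
    copyMatrix

/-- A search of the list of `x` finds the slot of `y`; if there is none, variable `68` keeps the
degree, which is the number of the new slot. The cost is linear in the degree and quadratic in `q`.
-/
lemma setArc_runs {b : Fin n → Fin q → ℝ≥0} {adj : Fin n → List (Fin n)}
    {M M' : Fin n → Fin n → Sym2 (Fin q) → ℝ≥0} {ℓ : ℕ} {m : Memory} {rows : ℕ → List (Fin n)}
    {x y : Fin n} {i d : ℕ} (h : HasTables b adj M ℓ m) (hrows : HasRows rows m)
    (hx : m.nat (varAddr 65) = x) (hy : m.nat (varAddr 66) = y) (hi : m.nat (varAddr 67) = i)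
    (hA : ∀ a c : Fin q, m.real (3, i, a, c, 0) = M' x y s(a, c)) (hd : (adj x).length ≤ d)
    (hnd : (adj x).Nodup) (hM : ∀ v w, ¬ (v = x ∧ w = y) → M' v w = M v w) :
    ∃ m', Runs setArc m m' (d * 5 + q * (q * 4 + 6) + 25) ∧
      HasTables b (Function.update adj x (pushNew (adj x) y)) M' ℓ m' ∧
      HasRows (Function.update rows 0 (pushNew (rows 0) x)) m' := by
  obtain ⟨m₁, h1, hR1⟩ := pushTo_runs (er := .lit 0) (ev := .var 65) (r := 0) (v := x) hrows
    (by simpa using hx) rfl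
  have hT1 := h.frame h1.frame
  have a65 := (h1.frame.nat 65 (0, 0, 0, 0)).trans hx
  have a66 := (h1.frame.nat 66 (0, 0, 0, 0)).trans hy
  have a67 := (h1.frame.nat 67 (0, 0, 0, 0)).trans hi
  have a3 : ∀ a c : Fin q, m₁.real (3, i, a, c, 0) = M' x y s(a, c) :=
    fun a c => (h1.frame.real 3 _).trans (hA a c)
  have h2 := Runs.setNat (m := m₁) (.var 68) (.get₁ 2 (.var 65))
  have e2 : (NExp.get₁ 2 (.var 65)).eval m₁ = (adj x).length := by simp [a65, hT1.deg]
  rw [e2] at h2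
  change Runs _ _ (m₁.writeNat (varAddr 68) (adj x).length) _ at h2
  obtain ⟨m₃, h3, ⟨p, hp, hpos⟩, -⟩ := forLoop_runs (i := 69) (N := .get₁ 2 (.var 65))
    (body := .ite (.natEq (.get₂ 3 (.var 65) (.var 69)) (.var 66))
      (.setNat (.var 68) (.var 69)) .skip)
    (m := m₁.writeNat (varAddr 68) (adj x).length) (adj x).length d 2
    -- Either `y` has not occurred so far and `p` is still the degree, or `p` is a position of `y`.
    (fun k m' => ∃ p, m'.nat (varAddr 68) = p ∧
      ((p = (adj x).length ∧ y ∉ (adj x).take k) ∨ ∃ hp : p < (adj x).length, (adj x)[p] = y))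
    hd rfl ⟨(adj x).length, by simp, Or.inl ⟨rfl, by simp⟩⟩
    (fun k _ m' hf _ _ => by
      have g65 := hf.nat 65 (0, 0, 0, 0)
      have g2 := fun i => hf.nat 2 i
      have := hT1.deg x
      simp only [Memory.nat_writeNat, varAddr] at g65
      simp [g65, g2, a65, this])
    (by
      rintro k hk m₂ hf ⟨p, hp, hpos⟩ hik
      have g65 : m₂.nat (varAddr 65) = x := by
        have := hf.nat 65 (0, 0, 0, 0)
        simpa [a65] using this
      have g66 : m₂.nat (varAddr 66) = y := by
        have := hf.nat 66 (0, 0, 0, 0)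
        simpa [a66] using this
      have g3 : m₂.nat (3, x, k, 0, 0) = ((adj x)[k] : ℕ) := by
        have := hf.nat 3 (x, k, 0, 0)
        simpa [hT1.nbr x k hk] using this
      have htake : (adj x).take (k + 1) = (adj x).take k ++ [(adj x)[k]] := by simp
      by_cases hky : (adj x)[k] = y
      · refine ⟨_, Runs.ite_true ?_ (Runs.setNat _ _), k, ?_, Or.inr ⟨hk, hky⟩⟩
        · simp [g65, g66, hik, g3, hky]
        · simp [hik]
      · refine ⟨m₂, Runs.ite_false ?_ Runs.skip, p, ?_, ?_⟩
        · simp [g65, g66, hik, g3, Fin.val_inj, hky]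
        · simpa using hp
        · refine hpos.imp_left fun hh => ⟨hh.1, ?_⟩
          rw [htake]
          simp only [List.mem_append, List.mem_singleton, not_or]
          exact ⟨hh.2, fun h => hky h.symm⟩)
  rw [List.take_length] at hpos
  have hT3 := (hT1.writeNat (varAddr 68) (adj x).length).frame h3.frame
  have hR3 := (hR1.writeNat (varAddr 68) (adj x).length).frame h3.frame
  have b65 : m₃.nat (varAddr 65) = x := by
    have := h3.frame.nat 65 (0, 0, 0, 0)
    simpa [a65] using this
  have b66 : m₃.nat (varAddr 66) = y := by
    have := h3.frame.nat 66 (0, 0, 0, 0)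
    simpa [a66] using this
  have b67 : m₃.nat (varAddr 67) = i := by
    have := h3.frame.nat 67 (0, 0, 0, 0)
    simpa [a67] using this
  have b3 : ∀ a c : Fin q, m₃.real (3, i, a, c, 0) = M' x y s(a, c) := by
    intro a c
    have := h3.frame.real 3 (i, a, c, 0)
    simpa [a3] using this
  set adj' := Function.update adj x (pushNew (adj x) y) with hadj'
  have hadjx : adj' x = pushNew (adj x) y := by simp [hadj']
  have hadjv : ∀ v, v ≠ x → adj' v = adj v := fun v hv => by simp [hadj', hv]
  -- after the insertion
  obtain ⟨m₄, h4, hsp4, hdist4, hvec4, hdeg4, hnbr4, hmat4, hpl, hpy, hR4, c65, c67, c68, c3⟩ :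
      ∃ m₄, Runs (.ite (.natEq (.var 68) (.get₁ 2 (.var 65)))
          (.setNat ⟨3, .var 65, .var 68, .lit 0, .lit 0⟩ (.var 66) ;;
          .setNat ⟨2, .var 65, .lit 0, .lit 0, .lit 0⟩ (.add (.var 68) (.lit 1))) .skip) m₃ m₄ 4 ∧
        m₄.nat (0, 1, 0, 0, 0) = q ∧ m₄.nat (0, 2, 0, 0, 0) = ℓ ∧
        (∀ (v : Fin n) (a : Fin q), m₄.real (0, v, a, 0, 0) = b v a) ∧
        (∀ v : Fin n, m₄.nat (2, v, 0, 0, 0) = (adj' v).length) ∧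
        (∀ (v : Fin n) (i : ℕ) (h : i < (adj' v).length),
          m₄.nat (3, v, i, 0, 0) = ((adj' v)[i] : ℕ)) ∧
        (∀ (v : Fin n) (i : ℕ) (h : i < (adj' v).length), ¬ (v = x ∧ i = p) → ∀ a c : Fin q,
          m₄.real (1, v, i, a, c) = M v (adj' v)[i] s(a, c)) ∧
        (∃ h : p < (adj' x).length, (adj' x)[p] = y) ∧ (adj' x).Nodup ∧
        HasRows (Function.update rows 0 (pushNew (rows 0) x)) m₄ ∧
        m₄.nat (varAddr 65) = x ∧ m₄.nat (varAddr 67) = i ∧ m₄.nat (varAddr 68) = p ∧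
        ∀ a c : Fin q, m₄.real (3, i, a, c, 0) = M' x y s(a, c) := by
    rcases hpos with ⟨rfl, hmem⟩ | ⟨hpl, hpy⟩
    · have hpn : pushNew (adj x) y = adj x ++ [y] := by simp [pushNew, hmem]
      have h4 := (Runs.setNat (m := m₃) ⟨3, .var 65, .var 68, .lit 0, .lit 0⟩ (.var 66)).seq
        (Runs.setNat ⟨2, .var 65, .lit 0, .lit 0, .lit 0⟩ (.add (.var 68) (.lit 1)))
      refine ⟨_, Runs.ite_true ?_ h4, ?_, ?_, ?_, ?_, ?_, ?_, ?_, ?_, ?_, ?_, ?_, ?_, ?_⟩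
      · simp [hp, b65, hT3.deg]
      · simpa using hT3.spins
      · simpa using hT3.dist
      · simpa using hT3.vec
      · intro v
        by_cases hv : v = x
        · subst hv
          simp [b65, hp, hadjx, hpn]
        · have hv' : (v : ℕ) ≠ x := fun h => hv (Fin.ext h)
          simp [b65, hv', hadjv v hv, hT3.deg]
      · intro v j hj
        by_cases hv : v = x
        · subst hv
          simp only [hadjx, hpn, List.length_append, List.length_singleton] at hj ⊢
          by_cases hjl : j = (adj v).length
          · subst hjl
            simp [b65, hp, b66]
          · have hj' : j < (adj v).length := by omega
            have := hT3.nbr v j hj'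
            simp [b65, hp, hjl, this, List.getElem_append_left hj']
        · have hv' : (v : ℕ) ≠ x := fun h => hv (Fin.ext h)
          simp only [hadjv v hv] at hj ⊢
          have := hT3.nbr v j hj
          simp [b65, hv', this]
      · intro v j hj hne a c
        by_cases hv : v = x
        · subst hv
          simp only [hadjx, hpn, List.length_append, List.length_singleton] at hj ⊢
          have hj' : j < (adj v).length := by
            have : j ≠ (adj v).length := fun h => hne ⟨rfl, h⟩
            omega
          have := hT3.mat v j hj' a c
          simp [this, List.getElem_append_left hj']
        · simp only [hadjv v hv] at hj ⊢
          have := hT3.mat v j hj a c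
          simp [this]
      · simp only [hadjx, hpn]
        exact ⟨by simp, by simp⟩
      · rw [hadjx]
        exact nodup_pushNew hnd y
      · refine (hR3.congr (m' := m₃) ?_ ?_ ?_).congr ?_ ?_ ?_ <;> intro j <;> simp
      · simp [b65]
      · simpa using b67
      · simpa using hp
      · simpa using b3
    · have hmem : y ∈ adj x := hpy ▸ List.getElem_mem hpl
      have hpn : pushNew (adj x) y = adj x := by simp [pushNew, hmem]
      have hself : adj' = adj := by rw [hadj', hpn, Function.update_eq_self]
      rw [hself]
      refine ⟨m₃, (Runs.ite_false ?_ Runs.skip).mono (by norm_num), hT3.spins, hT3.dist, hT3.vec,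
        hT3.deg, hT3.nbr, fun v j hj _ a c => hT3.mat v j hj a c, ⟨hpl, hpy⟩, hnd, ?_, b65, b67, hp,
        b3⟩
      · simp [hp, b65, hT3.deg, hpl.ne]
      · exact hR3
  obtain ⟨hpl, hpl'⟩ := hpl
  obtain ⟨m₅, h5, hI5⟩ := copyMatrix_runs hsp4 c65 c67 c68
  refine ⟨m₅, (h1.seq (h2.seq (h3.seq (h4.seq h5)))).mono (by omega), ?_, hR4.frame h5.frame⟩
  refine ⟨(h5.frame.nat 0 _).trans hsp4, (h5.frame.nat 0 _).trans hdist4,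
    fun v => (h5.frame.nat 2 _).trans (hdeg4 v),
    fun v j hj => (h5.frame.nat 3 _).trans (hnbr4 v j hj),
    fun v a => (h5.frame.real 0 _).trans (hvec4 v a), fun v j hj a c => ?_⟩
  rw [hI5 v j a c a.2 c.2]
  by_cases hvj : v = x ∧ j = p
  · obtain ⟨rfl, rfl⟩ := hvj
    rw [if_pos ⟨rfl, rfl⟩, c3, hpl']
  · rw [if_neg (fun h => hvj ⟨Fin.ext h.1, h.2⟩), hmat4 v j hj hvj a c, hM]
    -- The list has no repetitions, so `y` stands at position `p` only, whose matrix has just been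
    -- replaced.
    rintro ⟨rfl, hw⟩
    exact hvj ⟨rfl, (hpy.getElem_inj_iff (hi := hj) (hj := hpl)).1 (hw.trans hpl'.symm)⟩

/-! ### Updating the edges -/

/-- Both orders of the pairs in a list. -/
def arcs (de : List (Fin n × Fin n)) : List (Fin n × Fin n) := de.flatMap fun p => [p, p.swap]

lemma mem_arcs {de : List (Fin n × Fin n)} {v w : Fin n} :
    (v, w) ∈ arcs de ↔ s(v, w) ∈ de.map fun p => s(p.1, p.2) := by
  simp only [arcs, List.mem_flatMap, List.mem_cons, List.not_mem_nil, or_false, List.mem_map,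
    Sym2.eq_iff]
  refine exists_congr fun p => and_congr_right fun _ => ?_
  simp only [Prod.ext_iff, Prod.fst_swap, Prod.snd_swap]
  tauto

/-- Appends new arcs to the adjacency lists. -/
def addArcs (adj : Fin n → List (Fin n)) (t : List (Fin n × Fin n)) : Fin n → List (Fin n) :=
  t.foldl (fun adj p => Function.update adj p.1 (pushNew (adj p.1) p.2)) adj

lemma addArcs_snoc (adj : Fin n → List (Fin n)) (t : List (Fin n × Fin n)) (x y : Fin n) :
    addArcs adj (t ++ [(x, y)])
      = Function.update (addArcs adj t) x (pushNew (addArcs adj t x) y) := by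
  simp [addArcs]

lemma mem_addArcs {adj : Fin n → List (Fin n)} {t : List (Fin n × Fin n)} {v w : Fin n} :
    w ∈ addArcs adj t v ↔ w ∈ adj v ∨ (v, w) ∈ t := by
  induction t using List.reverseRecOn with
  | nil => simp [addArcs]
  | append_singleton t p ih =>
    obtain ⟨x, y⟩ := p
    rw [addArcs_snoc]
    by_cases hv : v = x
    · subst hv
      simp [mem_pushNew, ih, or_assoc]
    · simp [hv, ih]

lemma nodup_addArcs {adj : Fin n → List (Fin n)} (h : ∀ v, (adj v).Nodup)
    (t : List (Fin n × Fin n)) (v : Fin n) : (addArcs adj t v).Nodup := by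
  induction t using List.reverseRecOn with
  | nil => exact h v
  | append_singleton t p ih =>
    obtain ⟨x, y⟩ := p
    rw [addArcs_snoc]
    by_cases hv : v = x
    · subst hv
      simpa using nodup_pushNew ih y
    · simpa [hv] using ih

/-- The lists only grow during the update, so the degrees of the final graph bound the search times
throughout. -/
lemma length_addArcs_le (adj : Fin n → List (Fin n)) (t t' : List (Fin n × Fin n)) (v : Fin n) :
    (addArcs adj t v).length ≤ (addArcs adj (t ++ t') v).length := by
  induction t' using List.reverseRecOn with
  | nil => simp
  | append_singleton t' p ih =>
    obtain ⟨x, y⟩ := p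
    rw [← List.append_assoc, addArcs_snoc]
    by_cases hv : v = x
    · subst hv
      simpa using ih.trans (prefix_pushNew _ y).length_le
    · simpa [hv] using ih

/-- Replaces the matrices of the pairs in the list, with new entries in the adjacency lists where
necessary, and pushes the ends of the pairs to the stack. -/
def updateEdges : Cmd :=
  forLoop 67 (.get 0 (.lit 4) (.lit 0) (.lit 0) (.lit 0)) (
    (.setNat (.var 65) (.get₁ 5 (.var 67)) ;; .setNat (.var 66) (.get₁ 6 (.var 67)) ;; setArc) ;;
    .setNat (.var 65) (.get₁ 6 (.var 67)) ;; .setNat (.var 66) (.get₁ 5 (.var 67)) ;; setArc)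

/-- Between the two halves of an edge update the two copies of a matrix may disagree. The state is
therefore described by the list `t` of the arcs treated so far, with a matrix for each orientation.
-/
lemma setArc_append_runs {b : Fin n → Fin q → ℝ≥0} {adj : Fin n → List (Fin n)}
    {A A' : Sym2 (Fin n) → Sym2 (Fin q) → ℝ≥0} {ℓ : ℕ} {m : Memory} {rows : ℕ → List (Fin n)}
    {l : List (Fin n)} {t : List (Fin n × Fin n)} {x y : Fin n} {i d ex ey : ℕ}
    (h : HasTables b (addArcs adj t)
      (fun v w => if (v, w) ∈ t then A' s(v, w) else A s(v, w)) ℓ m)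
    (hrows : HasRows (Function.update rows 0 (pushAll l (t.map Prod.fst))) m)
    (hey : ey ≠ 65) (hi : m.nat (varAddr 67) = i) (hx : m.nat (ex, i, 0, 0, 0) = x)
    (hy : m.nat (ey, i, 0, 0, 0) = y)
    (hA : ∀ a c : Fin q, m.real (3, i, a, c, 0) = A' s(x, y) s(a, c))
    (hd : (addArcs adj t x).length ≤ d) (hnd : ∀ v, (adj v).Nodup) :
    ∃ m', Runs (.setNat (.var 65) (.get₁ ex (.var 67)) ;; .setNat (.var 66) (.get₁ ey (.var 67)) ;;
        setArc) m m' (d * 5 + q * (q * 4 + 6) + 29) ∧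
      HasTables b (addArcs adj (t ++ [(x, y)]))
        (fun v w => if (v, w) ∈ t ++ [(x, y)] then A' s(v, w) else A s(v, w)) ℓ m' ∧
      HasRows (Function.update rows 0 (pushAll l ((t ++ [(x, y)]).map Prod.fst))) m' := by
  have h1 := Runs.setNat (m := m) (.var 65) (.get₁ ex (.var 67))
  have e1 : (NExp.get₁ ex (.var 67)).eval m = x := by simp [hi, hx]
  rw [e1] at h1
  change Runs _ _ (m.writeNat (varAddr 65) x) _ at h1
  have h2 := Runs.setNat (m := m.writeNat (varAddr 65) x) (.var 66) (.get₁ ey (.var 67))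
  have e2 : (NExp.get₁ ey (.var 67)).eval (m.writeNat (varAddr 65) x) = y := by
    simp [hi, hy, hey]
  rw [e2] at h2
  change Runs _ _ ((m.writeNat (varAddr 65) x).writeNat (varAddr 66) y) _ at h2
  obtain ⟨m', h3, hT, hR⟩ := setArc_runs (x := x) (y := y) (i := i)
    (M' := fun v w => if (v, w) ∈ t ++ [(x, y)] then A' s(v, w) else A s(v, w))
    ((h.writeNat (varAddr 65) x).writeNat (varAddr 66) y)
    ((hrows.writeNat (varAddr 65) x).writeNat (varAddr 66) y) (by simp) (by simp)
    (by simpa using hi)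
    (by simpa using hA) hd (nodup_addArcs hnd t x) (by
      intro v w hne
      have : (v, w) ∈ t ++ [(x, y)] ↔ (v, w) ∈ t := by simp [hne]
      simp only [this])
  refine ⟨m', (h1.seq (h2.seq h3)).mono (by omega), ?_, ?_⟩
  · rw [addArcs_snoc]
    exact hT
  · rw [List.map_append, List.map_singleton, pushAll_snoc]
    simpa using hR

lemma updateEdges_runs {b : Fin n → Fin q → ℝ≥0} {adj : Fin n → List (Fin n)}
    {A A' : Sym2 (Fin n) → Sym2 (Fin q) → ℝ≥0} {ℓ : ℕ} {m : Memory} {rows : ℕ → List (Fin n)}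
    {de : List (Fin n × Fin n)} {d : ℕ} (h : HasTables b adj (fun v w => A s(v, w)) ℓ m)
    (hrows : HasRows rows m) (hlen : m.nat (0, 4, 0, 0, 0) = de.length)
    (h5 : ∀ i (hi : i < de.length), m.nat (5, i, 0, 0, 0) = (de[i].1 : ℕ))
    (h6 : ∀ i (hi : i < de.length), m.nat (6, i, 0, 0, 0) = (de[i].2 : ℕ))
    (hA : ∀ i (hi : i < de.length) (a c : Fin q),
      m.real (3, i, a, c, 0) = A' s(de[i].1, de[i].2) s(a, c))
    (hd : ∀ v, (addArcs adj (arcs de) v).length ≤ d) (hnd : ∀ v, (adj v).Nodup) :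
    ∃ m', Runs updateEdges m m' (de.length * (2 * (d * 5 + q * (q * 4 + 6)) + 62) + 3) ∧
      HasTables b (addArcs adj (arcs de))
        (fun v w => if (v, w) ∈ arcs de then A' s(v, w) else A s(v, w)) ℓ m' ∧
      HasRows (Function.update rows 0 (pushAll (rows 0) ((arcs de).map Prod.fst))) m' := by
  obtain ⟨m', hm', ⟨hT, hR⟩, -⟩ := forLoop_runs (i := 67)
    (N := .get 0 (.lit 4) (.lit 0) (.lit 0) (.lit 0))
    (body := (.setNat (.var 65) (.get₁ 5 (.var 67)) ;; .setNat (.var 66) (.get₁ 6 (.var 67)) ;;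
      setArc) ;; .setNat (.var 65) (.get₁ 6 (.var 67)) ;; .setNat (.var 66) (.get₁ 5 (.var 67)) ;;
      setArc)
    (m := m) de.length de.length (2 * (d * 5 + q * (q * 4 + 6)) + 59)
    (fun k m' => HasTables b (addArcs adj (arcs (de.take k)))
        (fun v w => if (v, w) ∈ arcs (de.take k) then A' s(v, w) else A s(v, w)) ℓ m' ∧
      HasRows (Function.update rows 0 (pushAll (rows 0) ((arcs (de.take k)).map Prod.fst))) m')
    le_rfl rfl
    ⟨by simpa [arcs, addArcs] using h.writeNat _ _, by
      simpa [pushAll, arcs] using hrows.writeNat _ _⟩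
    (fun k _ m' hf _ _ => by simpa [hlen] using hf.nat 0 (4, 0, 0, 0))
    (by
      rintro k hk m₁ hf ⟨hT, hR⟩ hik
      have htake : de.take (k + 1) = de.take k ++ [de[k]] := by simp
      have harcs : arcs (de.take (k + 1))
          = (arcs (de.take k) ++ [(de[k].1, de[k].2)]) ++ [(de[k].2, de[k].1)] := by
        rw [htake, arcs, arcs, List.flatMap_append, List.flatMap_singleton, List.append_assoc]
        rfl
      have hall : arcs de = arcs (de.take k) ++ arcs (de.drop k) := by
        rw [arcs, arcs, arcs, ← List.flatMap_append, List.take_append_drop]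
      have hall' : arcs de = (arcs (de.take k) ++ [(de[k].1, de[k].2)])
          ++ ([(de[k].2, de[k].1)] ++ arcs (de.drop (k + 1))) := by
        rw [← List.append_assoc, ← harcs, arcs, arcs, arcs, ← List.flatMap_append,
          List.take_append_drop]
      have f5 := (hf.nat 5 (k, 0, 0, 0)).trans (h5 k hk)
      have f6 := (hf.nat 6 (k, 0, 0, 0)).trans (h6 k hk)
      have fA : ∀ a c : Fin q, m₁.real (3, k, a, c, 0) = A' s(de[k].1, de[k].2) s(a, c) :=
        fun a c => (hf.real 3 _).trans (hA k hk a c)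
      obtain ⟨m₂, r2, hT2, hR2⟩ := setArc_append_runs (ex := 5) (ey := 6) hT hR (by decide) hik f5
        f6
        fA ((length_addArcs_le adj _ (arcs (de.drop k)) _).trans (hall ▸ hd _)) hnd
      obtain ⟨m₃, r3, hT3, hR3⟩ := setArc_append_runs (ex := 6) (ey := 5) hT2 hR2 (by decide)
        ((r2.frame.nat 67 _).trans hik) ((r2.frame.nat 6 _).trans f6)
        ((r2.frame.nat 5 _).trans f5)
        (fun a c => by
          rw [Sym2.eq_swap (a := de[k].2)]
          exact (r2.frame.real 3 _).trans (fA a c))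
        ((length_addArcs_le adj _ ([(de[k].2, de[k].1)] ++ arcs (de.drop (k + 1))) _).trans
          (hall' ▸ hd _)) hnd
      rw [← harcs] at hT3 hR3
      exact ⟨m₃, (r2.seq r3).mono (by omega), hT3.writeNat _ _, hR3.writeNat _ _⟩)
  rw [List.take_length] at hT hR
  exact ⟨m', hm'.mono (le_of_eq (by ring)), hT, hR⟩

/-! ### Making the configuration feasible -/

/-- The part of the weight that depends on the spin `a` of `u`. -/
def localWeight (I : SpinSystem n q) (adj : Fin n → List (Fin n)) (X : Conf n q) (u : Fin n)
    (a : Fin q) : ℝ≥0 :=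
  I.b u a * ((adj u).map fun w => I.A s(u, w) s(a, X w)).prod

open Classical in
/-- The last number below `k` with a property, or `0`. -/
noncomputable def lastBelow (p : ℕ → Prop) : ℕ → ℕ
  | 0 => 0
  | k + 1 => if p k then k else lastBelow p k

lemma lastBelow_spec {p : ℕ → Prop} {k a : ℕ} (ha : a < k) (hp : p a) :
    p (lastBelow p k) := by
  induction k with
  | zero => omega
  | succ k ih =>
    rw [lastBelow]
    split_ifs with h
    · exact h
    · exact ih (lt_of_le_of_ne (by omega) fun e => h (e ▸ hp))

lemma lastBelow_lt (p : ℕ → Prop) {k : ℕ} (hk : 0 < k) : lastBelow p k < k := by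
  have : ∀ k, lastBelow p k ≤ k - 1 := by
    intro k
    induction k with
    | zero => simp [lastBelow]
    | succ k ih =>
      rw [lastBelow]
      split_ifs <;> omega
  have := this k
  omega

/-- The last spin of `u` with a positive local weight. -/
noncomputable def bestSpin [NeZero q] (I : SpinSystem n q) (adj : Fin n → List (Fin n))
    (X : Conf n q) (u : Fin n) : Fin q :=
  ⟨lastBelow (fun a => ∃ h : a < q, localWeight I adj X u ⟨a, h⟩ ≠ 0) q,
    lastBelow_lt _ (NeZero.pos q)⟩

/-- Replaces the spins of the vertices in the list one after the other. -/
noncomputable def repaired [NeZero q] (I : SpinSystem n q) (adj : Fin n → List (Fin n))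
    (s : List (Fin n)) (X : Conf n q) : Conf n q :=
  s.foldl (fun X u => Function.update X u (bestSpin I adj X u)) X

lemma repaired_snoc [NeZero q] (I : SpinSystem n q) (adj : Fin n → List (Fin n))
    (s : List (Fin n)) (u : Fin n) (X : Conf n q) : repaired I adj (s ++ [u]) X
      = Function.update (repaired I adj s X) u (bestSpin I adj (repaired I adj s X) u) := by
  simp [repaired]

/-- Computes the local weight of the spin in variable `74` at the vertex in variable `73`. -/
def evalSpin : Cmd :=
  .setReal (.var 17) (.get ⟨0, .var 73, .var 74, .lit 0, .lit 0⟩) ;;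
    forLoop 75 (.get₁ 2 (.var 73)) (.setReal (.var 17) (.mul (.get (.var 17))
      (.get ⟨1, .var 73, .var 75, .var 74, .get₁ 1 (.get₂ 3 (.var 73) (.var 75))⟩)))

lemma evalSpin_runs {I : SpinSystem n q} {adj : Fin n → List (Fin n)} {ℓ d : ℕ} {m : Memory}
    {X : Conf n q} {u : Fin n} {a : Fin q} (hI : HasSystem I adj ℓ m) (hX : HasConf X m)
    (hd : (adj u).length ≤ d) (hu : m.nat (varAddr 73) = u) (ha : m.nat (varAddr 74) = a) :
    ∃ m', Runs evalSpin m m' (d * 4 + 5) ∧ m'.real (varAddr 17) = localWeight I adj X u a := by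
  have h1 := Runs.setReal (m := m) (.var 17) (.get ⟨0, .var 73, .var 74, .lit 0, .lit 0⟩)
  have e1 : (RExp.get ⟨0, .var 73, .var 74, .lit 0, .lit 0⟩).eval m = I.b u a := by
    simp [hu, ha, hI.vec]
  rw [e1] at h1
  change Runs _ _ (m.writeReal (varAddr 17) (I.b u a)) _ at h1
  obtain ⟨m', hm', hI', -⟩ := forLoop_runs (i := 75) (N := .get₁ 2 (.var 73))
    (body := .setReal (.var 17) (.mul (.get (.var 17))
      (.get ⟨1, .var 73, .var 75, .var 74, .get₁ 1 (.get₂ 3 (.var 73) (.var 75))⟩)))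
    (m := m.writeReal (varAddr 17) (I.b u a)) (adj u).length d 1
    (fun k m' => m'.real (varAddr 17)
      = ((I.b u a * (((adj u).take k).map fun w => I.A s(u, w) s(a, X w)).prod : ℝ≥0) : ℝ))
    hd rfl (by simp)
    (fun k _ m' hf _ _ => by
      have h1 := (hf.nat 73 (0, 0, 0, 0)).trans hu
      have h2 := (hf.nat 2 (u, 0, 0, 0)).trans (hI.deg u)
      simp [h1, h2])
    (by
      intro k hk m₁ hf hI1 hik
      refine ⟨_, Runs.setReal _ _, ?_⟩
      have h1 := (hf.nat 73 (0, 0, 0, 0)).trans hu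
      have h2 := (hf.nat 74 (0, 0, 0, 0)).trans ha
      have h3 := (hf.nat 3 (u, k, 0, 0)).trans (hI.nbr u k hk)
      have h4 := (hf.nat 1 ((adj u)[k], 0, 0, 0)).trans (hX _)
      have h5 := (hf.real 1 (u, k, a, X (adj u)[k])).trans
        (hI.mat u k hk a (X (adj u)[k]))
      have htake : (adj u).take (k + 1) = (adj u).take k ++ [(adj u)[k]] := by simp
      rw [htake, List.map_append, List.prod_append, List.map_singleton, List.prod_singleton,
        ← mul_assoc, NNReal.coe_mul, ← hI1, ← h5]
      simp [h1, h2, h3, h4, hik])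
  rw [List.take_length] at hI'
  exact ⟨m', (h1.seq hm').mono (by omega), hI'⟩

/-- Gives new spins to the vertices in the stack. -/
def repair : Cmd :=
  forLoop 72 (.get₁ 9 (.lit 0)) (
    .setNat (.var 73) (.get₂ 7 (.lit 0) (.var 72)) ;;
    .setNat (.var 76) (.lit 0) ;;
    forLoop 74 (.get₁ 0 (.lit 1)) (evalSpin ;;
      .ite (.realEq (.get (.var 17)) (.ofNat (.lit 0))) .skip (.setNat (.var 76) (.var 74))) ;;
    .setNat ⟨1, .var 73, .lit 0, .lit 0, .lit 0⟩ (.var 76))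

lemma repair_runs [NeZero q] {I : SpinSystem n q} {adj : Fin n → List (Fin n)} {ℓ d B : ℕ}
    {m : Memory} {X : Conf n q} {rows : ℕ → List (Fin n)} (hI : HasSystem I adj ℓ m)
    (hX : HasConf X m) (hrows : HasRows rows m) (hB : (rows 0).length ≤ B)
    (hd : ∀ v, (adj v).length ≤ d) :
    ∃ m', Runs repair m m' (B * (q * (d * 4 + 11) + 12) + 3) ∧
      HasConf (repaired I adj (rows 0) X) m' := by
  set s := rows 0 with hs
  obtain ⟨m', hm', hI', -⟩ := forLoop_runs (i := 72) (N := .get₁ 9 (.lit 0))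
    (body := .setNat (.var 73) (.get₂ 7 (.lit 0) (.var 72)) ;;
      .setNat (.var 76) (.lit 0) ;;
      forLoop 74 (.get₁ 0 (.lit 1)) (evalSpin ;;
        .ite (.realEq (.get (.var 17)) (.ofNat (.lit 0))) .skip (.setNat (.var 76) (.var 74))) ;;
      .setNat ⟨1, .var 73, .lit 0, .lit 0, .lit 0⟩ (.var 76))
    (m := m) s.length B (q * (d * 4 + 11) + 9)
    (fun k m' => HasConf (repaired I adj (s.take k) X) m') hB rfl
    (by
      intro v
      have := hX v
      simpa [repaired] using this)
    (fun k _ m' hf _ _ => by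
      have h1 := (hf.nat 9 (0, 0, 0, 0)).trans (hrows.len 0)
      simp [h1, hs])
    (by
      intro k hk m₁ hf hX1 hik
      set Y := repaired I adj (s.take k) X with hY
      have hI1 := hI.frame hf
      have h1 := Runs.setNat (m := m₁) (.var 73) (.get₂ 7 (.lit 0) (.var 72))
      have e1 : (NExp.get₂ 7 (.lit 0) (.var 72)).eval m₁ = (s[k] : ℕ) := by
        have := (hf.nat 7 (0, k, 0, 0)).trans (hrows.item 0 k hk)
        simp [hik, this, hs]
      rw [e1] at h1
      change Runs _ _ (m₁.writeNat (varAddr 73) (s[k] : ℕ)) _ at h1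
      have h2 := Runs.setNat (m := m₁.writeNat (varAddr 73) (s[k] : ℕ)) (.var 76) (.lit 0)
      change Runs _ _ ((m₁.writeNat (varAddr 73) (s[k] : ℕ)).writeNat (varAddr 76) 0) _ at h2
      have hX2 := (hX1.frame h1.frame).frame h2.frame
      have hI2 := (hI1.frame h1.frame).frame h2.frame
      have g73 : ((m₁.writeNat (varAddr 73) (s[k] : ℕ)).writeNat (varAddr 76) 0).nat (varAddr 73)
          = s[k] := by simp
      have g76 : ((m₁.writeNat (varAddr 73) (s[k] : ℕ)).writeNat (varAddr 76) 0).nat (varAddr 76)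
          = 0 := by simp
      generalize (m₁.writeNat (varAddr 73) (s[k] : ℕ)).writeNat (varAddr 76) 0 = m₂ at *
      set p : ℕ → Prop := fun a => ∃ h : a < q, localWeight I adj Y s[k] ⟨a, h⟩ ≠ 0 with hp
      obtain ⟨m₃, h3, hI3, -⟩ := forLoop_runs (i := 74) (N := .get₁ 0 (.lit 1))
        (body := evalSpin ;;
          .ite (.realEq (.get (.var 17)) (.ofNat (.lit 0))) .skip (.setNat (.var 76) (.var 74)))
        (m := m₂) q q (d * 4 + 8)
        (fun j m' => m'.nat (varAddr 76) = lastBelow p j) le_rfl rfl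
        (by simp [g76, lastBelow])
        (fun j _ m' hf' _ _ => by
          have := (hf'.nat 0 (1, 0, 0, 0)).trans hI2.spins
          simp [this])
        (by
          intro j hj m₃ hf3 hI3 hij
          obtain ⟨m₄, h4, h17⟩ := evalSpin_runs (u := s[k]) (a := ⟨j, hj⟩) (hI2.frame hf3)
            (hX2.frame hf3) (hd _) ((hf3.nat 73 _).trans g73) hij
          have g74 := (h4.frame.nat 74 (0, 0, 0, 0)).trans hij
          have g76' := (h4.frame.nat 76 (0, 0, 0, 0)).trans hI3
          by_cases h0 : localWeight I adj Y s[k] ⟨j, hj⟩ = 0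
          · refine ⟨m₄, (h4.seq (Runs.ite_true ?_ Runs.skip)).mono (by omega), ?_⟩
            · simp [h17, h0]
            · have : ¬ p j := by
                rintro ⟨_, h⟩
                exact h h0
              rw [lastBelow, if_neg this]
              simpa using g76'
          · refine ⟨_, (h4.seq (Runs.ite_false ?_ (Runs.setNat _ _))).mono (by omega), ?_⟩
            · simp [h17, h0]
            · have : p j := ⟨hj, h0⟩
              rw [lastBelow, if_pos this]
              simp [g74])
      have g73' := (h3.frame.nat 73 (0, 0, 0, 0)).trans g73
      have hX3 := hX2.frame h3.frame
      refine ⟨_, (h1.seq (h2.seq (h3.seq (Runs.setNat _ _)))).mono (by ring_nf; omega), ?_⟩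
      have htake : s.take (k + 1) = s.take k ++ [s[k]] := by simp
      rw [htake, repaired_snoc, ← hY]
      intro v
      by_cases hv : v = s[k]
      · subst hv
        simp [g73', hI3, bestSpin, hp]
      · have hv' : (v : ℕ) ≠ s[k] := fun h => hv (Fin.ext h)
        have := hX3 v
        simp [g73', hv, hv', this])
  rw [List.take_length] at hI'
  exact ⟨m', hm'.mono (le_of_eq (by ring)), hI'⟩

/-! ### The first phase -/

/-- Updates the instance, makes the configuration feasible, and pushes the changed vertices and
their neighbours to the stack. -/
def prepare : Cmd :=
  updateVertices ;; updateEdges ;; repair ;; .setNat (.var 26) (.lit 0) ;;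
    .setNat (.var 23) (.get₁ 9 (.lit 0)) ;; expand

/-- A bound for the running time of the first phase. -/
def prepareTime (q d k : ℕ) : ℕ :=
  k * (q * 4 + 19) + k * (2 * (d * 5 + q * (q * 4 + 6)) + 62)
    + 2 * k * (q * (d * 4 + 11) + 12) + 2 * k * (d * 13 + 8) + 19

section Listing

variable {I : SpinSystem n q} {U : Update n q} (L : Listing I U)

/-- The adjacency lists after the update. -/
def Listing.newAdj : Fin n → List (Fin n) := addArcs L.adj (arcs L.de)

/-- The vertices that the update concerns. -/
def Listing.touched : List (Fin n) := pushAll (pushAll [] L.dv) ((arcs L.de).map Prod.fst)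

/-- The stack at the beginning of the main loop. -/
def Listing.initStack : List (Fin n) := pushAll L.touched (L.touched.flatMap L.newAdj)

lemma Listing.nodup_newAdj (v : Fin n) : (L.newAdj v).Nodup := nodup_addArcs L.adj_nodup _ v

lemma Listing.mem_newAdj (v w : Fin n) : w ∈ L.newAdj v ↔ (I.update U).graph.Adj v w := by
  rw [Listing.newAdj, mem_addArcs, mem_arcs, L.mem_de, L.mem_adj]
  simp only [SpinSystem.update, SimpleGraph.sup_adj, SimpleGraph.fromEdgeSet_adj, Finset.mem_coe]
  refine or_congr_right ⟨fun h => ⟨h, ?_⟩, fun h => h.1⟩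
  rintro rfl
  exact U.not_diag _ h rfl

lemma Listing.length_newAdj_le (v : Fin n) : (L.newAdj v).length ≤ (I.update U).maxDegree := by
  classical
  have h1 : (L.newAdj v).toFinset = (I.update U).graph.neighborFinset v := by
    ext w
    simp [L.mem_newAdj]
  rw [← List.toFinset_card_of_nodup (L.nodup_newAdj v), h1,
    SimpleGraph.card_neighborFinset_eq_degree]
  unfold SpinSystem.maxDegree
  convert SimpleGraph.degree_le_maxDegree (I.update U).graph v

lemma length_pushAll_le {α : Type*} [DecidableEq α] (l vs : List α) :
    (pushAll l vs).length ≤ l.length + vs.length := by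
  induction vs using List.reverseRecOn with
  | nil => simp [pushAll]
  | append_singleton vs v ih =>
    rw [pushAll_snoc, List.length_append, List.length_singleton]
    unfold pushNew
    split_ifs
    · omega
    · rw [List.length_append, List.length_singleton]
      omega

lemma Listing.length_dv : L.dv.length = U.DV.card := by
  rw [← List.toFinset_card_of_nodup L.dv_nodup]
  congr 1
  ext v
  simp [L.mem_dv]

lemma Listing.length_de : L.de.length = U.DE.card := by
  rw [← List.length_map (as := L.de) (fun p => s(p.1, p.2)),
    ← List.toFinset_card_of_nodup L.de_nodup]
  congr 1
  ext e
  rw [List.mem_toFinset, L.mem_de]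

lemma length_arcs (de : List (Fin n × Fin n)) : (arcs de).length = 2 * de.length := by
  induction de with
  | nil => rfl
  | cons p de ih =>
    rw [arcs, List.flatMap_cons, List.length_append, ← arcs, ih]
    simp
    omega

lemma Listing.length_touched_le : L.touched.length ≤ 2 * (U.DV.card + U.DE.card) := by
  refine (length_pushAll_le _ _).trans ?_
  have := length_pushAll_le [] L.dv
  rw [List.length_map, length_arcs, L.length_de]
  rw [L.length_dv] at this
  simp at this
  omega

lemma Listing.nodup_initStack : L.initStack.Nodup :=
  nodup_pushAll (nodup_pushAll (nodup_pushAll List.nodup_nil _) _) _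

lemma Listing.hasTables_load (ℓ : ℕ) (X : Conf n q) :
    HasTables I.b L.adj (fun v w => I.A s(v, w)) ℓ (L.load ℓ X) where
  spins := rfl
  dist := rfl
  deg v := by simp [Listing.load]
  nbr v i hi := by simp [Listing.load, hi]
  vec v a := by simp [Listing.load]
  mat v i hi a c := by simp [Listing.load, hi]

lemma Listing.hasConf_load (ℓ : ℕ) (X : Conf n q) : HasConf X (L.load ℓ X) := fun v => by
  simp [Listing.load]

lemma Listing.hasRows_load (ℓ : ℕ) (X : Conf n q) :
    HasRows (fun _ => ([] : List (Fin n))) (L.load ℓ X) where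
  len _ := rfl
  item _ i hi := absurd hi (by simp)
  mark _ _ := rfl

lemma Listing.prepare_runs [NeZero q] (ℓ : ℕ) (X : Conf n q) {d : ℕ}
    (hd : (I.update U).maxDegree ≤ d) :
    ∃ m', Runs prepare (L.load ℓ X) m' (prepareTime q d (U.DV.card + U.DE.card)) ∧
      Ready (I.update U) L.newAdj ℓ L.initStack
        (repaired (I.update U) L.newAdj L.touched X) m' := by
  set m := L.load ℓ X with hm
  have hd' : ∀ v, (L.newAdj v).length ≤ d := fun v => (L.length_newAdj_le v).trans hd
  obtain ⟨m₁, h1, hT1, hR1⟩ := updateVertices_runs (b' := U.b) (dv := L.dv)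
    (L.hasTables_load ℓ X) (L.hasRows_load ℓ X) rfl
    (fun i hi => by simp [Listing.load, hi]) (fun i hi a => by simp [Listing.load, hi])
  obtain ⟨m₂, h2, hT2, hR2⟩ := updateEdges_runs (A := I.A) (A' := U.A) (de := L.de) (d := d) hT1 hR1
    ((h1.frame.nat 0 _).trans rfl)
    (fun i hi => (h1.frame.nat 5 _).trans (by simp [Listing.load, hi]))
    (fun i hi => (h1.frame.nat 6 _).trans (by simp [Listing.load, hi]))
    (fun i hi a c => (h1.frame.real 3 _).trans (by simp [Listing.load, hi])) hd' L.adj_nodup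
  have hI2 : HasSystem (I.update U) L.newAdj ℓ m₂ := by
    refine ⟨hT2.spins, hT2.dist, hT2.deg, hT2.nbr, fun v a => ?_, fun v i hi a c => ?_⟩
    · rw [hT2.vec v a]
      by_cases hv : v ∈ U.DV
      · simp [SpinSystem.update, hv, (L.mem_dv v).2 hv]
      · simp [SpinSystem.update, hv, (L.mem_dv v).not.2 hv]
    · rw [hT2.mat v i hi a c]
      have hA : ∀ e, (I.update U).A e = if e ∈ U.DE then U.A e else I.A e := fun e => by
        by_cases he : e ∈ U.DE <;> simp [SpinSystem.update, he]
      rw [hA]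
      simp only [mem_arcs, L.mem_de]
      rfl
  have hX2 := ((L.hasConf_load ℓ X).frame h1.frame).frame h2.frame
  set rows : ℕ → List (Fin n) := Function.update (fun _ => []) 0 L.touched with hrows
  have hR2' : HasRows rows m₂ := by
    simpa [hrows, Listing.touched] using hR2
  have hr0 : rows 0 = L.touched := by simp [hrows]
  have hlen := L.length_touched_le
  obtain ⟨m₃, h3, hX3⟩ := repair_runs (B := 2 * (U.DV.card + U.DE.card)) (d := d) hI2 hX2 hR2'
    (by rw [hr0]; exact hlen) hd'
  rw [hr0] at hX3
  have hI3 := hI2.frame h3.frame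
  have hR3 := hR2'.frame h3.frame
  have h4 := Runs.setNat (m := m₃) (.var 26) (.lit 0)
  change Runs _ _ (m₃.writeNat (varAddr 26) 0) _ at h4
  have h5 := Runs.setNat (m := m₃.writeNat (varAddr 26) 0) (.var 23) (.get₁ 9 (.lit 0))
  have e5 : (NExp.get₁ 9 (.lit 0)).eval (m₃.writeNat (varAddr 26) 0) = L.touched.length := by
    have := hR3.len 0
    rw [hr0] at this
    simp [this]
  rw [e5] at h5
  change Runs _ _ ((m₃.writeNat (varAddr 26) 0).writeNat (varAddr 23) L.touched.length) _ at h5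
  have hR5 := (hR3.writeNat (varAddr 26) 0).writeNat (varAddr 23) L.touched.length
  have hI5 := (hI3.frame h4.frame).frame h5.frame
  have hX5 := (hX3.frame h4.frame).frame h5.frame
  obtain ⟨m₆, h6, hR6⟩ := expand_runs (r := 0) (B := 2 * (U.DV.card + U.DE.card)) (d := d) hI5 hR5
    (by simp) (by rw [hr0]; exact hlen) (by simp [hr0]) hd'
  rw [hr0] at hR6
  have hrun := h1.seq (h2.seq (h3.seq (h4.seq (h5.seq h6))))
  -- The counter of rows is still 0, and only row 0 has been used: all other rows are fresh for the
  -- main loop.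
  have h30 : m₆.nat (varAddr 30) = 0 := by
    rw [hrun.frame.nat 30]
    rfl
  refine ⟨m₆, hrun.mono ?_, hI5.frame h6.frame, hX5.frame h6.frame, L.nodup_initStack, _, hR6,
    by simp [Listing.initStack], fun r hr => ?_⟩
  · rw [prepareTime, L.length_dv, L.length_de]
    have e1 : U.DV.card * (q * 4 + 19) ≤ (U.DV.card + U.DE.card) * (q * 4 + 19) :=
      Nat.mul_le_mul_right _ (Nat.le_add_right _ _)
    have e2 : U.DE.card * (2 * (d * 5 + q * (q * 4 + 6)) + 62)
        ≤ (U.DV.card + U.DE.card) * (2 * (d * 5 + q * (q * 4 + 6)) + 62) :=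
      Nat.mul_le_mul_right _ (Nat.le_add_left _ _)
    omega
  · rw [h30] at hr
    simp [hrows, hr.ne']

end Listing

/-! ### The law of the repaired configuration -/

lemma mem_edges {J : SpinSystem n q} {e : Sym2 (Fin n)} : e ∈ J.edges ↔ e ∈ J.graph.edgeSet := by
  simp [SpinSystem.edges]

/-- Permissivity with all spins fixed except that of `u`: some spin of `u` has positive conditional
weight, and the factors of this weight are those of the local weight. -/
lemma exists_localWeight_ne_zero {J : SpinSystem n q} {adj : Fin n → List (Fin n)}
    (hJ : J.Permissive)
    (hadj : ∀ v w, w ∈ adj v ↔ J.graph.Adj v w) (X : Conf n q) (u : Fin n) :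
    ∃ a, localWeight J adj X u a ≠ 0 := by
  classical
  have h := (hJ (Finset.univ.erase u) X).ne'
  obtain ⟨ρ, hρ, h0⟩ := Finset.exists_ne_zero_of_sum_ne_zero h
  rw [SpinSystem.mem_extensions] at hρ
  have hX : ∀ w, w ≠ u → ρ w = X w := fun w hw => hρ w (by simp [hw])
  refine ⟨ρ u, mul_ne_zero ?_ ?_⟩
  · exact Finset.prod_ne_zero_iff.1 (left_ne_zero_of_mul h0) u (by simp)
  · rw [Ne, List.prod_eq_zero_iff, List.mem_map]
    rintro ⟨w, hw, hw0⟩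
    have huw := (hadj u w).1 hw
    refine Finset.prod_ne_zero_iff.1 (right_ne_zero_of_mul h0) s(u, w) ?_ ?_
    · rw [Finset.mem_filter, mem_edges]
      exact ⟨huw, u, by simp, by simp⟩
    · rw [Sym2.map_mk, hX w huw.ne']
      exact hw0

section Repair

variable [NeZero q] {J : SpinSystem n q} {adj : Fin n → List (Fin n)}

lemma repaired_of_notMem {s : List (Fin n)} {v : Fin n} (hv : v ∉ s) (X : Conf n q) :
    repaired J adj s X v = X v := by
  induction s using List.reverseRecOn with
  | nil => rfl
  | append_singleton s u ih =>
    simp only [List.mem_append, List.mem_singleton, not_or] at hv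
    rw [repaired_snoc, Function.update_of_ne hv.2, ih hv.1]

lemma bestSpin_congr {X Y : Conf n q} {u : Fin n} (h : ∀ w ∈ adj u, X w = Y w) :
    bestSpin J adj X u = bestSpin J adj Y u := by
  have : ∀ a, localWeight J adj X u a = localWeight J adj Y u a := by
    intro a
    unfold localWeight
    rw [List.map_congr_left fun w hw => by rw [h w hw]]
  simp only [bestSpin, this]

/-- The new spin of a vertex is a deterministic function of the spins of its neighbours. If these
all lie in Λ, the repair never looks outside of Λ. -/
lemma repaired_congr {s : List (Fin n)} {Λ : Finset (Fin n)} (hadj : ∀ u ∈ s, ∀ w ∈ adj u, w ∈ Λ)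
    {X Y : Conf n q} (h : ∀ v ∈ Λ, X v = Y v) :
    ∀ v ∈ Λ, repaired J adj s X v = repaired J adj s Y v := by
  induction s using List.reverseRecOn with
  | nil => exact h
  | append_singleton s u ih =>
    have ih' := ih fun u hu => hadj u (List.mem_append_left _ hu)
    intro v hv
    rw [repaired_snoc, repaired_snoc,
      bestSpin_congr fun w hw => ih' w (hadj u (by simp) w hw)]
    by_cases hvu : v = u
    · subst hvu
      simp
    · rw [Function.update_of_ne hvu, Function.update_of_ne hvu, ih' v hv]

lemma localWeight_bestSpin_ne_zero (hJ : J.Permissive)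
    (hadj : ∀ v w, w ∈ adj v ↔ J.graph.Adj v w) (X : Conf n q) (u : Fin n) :
    localWeight J adj X u (bestSpin J adj X u) ≠ 0 := by
  obtain ⟨a, ha⟩ := exists_localWeight_ne_zero hJ hadj X u
  obtain ⟨_, h⟩ := lastBelow_spec (p := fun a => ∃ h : a < q, localWeight J adj X u ⟨a, h⟩ ≠ 0)
    a.2 ⟨a.2, ha⟩
  exact h

/-- A later change at `u` cannot spoil a vertex treated before: their common edge is one of the
factors of the local weight of `u`, which is positive for the new spin. -/
lemma repaired_feasible (hJ : J.Permissive) (hadj : ∀ v w, w ∈ adj v ↔ J.graph.Adj v w)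
    (s : List (Fin n)) (X : Conf n q) :
    ∀ v ∈ s, J.b v (repaired J adj s X v) ≠ 0 ∧ ∀ w ∈ adj v,
      J.A s(v, w) s(repaired J adj s X v, repaired J adj s X w) ≠ 0 := by
  induction s using List.reverseRecOn with
  | nil => simp
  | append_singleton s u ih =>
    set Y := repaired J adj s X with hY
    have hloc := localWeight_bestSpin_ne_zero hJ hadj Y u
    set a := bestSpin J adj Y u with ha
    have hb := left_ne_zero_of_mul hloc
    have hA : ∀ w ∈ adj u, J.A s(u, w) s(a, Y w) ≠ 0 := by
      have := right_ne_zero_of_mul hloc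
      rw [Ne, List.prod_eq_zero_iff, List.mem_map] at this
      exact fun w hw h0 => this ⟨w, hw, h0⟩
    rw [repaired_snoc, ← hY, ← ha]
    intro v hv
    by_cases hvu : v = u
    · subst hvu
      refine ⟨by simpa using hb, fun w hw => ?_⟩
      have hne : w ≠ v := ((hadj v w).1 hw).ne'
      simpa [hne] using hA w hw
    · have hvs : v ∈ s := by simpa [hvu] using hv
      refine ⟨by simpa [hvu] using (ih v hvs).1, fun w hw => ?_⟩
      by_cases hwu : w = u
      · subst hwu
        have := hA v ((hadj w v).2 ((hadj v w).1 hw).symm)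
        rw [Sym2.eq_swap, Sym2.eq_swap (a := a)] at this
        simpa [hvu] using this
      · simpa [hvu, hwu] using (ih v hvs).2 w hw

end Repair

namespace Listing

variable {I : SpinSystem n q} {U : Update n q} (L : Listing I U)

lemma mem_touched {v : Fin n} : v ∈ L.touched ↔ v ∈ U.DV ∨ ∃ w, s(v, w) ∈ U.DE := by
  simp only [touched, mem_pushAll, List.not_mem_nil, false_or, L.mem_dv, List.mem_map, Prod.exists,
    exists_and_right, exists_eq_right, mem_arcs, L.mem_de]

lemma mem_initStack {v : Fin n} :
    v ∈ L.initStack ↔ v ∈ L.touched ∨ ∃ u ∈ L.touched, (I.update U).graph.Adj u v := by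
  simp only [initStack, mem_pushAll, List.mem_flatMap, L.mem_newAdj]

lemma notMem_DE {e : Sym2 (Fin n)} {v : Fin n} (hv : v ∈ e) (h : v ∉ L.touched) : e ∉ U.DE := by
  intro he
  obtain ⟨w, rfl⟩ := hv
  exact h (L.mem_touched.2 (Or.inr ⟨w, he⟩))

lemma mem_edges_update {e : Sym2 (Fin n)} {v : Fin n} (hv : v ∈ e) (h : v ∉ L.touched) :
    e ∈ (I.update U).edges ↔ e ∈ I.edges := by
  rw [mem_edges, mem_edges]
  simp [SpinSystem.update, L.notMem_DE hv h]

lemma update_b {v : Fin n} (h : v ∉ L.touched) : (I.update U).b v = I.b v := by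
  have : v ∉ U.DV := fun hv => h (L.mem_touched.2 (Or.inl hv))
  simp [SpinSystem.update, this]

lemma update_A {e : Sym2 (Fin n)} {v : Fin n} (hv : v ∈ e) (h : v ∉ L.touched) :
    (I.update U).A e = I.A e := by
  simp [SpinSystem.update, L.notMem_DE hv h]

variable [NeZero q]

/-- The configuration with which the main loop starts. -/
noncomputable def start (X : Conf n q) : Conf n q := repaired (I.update U) L.newAdj L.touched X

/-- Factors at a touched vertex are positive by the repair; all other factors are factors of the old
weight of `X`. -/
lemma weight_start_ne_zero (hJ : (I.update U).Permissive) {X : Conf n q} (hX : I.weight X ≠ 0) :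
    (I.update U).weight (L.start X) ≠ 0 := by
  have hfeas := repaired_feasible hJ L.mem_newAdj L.touched X
  have hb := Finset.prod_ne_zero_iff.1 (left_ne_zero_of_mul hX)
  have hA := Finset.prod_ne_zero_iff.1 (right_ne_zero_of_mul hX)
  refine mul_ne_zero (Finset.prod_ne_zero_iff.2 fun v _ => ?_)
    (Finset.prod_ne_zero_iff.2 fun e he => ?_)
  · by_cases hv : v ∈ L.touched
    · exact (hfeas v hv).1
    · rw [L.update_b hv, start, repaired_of_notMem hv]
      exact hb v (Finset.mem_univ v)
  · induction e using Sym2.ind with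
    | _ v w =>
      have hvw : (I.update U).graph.Adj v w := mem_edges.1 he
      by_cases hv : v ∈ L.touched
      · exact (hfeas v hv).2 w ((L.mem_newAdj v w).2 hvw)
      by_cases hw : w ∈ L.touched
      · have := (hfeas w hw).2 v ((L.mem_newAdj w v).2 hvw.symm)
        rw [Sym2.eq_swap, Sym2.eq_swap (a := repaired _ _ _ _ w)] at this
        exact this
      rw [L.update_A (Sym2.mem_mk_left v w) hv, Sym2.map_mk, start, repaired_of_notMem hv,
        repaired_of_notMem hw]
      exact hA _ ((L.mem_edges_update (Sym2.mem_mk_left v w) hv).1 he)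

/-- This is why the neighbours of touched vertices are in the stack as well: an edge with an end off
the stack has no touched end, so that neither its matrix nor the spins at its ends have changed. -/
lemma condWeight_start (X : Conf n q) :
    (I.update U).condWeight L.initStack.toFinset (L.start X)
      = I.condWeight L.initStack.toFinset X := by
  classical
  have hmem : ∀ v, v ∉ L.initStack.toFinset → v ∉ L.touched := fun v hv h =>
    hv (List.mem_toFinset.2 (L.mem_initStack.2 (Or.inl h)))
  unfold SpinSystem.condWeight
  congr 1
  · refine Finset.prod_congr rfl fun v hv => ?_
    have := hmem v (Finset.mem_filter.1 hv).2
    rw [L.update_b this, start, repaired_of_notMem this]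
  · refine Finset.prod_congr ?_ fun e he => ?_
    · ext e
      rw [Finset.mem_filter, Finset.mem_filter]
      refine and_congr_left ?_
      rintro ⟨v, hve, hv⟩
      exact L.mem_edges_update hve (hmem v hv)
    · obtain ⟨he, v, hve, hv⟩ := Finset.mem_filter.1 he
      have hvt := hmem v hv
      rw [L.update_A hve hvt]
      congr 1
      refine SpinSystem.map_congr_of_mem fun w hw => ?_
      refine repaired_of_notMem (fun hwt => hv ?_) X
      have he' := (L.mem_edges_update hve hvt).2 he
      rw [List.mem_toFinset, L.mem_initStack]
      refine Or.inr ⟨w, hwt, ?_⟩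
      have hwv : w ≠ v := fun h => hvt (h ▸ hwt)
      rw [mem_edges, (Sym2.mem_and_mem_iff hwv).1 ⟨hw, hve⟩] at he'
      exact he'

/-- If a function has the right expectation under all conditional distributions of the updated
instance given the spins in the stack, then the repaired sample has the right expectation. -/
lemma sum_start_le (hJ : (I.update U).Permissive) {H : Conf n q → ℝ≥0∞} {μ : ℝ≥0∞}
    (hH : ∀ σ, ∑ ρ ∈ SpinSystem.extensions L.initStack.toFinset σ,
        ((I.update U).weight ρ : ℝ≥0∞) * H ρ
      ≤ μ * ∑ ρ ∈ SpinSystem.extensions L.initStack.toFinset σ, ((I.update U).weight ρ : ℝ≥0∞)) :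
    ∑ X, (I.weight X : ℝ≥0∞) * H (L.start X) ≤ μ * ∑ X, (I.weight X : ℝ≥0∞) := by
  classical
  set R := L.initStack.toFinset with hR
  set J := I.update U with hJdef
  have huniv : (Finset.univ : Finset (Conf n q))
      = SpinSystem.extensions ∅ (fun _ => (0 : Fin q)) := by
    ext ρ
    simp [SpinSystem.mem_extensions]
  rw [huniv, SpinSystem.sum_extensions_classes (Finset.empty_subset R),
    SpinSystem.sum_extensions_classes (Finset.empty_subset R) _ fun X => (I.weight X : ℝ≥0∞),
    Finset.mul_sum]
  refine Finset.sum_le_sum fun τ _ => ?_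
  have hw : ∀ X ∈ SpinSystem.extensions R τ, I.weight X = I.innerWeight R τ * I.condWeight R X :=
    fun X hX => by
      rw [I.weight_eq R, I.innerWeight_congr (SpinSystem.mem_extensions.1 hX)]
  -- On a class of samples with fixed spins in the stack the start is constant there and equals the
  -- sample elsewhere, so the class is mapped bijectively onto one class of the new instance.
  have hstart : ∀ X ∈ SpinSystem.extensions R τ, L.start X = SpinSystem.glue R (L.start τ) X := by
    intro X hX
    rw [SpinSystem.mem_extensions] at hX
    funext v
    unfold SpinSystem.glue
    split_ifs with hv
    · refine repaired_congr (Λ := R) (fun u hu w hw => ?_) hX v hv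
      exact List.mem_toFinset.2 (L.mem_initStack.2 (Or.inr ⟨u, hu, (L.mem_newAdj u w).1 hw⟩))
    · refine repaired_of_notMem (fun h => hv ?_) X
      exact List.mem_toFinset.2 (L.mem_initStack.2 (Or.inl h))
  have hsum : ∀ F : Conf n q → ℝ≥0∞,
      ∑ X ∈ SpinSystem.extensions R τ, (I.weight X : ℝ≥0∞) * F (L.start X)
      = I.innerWeight R τ * ∑ ρ ∈ SpinSystem.extensions R (L.start τ),
        (J.condWeight R ρ : ℝ≥0∞) * F ρ := by
    intro F
    rw [SpinSystem.sum_extensions_glue R (L.start τ) τ, Finset.mul_sum]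
    refine Finset.sum_congr rfl fun X hX => ?_
    rw [hw X hX, ← hstart X hX, L.condWeight_start, ENNReal.coe_mul, mul_assoc]
  have hsum' : ∀ F : Conf n q → ℝ≥0∞,
      ∑ ρ ∈ SpinSystem.extensions R (L.start τ), (J.weight ρ : ℝ≥0∞) * F ρ
      = J.innerWeight R (L.start τ) * ∑ ρ ∈ SpinSystem.extensions R (L.start τ),
        (J.condWeight R ρ : ℝ≥0∞) * F ρ := by
    intro F
    rw [Finset.mul_sum]
    refine Finset.sum_congr rfl fun X hX => ?_
    rw [J.weight_eq R, J.innerWeight_congr (SpinSystem.mem_extensions.1 hX), ENNReal.coe_mul,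
      mul_assoc]
  have hone := hsum fun _ => 1
  have hone' := hsum' fun _ => 1
  simp only [mul_one] at hone hone'
  rw [hsum, hone]
  by_cases h0 : I.innerWeight R τ = 0
  · simp [h0]
  -- A configuration of positive conditional weight in the new instance is the start of a feasible
  -- sample, hence has positive weight; its inner factor is therefore nonzero.
  have hJ0 : J.innerWeight R (L.start τ) ≠ 0 := by
    have hpos := (hJ R (L.start τ)).ne'
    obtain ⟨ρ, hρ, hρ0⟩ := Finset.exists_ne_zero_of_sum_ne_zero hpos
    have hX : L.start (SpinSystem.glue R τ ρ) = ρ := by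
      rw [SpinSystem.mem_extensions] at hρ
      rw [hstart _ (by simp +contextual [SpinSystem.mem_extensions, SpinSystem.glue])]
      funext v
      by_cases hv : v ∈ R <;> simp [SpinSystem.glue, hv, hρ]
    have hmem : SpinSystem.glue R τ ρ ∈ SpinSystem.extensions R τ := by
      simp +contextual [SpinSystem.mem_extensions, SpinSystem.glue]
    have h1 : I.weight (SpinSystem.glue R τ ρ) ≠ 0 := by
      rw [hw _ hmem, ← L.condWeight_start, hX]
      exact mul_ne_zero h0 hρ0
    have h2 := L.weight_start_ne_zero hJ h1
    rw [hX, SpinSystem.weight_eq _ R, SpinSystem.innerWeight_congr _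
      (SpinSystem.mem_extensions.1 hρ)] at h2
    exact left_ne_zero_of_mul h2
  -- The old and the new class differ by their inner factors only; the new one cancels, the old one
  -- is multiplied back.
  have key := hH (L.start τ)
  rw [hsum', hone', mul_left_comm, ENNReal.mul_le_mul_iff_right (by exact_mod_cast hJ0)
    ENNReal.coe_ne_top] at key
  rw [mul_left_comm]
  exact mul_le_mul_right key _

end Listing

/-! ### The algorithm -/

/-- The algorithm. -/
def dynamicSampler : Cmd := prepare ;; mainLoop

lemma gibbs_apply (I : SpinSystem n q) (hZ : I.Z ≠ 0) (X : Conf n q) :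
    I.gibbs hZ X = (I.weight X : ℝ≥0∞) / I.Z := by
  rw [← ENNReal.coe_div hZ]
  rfl

section Dynamic

variable [NeZero q] {I : SpinSystem n q} {U : Update n q} (L : Listing I U) {ℓ : ℕ}

lemma dynamicSampler_wp_le {κ : ℝ≥0∞} {f : Memory → ℝ≥0∞} {X : Conf n q} {c : ℝ≥0∞} {d : ℕ}
    (hd : (I.update U).maxDegree ≤ d)
    (h : ∀ m, Ready (I.update U) L.newAdj ℓ L.initStack (L.start X) m → wp κ mainLoop f m ≤ c) :
    wp κ dynamicSampler f (L.load ℓ X)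
      ≤ κ * (prepareTime q d (U.DV.card + U.DE.card) + 1 : ℕ) + c := by
  obtain ⟨m, hrun, hready⟩ := L.prepare_runs ℓ X hd
  rw [dynamicSampler, wp]
  refine (add_le_add_right ((hrun.wp_le κ _).trans (add_le_add_right (h m hready) _)) κ).trans ?_
  push_cast
  refine le_of_eq ?_
  ring

/-- Both phases composed: `sum_sampler_le` supplies, for every boundary condition on the initial
stack, the hypothesis of `sum_start_le`; dividing by the old partition function gives the
expectation over the input sample. -/
lemma expect_dynamicSampler_le (hZ : I.Z ≠ 0) (hperm : (I.update U).Permissive)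
    (hssm : (I.update U).RatioSSM ℓ) (hℓ : 1 ≤ ℓ) {f : Memory → ℝ≥0∞} {g : Conf n q → ℝ≥0∞}
    {μ : ℝ≥0∞} (hfg : ∀ X m, HasConf X m → f m ≤ g X)
    (hμ : ∑ ρ, ((I.update U).weight ρ : ℝ≥0∞) * g ρ
      ≤ μ * ∑ ρ, ((I.update U).weight ρ : ℝ≥0∞)) :
    expect ((I.gibbs hZ).map (L.load ℓ)) (wp 0 dynamicSampler f) ≤ μ := by
  have h1 : ∀ X, wp 0 dynamicSampler f (L.load ℓ X)
      ≤ sampler (I.update U) L.newAdj ℓ g L.initStack (L.start X) := by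
    intro X
    refine (dynamicSampler_wp_le L le_rfl fun m hm => mainLoop_wp_le_sampler hperm hssm
      L.mem_newAdj L.nodup_newAdj hℓ (fun X m h => hfg X m h.hasConf) hm).trans ?_
    rw [zero_mul, zero_add]
  rw [expect_map]
  refine (expect_mono _ h1).trans ?_
  have h2 := L.sum_start_le hperm fun σ =>
    sum_sampler_le hperm hssm hℓ L.mem_newAdj hμ L.nodup_initStack σ
  have hZ' : (I.Z : ℝ≥0∞) = ∑ X, (I.weight X : ℝ≥0∞) := by
    rw [SpinSystem.Z, ENNReal.ofNNReal_finsetSum]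
  have hZ0 : (I.Z : ℝ≥0∞) ≠ 0 := by exact_mod_cast hZ
  rw [← hZ'] at h2
  rw [expect, tsum_fintype]
  simp only [gibbs_apply, div_eq_mul_inv]
  simp only [mul_right_comm _ (I.Z : ℝ≥0∞)⁻¹]
  rw [← Finset.sum_mul, ← div_eq_mul_inv]
  exact ENNReal.div_le_of_le_mul h2

/-- The bound holds for each single input of positive weight; the randomness of the input serves
only to exclude infeasible ones. -/
lemma dynamicSampler_time (hZ : I.Z ≠ 0) (hperm : (I.update U).Permissive)
    (hssm : (I.update U).RatioSSM ℓ) (hℓ : 1 ≤ ℓ) {D d K : ℕ} (hd : (I.update U).maxDegree ≤ d)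
    (hD : ∀ u, ∀ k ≤ ℓ, (ballList L.newAdj u k).length ≤ D) (hK : q ^ D ≤ K) :
    expectedTime dynamicSampler ((I.gibbs hZ).map (L.load ℓ))
      ≤ (prepareTime q d (U.DV.card + U.DE.card) + 2
        + 5 * (roundTime q D d K + 1) * L.initStack.length : ℕ) := by
  refine (expectedTime_le _ _).trans ?_
  rw [expect_map]
  refine (expect_mono_support _ fun X hX => ?_).trans (expect_const _ _).le
  have hX' : I.weight X ≠ 0 := by
    intro h
    rw [gibbs_apply, h] at hX
    simp at hX
  refine (dynamicSampler_wp_le L hd fun m hm => mainLoop_time hperm hssm L.mem_newAdj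
    L.nodup_newAdj hℓ hD (fun v => (L.length_newAdj_le v).trans hd) hK hm
    (L.weight_start_ne_zero hperm hX')).trans ?_
  rw [one_mul]
  norm_cast
  omega

end Dynamic

/-! ### Arithmetic of the running time. -/

lemma Listing.length_initStack_le {I : SpinSystem n q} {U : Update n q} (L : Listing I U) {d : ℕ}
    (hd : (I.update U).maxDegree ≤ d) :
    L.initStack.length ≤ 2 * (U.DV.card + U.DE.card) * (d + 1) := by
  have h1 := length_pushAll_le L.touched (L.touched.flatMap L.newAdj)
  have h2 := length_flatMap_le (fun v => (L.length_newAdj_le v).trans hd) L.touched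
  refine h1.trans ((Nat.add_le_add_left h2 _).trans ?_)
  calc _ = L.touched.length * (d + 1) := by ring
    _ ≤ _ := Nat.mul_le_mul_right _ L.length_touched_le

/-- With all parameters replaced by `K` the cost is a polynomial of degree 4 in `K`; 314 is the sum
of its coefficients. -/
lemma roundTime_le {q D d K : ℕ} (hq : q ≤ K) (hD : D ≤ K) (hd : d ≤ K) (hK : 1 ≤ K) :
    roundTime q D d K ≤ 314 * K ^ 4 := by
  have h : roundTime q D d K ≤ roundTime K K K K := by
    unfold roundTime
    gcongr
  refine h.trans ?_
  unfold roundTime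
  have h3 : K ^ 3 ≤ K ^ 4 := Nat.pow_le_pow_right hK (by norm_num)
  have h2 : K ^ 2 ≤ K ^ 4 := Nat.pow_le_pow_right hK (by norm_num)
  have h1 : K ≤ K ^ 4 := Nat.le_self_pow (by norm_num) K
  have h0 : 1 ≤ K ^ 4 := Nat.one_le_pow _ _ hK
  ring_nf at *
  omega

/-- The cost becomes linear in `M` and at most quadratic in `K`; 230 is the sum of the coefficients.
-/
lemma prepareTime_le {q d K k M : ℕ} (hq : q ≤ K) (hd : d ≤ K) (hK : 1 ≤ K) (hk : k ≤ M)
    (hM : 1 ≤ M) : prepareTime q d k ≤ 230 * (M * K ^ 4) := by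
  have h : prepareTime q d k ≤ prepareTime K K M := by
    unfold prepareTime
    gcongr
  refine h.trans ?_
  unfold prepareTime
  have h2 : M * K ^ 2 ≤ M * K ^ 4 :=
    Nat.mul_le_mul_left _ (Nat.pow_le_pow_right hK (by norm_num))
  have h1 : M * K ≤ M * K ^ 4 := Nat.mul_le_mul_left _ (Nat.le_self_pow (by norm_num) K)
  have h0 : M ≤ M * K ^ 4 := Nat.le_mul_of_pos_right _ (Nat.pow_pos hK)
  ring_nf at *
  omega

/-- Put K = q^(2Δ^ℓ). Rounds and preparation cost at most 6532·ΔM·K^4, where 6532 = 230 + 2 +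
5·315·4. As 6532 ≤ 2^13 ≤ K^13, the constant is absorbed and the total is at most ΔM·K^17, whose
exponent is 17·2Δ^ℓ = 34Δ^ℓ. -/
lemma total_time_le {q ℓ Δ k M s : ℕ} (hq : 2 ≤ q) (hΔ : 1 ≤ Δ) (hℓ : 1 ≤ ℓ) (hk : k ≤ M)
    (hM : 1 ≤ M) (hs : s ≤ 2 * k * (Δ + 1)) :
    prepareTime q Δ k + 2
        + 5 * (roundTime q (2 * Δ ^ ℓ) Δ (q ^ (2 * Δ ^ ℓ)) + 1) * s
      ≤ Δ * M * q ^ (34 * Δ ^ ℓ) := by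
  set D := 2 * Δ ^ ℓ with hD
  set K := q ^ D with hK
  have hD1 : 2 ≤ D := by
    have := Nat.one_le_pow ℓ Δ hΔ
    omega
  have hΔD : Δ ≤ D := by
    have := Nat.le_self_pow (n := ℓ) (by omega) Δ
    omega
  have hDK : D ≤ K := (Nat.lt_two_pow_self).le.trans (Nat.pow_le_pow_left hq D)
  have hqK : q ≤ K := Nat.le_self_pow (by omega) q
  have hK2 : 2 ≤ K := hq.trans hqK
  have hr := roundTime_le (K := K) hqK hDK (hΔD.trans hDK) (by omega)
  have hp := prepareTime_le (K := K) (k := k) (M := M) hqK (hΔD.trans hDK) (by omega) hk hM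
  have hs' : s ≤ 4 * (Δ * M) := by
    refine hs.trans ?_
    calc 2 * k * (Δ + 1) ≤ 2 * M * (Δ + Δ) := by gcongr
      _ = _ := by ring
  have hK4 : 1 ≤ K ^ 4 := Nat.one_le_pow _ _ (by omega)
  have hΔM : 1 ≤ Δ * M := Nat.mul_pos hΔ hM
  have hMΔ : M ≤ Δ * M := Nat.le_mul_of_pos_left M hΔ
  have e : q ^ (34 * Δ ^ ℓ) = K ^ 4 * K ^ 13 := by
    rw [hK, ← pow_mul, ← pow_mul, ← pow_add, hD]
    congr 1
    ring
  have h13 : 8192 ≤ K ^ 13 := by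
    calc 8192 = 2 ^ 13 := by norm_num
      _ ≤ K ^ 13 := Nat.pow_le_pow_left hK2 13
  calc _ ≤ 230 * (Δ * M * K ^ 4) + 2 * (Δ * M * K ^ 4)
        + 5 * (314 * K ^ 4 + K ^ 4) * (4 * (Δ * M)) := by
        refine Nat.add_le_add (Nat.add_le_add (hp.trans (by gcongr)) ?_) (by gcongr)
        have := Nat.mul_le_mul hΔM hK4
        omega
    _ = Δ * M * K ^ 4 * 6532 := by ring
    _ ≤ Δ * M * K ^ 4 * K ^ 13 := Nat.mul_le_mul_left _ (by omega)
    _ = _ := by rw [e]; ring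

section Dynamic

variable [NeZero q] {I : SpinSystem n q} {U : Update n q} (L : Listing I U) {ℓ : ℕ}

lemma expectedTime_dynamicSampler_le (hq : 2 ≤ q) (hZ : I.Z ≠ 0)
    (hperm : (I.update U).Permissive) (hssm : (I.update U).RatioSSM ℓ) (hℓ : 1 ≤ ℓ) :
    expectedTime dynamicSampler ((I.gibbs hZ).map (L.load ℓ))
      ≤ ((max (I.update U).maxDegree 1 * max (U.DV.card + U.DE.card) 1
          * q ^ (34 * max (I.update U).maxDegree 1 ^ ℓ) : ℕ) : ℝ≥0∞) := by
  set Δ := max (I.update U).maxDegree 1 with hΔ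
  have hΔ1 : 1 ≤ Δ := le_max_right _ _
  have hd : (I.update U).maxDegree ≤ Δ := le_max_left _ _
  refine (dynamicSampler_time L hZ hperm hssm hℓ (D := 2 * Δ ^ ℓ) (d := Δ) hd
    (fun u k hk => ?_) le_rfl).trans ?_
  · exact (length_ballList_le L.mem_newAdj hΔ1 (fun v => (L.length_newAdj_le v).trans hd) k).trans
      (Nat.mul_le_mul_left 2 (Nat.pow_le_pow_right hΔ1 hk))
  · exact Nat.cast_le.2 (total_time_le hq hΔ1 hℓ (le_max_left _ _) (le_max_right _ _)
      (L.length_initStack_le hd))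

lemma haltProb_dynamicSampler (hZ : I.Z ≠ 0) (hperm : (I.update U).Permissive)
    (hssm : (I.update U).RatioSSM ℓ) (hℓ : 1 ≤ ℓ)
    (htime : expectedTime dynamicSampler ((I.gibbs hZ).map (L.load ℓ)) ≠ ∞) (Y : Conf n q) :
    haltProb dynamicSampler ((I.gibbs hZ).map (L.load ℓ)) (holding Y)
      = ((I.update U).gibbsProb Y : ℝ≥0∞) := by
  classical
  have hinj : ∀ (Y X : Conf n q) m, HasConf X m → m ∈ holding Y → Y = X := fun Y X m hX hY =>
    funext fun v => Fin.ext ((hY v).symm.trans (hX v))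
  -- A feasible configuration of the old instance exists, and the repair makes it feasible for the
  -- new one.
  have hZ' : (I.update U).Z ≠ 0 := by
    obtain ⟨X, -, hX⟩ := Finset.exists_ne_zero_of_sum_ne_zero hZ
    intro h0
    exact L.weight_start_ne_zero hperm hX (Finset.sum_eq_zero_iff.1 h0 _ (Finset.mem_univ _))
  have hZsum : ((I.update U).Z : ℝ≥0∞) = ∑ X, ((I.update U).weight X : ℝ≥0∞) := by
    rw [SpinSystem.Z, ENNReal.ofNNReal_finsetSum]
  refine haltProb_eq dynamicSampler _ holding (fun X X' m h h' => hinj X X' m h' h)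
    (fun Y => (I.update U).gibbsProb Y) ?_ (fun Y t => ?_) (fun t => ?_) htime Y
  · simp only [SpinSystem.gibbsProb]
    rw [← Finset.sum_div]
    exact div_self hZ'
  · refine (halted_le _ _ _ t).trans (expect_dynamicSampler_le L hZ hperm hssm hℓ
      (g := fun X => if X = Y then 1 else 0) (fun X m hX => ?_) ?_)
    · by_cases hm : m ∈ holding Y
      · rw [if_pos hm, if_pos (hinj Y X m hX hm).symm]
      · simp [hm]
    · rw [← hZsum, ← ENNReal.coe_mul, SpinSystem.gibbsProb, div_mul_cancel₀ _ hZ']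
      simp
  -- Memories between rounds always hold a configuration, so the event of holding none is bounded
  -- with g = 0 and μ = 0.
  · refine le_antisymm ((halted_le _ _ {m | ∀ Y, m ∉ holding Y} t).trans
      (expect_dynamicSampler_le L hZ hperm hssm hℓ (g := fun _ => 0) (fun X m hX => ?_)
        (by simp))) zero_le
    have : ¬ ∀ Y, m ∉ holding (n := n) (q := q) Y := fun h => h X hX
    simp [this]

end Dynamic

end DynamicSampling

theorem mainTheorem7 :
    ∃ (P : DynamicSampling.Cmd) (C : ℕ),
      ∀ (𝔍 : ∀ n q : ℕ, Set (DynamicSampling.SpinSystem n q)) (ell : ℕ → ℕ),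
        (∀ (n q : ℕ) (J : DynamicSampling.SpinSystem n q), J ∈ 𝔍 n q →
          J.Permissive ∧ 2 ≤ ell q ∧ J.RatioSSM (ell q)) →
        ∀ (n q : ℕ), 2 ≤ q →
        ∀ (I : DynamicSampling.SpinSystem n q) (hZ : I.Z ≠ 0)
          (U : DynamicSampling.Update n q) (L : DynamicSampling.Listing I U),
          I.update U ∈ 𝔍 n q →
          (∀ Y : DynamicSampling.Conf n q,
            DynamicSampling.haltProb P ((I.gibbs hZ).map (L.load (ell q)))
                (DynamicSampling.holding Y)
              = ((I.update U).gibbsProb Y : ENNReal)) ∧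
          DynamicSampling.expectedTime P ((I.gibbs hZ).map (L.load (ell q)))
            ≤ ((max (I.update U).maxDegree 1 * max (U.DV.card + U.DE.card) 1
                * q ^ (C * max (I.update U).maxDegree 1 ^ (ell q)) : ℕ) : ENNReal) := by
  refine ⟨DynamicSampling.dynamicSampler, 34, ?_⟩
  intro 𝔍 ell h𝔍 n q hq I hZ U L hU
  have : NeZero q := ⟨by omega⟩
  obtain ⟨hperm, hℓ2, hssm⟩ := h𝔍 n q _ hU
  have hℓ : 1 ≤ ell q := by omega
  have htime := DynamicSampling.expectedTime_dynamicSampler_le L hq hZ hperm hssm hℓ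
  exact ⟨DynamicSampling.haltProb_dynamicSampler L hZ hperm hssm hℓ
    (ne_top_of_le_ne_top (ENNReal.natCast_ne_top _) htime), htime⟩
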